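/- Let $q:(0,\infty)\to\mathbb R$ satisfy $q\in L^1_{\mathrm{loc}}((0,\infty))$ and $\int_0^1 x(1-\log x)\,|q(x)|\,dx<\infty$. For $z\in\mathbb C$ and $x,y>0$ put $$\phi_{-1/2}(z,x)=\sqrt{\tfrac{\pi x}{2}}\,J_0(\sqrt z\,x),\qquad \theta_{-1/2}(z,x)=\sqrt{\tfrac{\pi x}{2}}\Big(\tfrac1\pi\log(z)J_0(\sqrt z\,x)-Y_0(\sqrt z\,x)\Big)$$ (principal branches; the singularity of $\theta_{-1/2}(\cdot,x)$ at $z=0$ is removable and $\theta_{-1/2}(0,x)$ is the limit), where $J_0,Y_0$ are the Bessel and Neumann functions, and $$G_{-1/2}(z,x,y)=\phi_{-1/2}(z,x)\theta_{-1/2}(z,y)-\phi_{-1/2}(z,y)\theta_{-1/2}(z,x).$$ Let $\phi(z,x)$ be the regular solution of $-f''-\frac{1}{4x^2}f+q(x)f=zf$ on $(0,\infty)$, that is, for each $z\in\mathbb C$, the solution of the form $\phi(z,x)=\sqrt{\pi x/2}\;\tilde\phi(z,x)$ with $\tilde\phi(z,\cdot)\in W^{1,1}[0,1]$ and $\tilde\phi(z,0)=1$.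 This solution exists, and for every $x>0$ the function $\phi(\cdot,x)$ is entire; moreover $k\mapsto\phi_{-1/2}(k^2,x)$ and $k\mapsto G_{-1/2}(k^2,x,y)$ are entire for $0<y\le x$. For all $k\in\mathbb C$ and $x>0$, $\partial_k\phi(k^2,x)$ satisfies the integral equation $$\partial_k\phi(k^2,x)=\partial_k\phi_{-1/2}(k^2,x)+\int_0^x\big[\partial_kG_{-1/2}(k^2,x,y)\,\phi(k^2,y)+G_{-1/2}(k^2,x,y)\,\partial_k\phi(k^2,y)\big]q(y)\,dy,$$ where the integral converges absolutely. Moreover, for every $b>0$ there is a constant $C$, depending only on $q$ and $b$, such that for all $k\in\mathbb C$ and $0<x\le b$ $$\big|\partial_k\phi(k^2,x)-\partial_k\phi_{-1/2}(k^2,x)\big|\le C\,|k|\,x\Big(\frac{x}{1+|k|x}\Big)^{3/2}e^{|\mathrm{Im}\,k|\,x}\int_0^x\frac{y}{1+|k|y}\Big(1+\log\frac xy\Big)|q(y)|\,dy .$$ -/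

import Mathlib

open MeasureTheory Set

noncomputable section

namespace RadialSchrodinger

/-- The Bessel function of the first kind of order zero,
`J₀(z) = ∑ (-z²/4)ⁿ / (n!)²`. -/
def besselJ0 (z : ℂ) : ℂ :=
  ∑' n : ℕ, (-z ^ 2 / 4) ^ n / ((n.factorial : ℂ) ^ 2)

/-- The Neumann function (Bessel function of the second kind) of order zero,
`Y₀(z) = (2/π) log(z/2) J₀(z) - (2/π) ∑ ψ(n+1) (-z²/4)ⁿ / (n!)²`, with `ψ` the digamma function
and the principal branch of the logarithm. -/
def besselY0 (z : ℂ) : ℂ :=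
  2 / (Real.pi : ℂ) * Complex.log (z / 2) * besselJ0 z
    - 2 / (Real.pi : ℂ) *
      ∑' n : ℕ, Complex.digamma ((n : ℂ) + 1) * ((-z ^ 2 / 4) ^ n / ((n.factorial : ℂ) ^ 2))

/-- `φ_{-1/2}(z,x) = √(πx/2) J₀(√z x)`, the regular solution for `q = 0`. -/
def phi0 (z : ℂ) (x : ℝ) : ℂ :=
  (Real.sqrt (Real.pi * x / 2) : ℂ) * besselJ0 (z ^ (1 / 2 : ℂ) * x)

/-- `θ_{-1/2}(z,x) = √(πx/2) ((1/π) log(z) J₀(√z x) - Y₀(√z x))`, principal branches. The singularity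
of this expression at `z = 0` is removable, and the value there is the limit
`-√(2x/π) (log(x/2) + γ)`, with `γ` the Euler–Mascheroni constant. -/
def theta0 (z : ℂ) (x : ℝ) : ℂ :=
  if z = 0 then
    ((-Real.sqrt (2 * x / Real.pi) * (Real.log (x / 2) + Real.eulerMascheroniConstant) : ℝ) : ℂ)
  else
    (Real.sqrt (Real.pi * x / 2) : ℂ) *
      (1 / (Real.pi : ℂ) * Complex.log z * besselJ0 (z ^ (1 / 2 : ℂ) * x)
        - besselY0 (z ^ (1 / 2 : ℂ) * x))

/-- `G_{-1/2}(z,x,y) = φ_{-1/2}(z,x) θ_{-1/2}(z,y) - φ_{-1/2}(z,y) θ_{-1/2}(z,x)`. -/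
def green0 (z : ℂ) (x y : ℝ) : ℂ :=
  phi0 z x * theta0 z y - phi0 z y * theta0 z x

/-- `q ∈ L¹_loc((0,∞))` and `∫₀¹ x (1 - log x) |q(x)| dx < ∞`. -/
def AdmissiblePotential (q : ℝ → ℝ) : Prop :=
  LocallyIntegrableOn q (Ioi 0) ∧
    IntegrableOn (fun x : ℝ => x * (1 - Real.log x) * |q x|) (Ioc 0 1)

/-- `f` solves `-f'' - f/(4x²) + q f = z f` on `(0,∞)`: `f` is differentiable with locally absolutely
continuous derivative `g`, and the equation holds almost everywhere. -/
def IsSolution (q : ℝ → ℝ) (z : ℂ) (f : ℝ → ℂ) : Prop :=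
  ∃ g : ℝ → ℂ,
    (∀ x : ℝ, 0 < x → HasDerivAt f (g x) x) ∧
    (∀ a b : ℝ, 0 < a → a ≤ b → AbsolutelyContinuousOnInterval g a b) ∧
    ∀ᵐ x : ℝ ∂(volume.restrict (Ioi 0)), ∃ f'' : ℂ, HasDerivAt g f'' x ∧
      -f'' - 1 / (4 * (x : ℂ) ^ 2) * f x + (q x : ℂ) * f x = z * f x

/-- `φ` is the regular solution: for each `z`, `φ(z,·)` solves the equation on `(0,∞)` and
`φ(z,x) = √(πx/2) φ̃(z,x)` with `φ̃(z,·) ∈ W^{1,1}[0,1]` (that is, absolutely continuous on `[0,1]`)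
and `φ̃(z,0) = 1`. Only the values `φ z x` with `0 < x` matter. -/
def IsRegularSolution (q : ℝ → ℝ) (φ : ℂ → ℝ → ℂ) : Prop :=
  ∀ z : ℂ, IsSolution q z (φ z) ∧
    AbsolutelyContinuousOnInterval
      (fun x : ℝ => if x = 0 then 1 else φ z x / (Real.sqrt (Real.pi * x / 2) : ℂ)) 0 1

end RadialSchrodinger

end

open MeasureTheory Set

noncomputable section

namespace RadialSchrodinger

/-! Write φ(z,x) = √(πx/2) u(z,x). The equation becomes x(xu')' = x²(q − z)u, and for q = 0 it has
the solutions `alpha` = J₀(√z x) and `beta`, the latter with a logarithm at x = 0. Both are power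
series in −zx²/4, up to log x, so no branch of √z or log z survives. The free Green function is
√(πx/2) √(πy/2) (2/π) times `kernel`, the antisymmetric combination of `alpha` and `beta`.

Existence and analyticity. Integrating twice, φ is regular exactly when u = 1 + ∫₀ˣ s⁻¹ ∫₀ˢ y (q −
z) u dy ds. The logarithmic moment condition on q makes this a Volterra operator on C([0,b]), hence
quasinilpotent. It is affine in z, so u = (1 − T(z))⁻¹ 1 is an entire function of z with values in
C([0,b]). This gives existence, uniqueness, and bounds on u and ∂_z u that are uniform in x and
locally uniform in z.

Integral equation. Lagrange's identity between u and the kernel gives u(x) = α(x) + ∫₀ˣ y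
kernel(x,y) u(y) q(y) dy (`IsVolterraSolution.green_equation`). The uniform bounds and the
logarithmic bound on the kernel allow differentiation in z under the integral
(`deriv_green_equation`), and the chain rule with z = k² finishes.

Estimate. No Bessel asymptotics are used. For |k|x ≤ 1 the series are bounded on a compact set.
Beyond that, an energy inequality for F = √x u propagates the bounds with decay (|k|x)^(−1/2) and
growth e^(|Im k| x) (`free_growth`). Derivatives in z are reduced to derivatives in x and y by
homogeneity (`two_mul_kernelZ`). The resulting bounds (`alpha_bound`, `kernel_bound`) feed a
weighted Grönwall inequality, used once for u and once for 2k ∂_z u. Inserting both a priori bounds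
into the differentiated equation yields the claim. -/

/-! ### Power series of Bessel type and their differential equations -/

/-- The coefficient sequence `c` grows at most exponentially. -/
def ExpGrowth (c : ℕ → ℂ) : Prop := ∃ K r : ℝ, 0 ≤ K ∧ 0 ≤ r ∧ ∀ n, ‖c n‖ ≤ K * r ^ n

/-- The power series `∑ cₙ sⁿ / (n!)²`. -/
def besselSeries (c : ℕ → ℂ) (s : ℂ) : ℂ := ∑' n : ℕ, c n * (s ^ n / ((n.factorial : ℂ) ^ 2))

/-- The coefficients of the derivative of a Bessel type series. -/
def shiftCoeff (c : ℕ → ℂ) (n : ℕ) : ℂ := c (n + 1) / (n + 1)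

theorem ExpGrowth.shift {c : ℕ → ℂ} (hc : ExpGrowth c) : ExpGrowth (shiftCoeff c) := by
  obtain ⟨K, r, hK, hr, h⟩ := hc
  refine ⟨K * r, r, by positivity, hr, fun n => ?_⟩
  have h1 : (1 : ℝ) ≤ ‖(n + 1 : ℂ)‖ := by
    have : ‖((n + 1 : ℕ) : ℂ)‖ = (n + 1 : ℕ) := Complex.norm_natCast _
    push_cast at this
    rw [this]; linarith [n.cast_nonneg (α := ℝ)]
  rw [shiftCoeff, norm_div]
  calc _ ≤ ‖c (n + 1)‖ := div_le_self (norm_nonneg _) h1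
    _ ≤ _ := h _
    _ = _ := by ring

theorem ExpGrowth.natMul {c : ℕ → ℂ} (hc : ExpGrowth c) : ExpGrowth (fun n => n * c n) := by
  obtain ⟨K, r, hK, hr, h⟩ := hc
  refine ⟨K, 2 * r, hK, by positivity, fun n => ?_⟩
  have h1 : (n : ℝ) ≤ 2 ^ n := by exact_mod_cast Nat.lt_two_pow_self.le
  rw [norm_mul, Complex.norm_natCast]
  calc _ ≤ (2 : ℝ) ^ n * (K * r ^ n) := by gcongr; exact h n
    _ = _ := by rw [mul_pow]; ring

theorem summable_besselSeries_term {K r : ℝ} (R : ℝ) (hK : 0 ≤ K) (hr : 0 ≤ r) (hR : 0 ≤ R) :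
    Summable fun n : ℕ => K * r ^ n * (R ^ n / ((n.factorial : ℝ) ^ 2)) := by
  refine Summable.of_nonneg_of_le (fun n => by positivity) (fun n => ?_)
    ((Real.summable_pow_div_factorial (r * R)).mul_left K)
  have h1 : (1 : ℝ) ≤ n.factorial := by exact_mod_cast n.factorial_pos
  rw [mul_pow, mul_assoc, mul_div_assoc, ]
  gcongr
  nlinarith

theorem ExpGrowth.summable {c : ℕ → ℂ} (hc : ExpGrowth c) (s : ℂ) :
    Summable fun n : ℕ => c n * (s ^ n / ((n.factorial : ℂ) ^ 2)) := by
  obtain ⟨K, r, hK, hr, h⟩ := hc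
  refine Summable.of_norm_bounded (summable_besselSeries_term ‖s‖ hK hr (norm_nonneg _))
    fun n => ?_
  rw [norm_mul, norm_div, norm_pow, norm_pow, Complex.norm_natCast]
  gcongr
  exact h n

/-- Termwise differentiation: n/(n!)² = 1/(n ((n−1)!)²), which explains the division in
`shiftCoeff`. Since n cₙ still grows at most exponentially, the differentiated terms have a summable
majorant on the ball of radius ‖s‖ + 1. -/
theorem hasDerivAt_besselSeries {c : ℕ → ℂ} (hc : ExpGrowth c) (s : ℂ) :
    HasDerivAt (besselSeries c) (besselSeries (shiftCoeff c) s) s := by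
  have hc0 := hc
  have hc' := hc.natMul
  obtain ⟨K, r, hK, hr, h⟩ := hc'
  set R : ℝ := ‖s‖ + 1
  have hR : 1 ≤ R := by simp [R]
  have key := hasDerivAt_tsum_of_isPreconnected (t := Metric.ball (0 : ℂ) R)
    (g := fun (n : ℕ) (s : ℂ) => c n * (s ^ n / ((n.factorial : ℂ) ^ 2)))
    (g' := fun (n : ℕ) (s : ℂ) => c n * ((n * s ^ (n - 1)) / ((n.factorial : ℂ) ^ 2)))
    (y₀ := 0) (y := s)
    (summable_besselSeries_term R hK hr (by positivity)) Metric.isOpen_ball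
    (convex_ball _ _).isPreconnected
    (fun n y _ => ((hasDerivAt_pow n y).div_const _).const_mul _) ?_
    (by simp [Metric.mem_ball]; positivity) (hc0.summable 0) (by simp [R])
  · refine key.congr_deriv ?_
    rw [besselSeries, Summable.tsum_eq_zero_add]
    · simp only [Nat.cast_zero, zero_mul, zero_div, mul_zero, zero_add, shiftCoeff]
      refine tsum_congr fun n => ?_
      have h1 : (n + 1 : ℂ) ≠ 0 := Nat.cast_add_one_ne_zero n
      have h2 : (n.factorial : ℂ) ≠ 0 := by exact_mod_cast n.factorial_ne_zero
      simp only [Nat.factorial_succ, Nat.add_sub_cancel]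
      push_cast
      field_simp
    · refine (summable_nat_add_iff 1).1 ((hc0.shift.summable s).congr fun n => ?_)
      have h1 : (n + 1 : ℂ) ≠ 0 := Nat.cast_add_one_ne_zero n
      have h2 : (n.factorial : ℂ) ≠ 0 := by exact_mod_cast n.factorial_ne_zero
      simp only [Nat.factorial_succ, Nat.add_sub_cancel, shiftCoeff]
      push_cast
      field_simp
  · intro n y hy
    rw [mem_ball_zero_iff] at hy
    have hn := h n
    rw [norm_mul, Complex.norm_natCast] at hn
    rw [norm_mul, norm_div, norm_mul, norm_pow, norm_pow, Complex.norm_natCast,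
      Complex.norm_natCast, mul_div_assoc, ← mul_assoc, mul_comm ‖c n‖]
    have : ‖y‖ ^ (n - 1) ≤ R ^ n :=
      (pow_le_pow_left₀ (norm_nonneg _) hy.le _).trans (pow_le_pow_right₀ hR (Nat.sub_le _ _))
    gcongr

/-- The Euler operator s d/ds multiplies the n-th coefficient by n. One further derivative then
shifts n cₙ back to cₙ₊₁, and this produces the second order equations below. -/
theorem mul_besselSeries_shift {c : ℕ → ℂ} (hc : ExpGrowth c) (s : ℂ) :
    s * besselSeries (shiftCoeff c) s = besselSeries (fun n => n * c n) s := by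
  rw [besselSeries, besselSeries, (hc.natMul.summable s).tsum_eq_zero_add, ← tsum_mul_left]
  simp only [Nat.cast_zero, zero_mul, zero_add, shiftCoeff]
  refine tsum_congr fun n => ?_
  have h1 : (n + 1 : ℂ) ≠ 0 := Nat.cast_add_one_ne_zero n
  have h2 : (n.factorial : ℂ) ≠ 0 := by exact_mod_cast n.factorial_ne_zero
  simp only [Nat.factorial_succ]
  push_cast
  field_simp
  ring

theorem besselSeries_add {c d : ℕ → ℂ} (hc : ExpGrowth c) (hd : ExpGrowth d) (s : ℂ) :
    besselSeries (fun n => c n + d n) s = besselSeries c s + besselSeries d s := by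
  rw [besselSeries, besselSeries, besselSeries, ← (hc.summable s).tsum_add (hd.summable s)]
  simp only [add_mul]

theorem besselSeries_zero (c : ℕ → ℂ) : besselSeries c 0 = c 0 := by
  rw [besselSeries, tsum_eq_single 0 (fun n hn => by simp [hn])]
  simp

/-- The digamma coefficients `ψ(n+1)`. -/
def digammaCoeff (n : ℕ) : ℂ := Complex.digamma ((n : ℂ) + 1)

theorem digammaCoeff_succ (n : ℕ) :
    digammaCoeff (n + 1) = digammaCoeff n + shiftCoeff (fun _ => 1) n := by
  rw [digammaCoeff, digammaCoeff, shiftCoeff]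
  push_cast
  rw [Complex.digamma_apply_add_one, one_div]
  intro m hm
  have := congrArg Complex.re hm
  simp at this
  have h1 : (0 : ℝ) ≤ n := n.cast_nonneg
  have h2 : (0 : ℝ) ≤ m := m.cast_nonneg
  linarith

theorem expGrowth_one : ExpGrowth (fun _ => 1) := ⟨1, 1, by simp, by simp, by simp⟩

theorem expGrowth_digammaCoeff : ExpGrowth digammaCoeff := by
  refine ⟨‖digammaCoeff 0‖ + 1, 2, by positivity, by simp, fun n => ?_⟩
  have h : ∀ n : ℕ, ‖digammaCoeff n‖ ≤ ‖digammaCoeff 0‖ + n := by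
    intro n
    induction n with
    | zero => simp
    | succ n ih =>
      rw [digammaCoeff_succ]
      have h1 : (1 : ℝ) ≤ ‖(n + 1 : ℂ)‖ := by
        have : ‖((n + 1 : ℕ) : ℂ)‖ = (n + 1 : ℕ) := Complex.norm_natCast _
        push_cast at this
        rw [this]; linarith [n.cast_nonneg (α := ℝ)]
      have h2 : ‖shiftCoeff (fun _ => 1) n‖ ≤ 1 := by
        rw [shiftCoeff, norm_div, norm_one]
        exact div_le_one_of_le₀ h1 (norm_nonneg _)
      refine (norm_add_le _ _).trans ?_
      push_cast
      linarith
  have h1 : (n : ℝ) ≤ 2 ^ n := by exact_mod_cast Nat.lt_two_pow_self.le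
  have h2 : (1 : ℝ) ≤ 2 ^ n := one_le_pow₀ (by norm_num)
  nlinarith [h n, norm_nonneg (digammaCoeff 0)]

/-- `∑ sⁿ / (n!)²`, so that `J₀(w) = serA (-w²/4)`. -/
def serA (s : ℂ) : ℂ := besselSeries (fun _ => 1) s
/-- The derivative of `serA`. -/
def serA' (s : ℂ) : ℂ := besselSeries (shiftCoeff fun _ => 1) s
/-- `∑ ψ(n+1) sⁿ / (n!)²`, the power series in the Neumann function. -/
def serB (s : ℂ) : ℂ := besselSeries digammaCoeff s
/-- The derivative of `serB`. -/
def serB' (s : ℂ) : ℂ := besselSeries (shiftCoeff digammaCoeff) s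

theorem hasDerivAt_serA (s : ℂ) : HasDerivAt serA (serA' s) s :=
  hasDerivAt_besselSeries expGrowth_one s

theorem hasDerivAt_serB (s : ℂ) : HasDerivAt serB (serB' s) s :=
  hasDerivAt_besselSeries expGrowth_digammaCoeff s

/-- This is Bessel's equation of order zero in the variable s = −w²/4: (s A')' = A. -/
theorem hasDerivAt_mul_serA' (s : ℂ) : HasDerivAt (fun s => s * serA' s) (serA s) s := by
  have h1 : (fun s => s * serA' s) = besselSeries (fun n => n * 1) :=
    funext fun s => mul_besselSeries_shift expGrowth_one s
  rw [h1]
  refine (hasDerivAt_besselSeries expGrowth_one.natMul s).congr_deriv ?_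
  rw [serA]
  congr 1
  funext n
  have h1 : (n + 1 : ℂ) ≠ 0 := Nat.cast_add_one_ne_zero n
  simp [shiftCoeff, h1]

/-- The recurrence ψ(n+2) = ψ(n+1) + 1/(n+1) leaves the extra term A'. It is exactly what the term
−log x · A in `beta` compensates. -/
theorem hasDerivAt_mul_serB' (s : ℂ) :
    HasDerivAt (fun s => s * serB' s) (serB s + serA' s) s := by
  have h1 : (fun s => s * serB' s) = besselSeries (fun n => n * digammaCoeff n) :=
    funext fun s => mul_besselSeries_shift expGrowth_digammaCoeff s
  rw [h1]
  refine (hasDerivAt_besselSeries expGrowth_digammaCoeff.natMul s).congr_deriv ?_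
  rw [serB, serA', ← besselSeries_add expGrowth_digammaCoeff expGrowth_one.shift]
  congr 1
  funext n
  have h1 : (n + 1 : ℂ) ≠ 0 := Nat.cast_add_one_ne_zero n
  rw [← digammaCoeff_succ]
  simp [shiftCoeff, h1]

theorem differentiable_serA : Differentiable ℂ serA :=
  fun s => (hasDerivAt_serA s).differentiableAt
theorem differentiable_serB : Differentiable ℂ serB :=
  fun s => (hasDerivAt_serB s).differentiableAt
theorem differentiable_serA' : Differentiable ℂ serA' :=
  fun s => (hasDerivAt_besselSeries expGrowth_one.shift s).differentiableAt
theorem differentiable_serB' : Differentiable ℂ serB' :=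
  fun s => (hasDerivAt_besselSeries expGrowth_digammaCoeff.shift s).differentiableAt

theorem serA_zero : serA 0 = 1 := besselSeries_zero _

theorem serB_zero : serB 0 = -Real.eulerMascheroniConstant := by
  rw [serB, besselSeries_zero, digammaCoeff, Nat.cast_zero, zero_add, Complex.digamma_one]

/-- The Wronskian identity for the two series. -/
theorem serA_serB_wronskian (s : ℂ) :
    serA s ^ 2 + 2 * (s * serA' s) * serB s - 2 * serA s * (s * serB' s) = 1 := by
  have hd : ∀ s, HasDerivAt (fun s => serA s ^ 2 + 2 * (s * serA' s) * serB s
      - 2 * serA s * (s * serB' s)) 0 s := by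
    intro s
    refine ((((hasDerivAt_serA s).pow 2).add
      (((hasDerivAt_mul_serA' s).const_mul 2).mul (hasDerivAt_serB s))).sub
      (((hasDerivAt_serA s).const_mul 2).mul (hasDerivAt_mul_serB' s))).congr_deriv ?_
    push_cast
    ring
  have := is_const_of_deriv_eq_zero (fun s => (hd s).differentiableAt)
    (fun s => (hd s).deriv) s 0
  rw [this]
  simp [serA_zero]

/-! ### Free solutions, their Wronskian, and the Green kernel -/

/-- `J₀(√z x)` as a function of `z` and `x`. -/
def alpha (z : ℂ) (x : ℝ) : ℂ := serA (-z * x ^ 2 / 4)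
/-- A second solution of the free equation, with a logarithmic singularity at `x = 0`. -/
def beta (z : ℂ) (x : ℝ) : ℂ :=
  serB (-z * x ^ 2 / 4) - Real.log x * serA (-z * x ^ 2 / 4)
/-- `x ∂ₓ alpha`. -/
def alpha1 (z : ℂ) (x : ℝ) : ℂ := 2 * ((-z * x ^ 2 / 4) * serA' (-z * x ^ 2 / 4))
/-- `x ∂ₓ beta`. -/
def beta1 (z : ℂ) (x : ℝ) : ℂ :=
  2 * ((-z * x ^ 2 / 4) * serB' (-z * x ^ 2 / 4)) - serA (-z * x ^ 2 / 4)
    - Real.log x * (2 * ((-z * x ^ 2 / 4) * serA' (-z * x ^ 2 / 4)))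
/-- The `z`-derivative of `alpha`. -/
def alphaZ (z : ℂ) (x : ℝ) : ℂ := (-(x : ℂ) ^ 2 / 4) * serA' (-z * x ^ 2 / 4)
/-- The `z`-derivative of `beta`. -/
def betaZ (z : ℂ) (x : ℝ) : ℂ :=
  (-(x : ℂ) ^ 2 / 4) * (serB' (-z * x ^ 2 / 4) - Real.log x * serA' (-z * x ^ 2 / 4))

theorem alpha_wronskian (z : ℂ) (x : ℝ) :
    alpha1 z x * beta z x - alpha z x * beta1 z x = 1 := by
  rw [alpha, beta, alpha1, beta1, ← serA_serB_wronskian (-z * x ^ 2 / 4)]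
  ring

theorem hasDerivAt_arg (z : ℂ) {x : ℝ} (hx : x ≠ 0) :
    HasDerivAt (fun x : ℝ => -z * (x : ℂ) ^ 2 / 4) (2 * (-z * x ^ 2 / 4) / x) x := by
  have h : HasDerivAt (fun w : ℂ => -z * w ^ 2 / 4) (-z * (2 * (x : ℂ)) / 4) (x : ℂ) := by
    simpa using ((hasDerivAt_pow 2 (x : ℂ)).const_mul (-z)).div_const 4
  refine h.comp_ofReal.congr_deriv ?_
  have : (x : ℂ) ≠ 0 := by exact_mod_cast hx
  field_simp

theorem hasDerivAt_argZ (z : ℂ) (x : ℝ) :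
    HasDerivAt (fun z : ℂ => -z * (x : ℂ) ^ 2 / 4) (-(x : ℂ) ^ 2 / 4) z := by
  simpa using (((hasDerivAt_id z).neg).mul_const ((x : ℂ) ^ 2)).div_const 4

theorem hasDerivAt_ofReal_log {x : ℝ} (hx : x ≠ 0) :
    HasDerivAt (fun x : ℝ => (Real.log x : ℂ)) (1 / x) x := by
  have := (Real.hasDerivAt_log hx).ofReal_comp
  simpa using this

theorem hasDerivAt_alpha (z : ℂ) {x : ℝ} (hx : x ≠ 0) :
    HasDerivAt (alpha z) (alpha1 z x / x) x := by
  refine ((hasDerivAt_serA _).comp x (hasDerivAt_arg z hx)).congr_deriv ?_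
  rw [alpha1]; ring

theorem hasDerivAt_beta (z : ℂ) {x : ℝ} (hx : x ≠ 0) :
    HasDerivAt (beta z) (beta1 z x / x) x := by
  refine (((hasDerivAt_serB _).comp x (hasDerivAt_arg z hx)).sub
    ((hasDerivAt_ofReal_log hx).mul ((hasDerivAt_serA _).comp x
      (hasDerivAt_arg z hx)))).congr_deriv ?_
  have : (x : ℂ) ≠ 0 := by exact_mod_cast hx
  simp only [beta1, Function.comp]
  field_simp
  ring

theorem hasDerivAt_alpha1 (z : ℂ) {x : ℝ} (hx : x ≠ 0) :
    HasDerivAt (alpha1 z) (-z * x * alpha z x) x := by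
  have := (((hasDerivAt_mul_serA' _).comp x (hasDerivAt_arg z hx)).const_mul 2)
  refine this.congr_deriv ?_
  have : (x : ℂ) ≠ 0 := by exact_mod_cast hx
  rw [alpha]
  field_simp
  ring

theorem hasDerivAt_beta1 (z : ℂ) {x : ℝ} (hx : x ≠ 0) :
    HasDerivAt (beta1 z) (-z * x * beta z x) x := by
  have h1 := (((hasDerivAt_mul_serA' _).comp x (hasDerivAt_arg z hx)).const_mul 2)
  have h2 := (((hasDerivAt_mul_serB' _).comp x (hasDerivAt_arg z hx)).const_mul 2)
  have h3 := ((hasDerivAt_serA _).comp x (hasDerivAt_arg z hx))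
  refine ((h2.sub h3).sub ((hasDerivAt_ofReal_log hx).mul h1)).congr_deriv ?_
  have : (x : ℂ) ≠ 0 := by exact_mod_cast hx
  simp only [beta, Function.comp]
  field_simp
  ring

theorem hasDerivAt_alphaZ (z : ℂ) (x : ℝ) :
    HasDerivAt (fun z => alpha z x) (alphaZ z x) z := by
  refine ((hasDerivAt_serA _).comp z (hasDerivAt_argZ z x)).congr_deriv ?_
  rw [alphaZ]; ring

theorem hasDerivAt_betaZ (z : ℂ) (x : ℝ) :
    HasDerivAt (fun z => beta z x) (betaZ z x) z := by
  refine (((hasDerivAt_serB _).comp z (hasDerivAt_argZ z x)).sub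
    (((hasDerivAt_serA _).comp z (hasDerivAt_argZ z x)).const_mul _)).congr_deriv ?_
  rw [betaZ]; ring

/-- The free Green kernel divided by `√(x y)`. -/
def kernel (z : ℂ) (x y : ℝ) : ℂ := alpha z x * beta z y - alpha z y * beta z x

/-- The `z`-derivative of `kernel`. -/
def kernelZ (z : ℂ) (x y : ℝ) : ℂ :=
  alphaZ z x * beta z y + alpha z x * betaZ z y - (alphaZ z y * beta z x + alpha z y * betaZ z x)

theorem hasDerivAt_kernelZ (z : ℂ) (x y : ℝ) :
    HasDerivAt (fun z => kernel z x y) (kernelZ z x y) z :=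
  ((hasDerivAt_alphaZ z x).mul (hasDerivAt_betaZ z y)).sub
    ((hasDerivAt_alphaZ z y).mul (hasDerivAt_betaZ z x))

/-- Apart from log x, the solutions depend on z and x only through z x², so 2z ∂_z acts as x ∂ₓ. On
`beta` the logarithm gives a discrepancy `alpha`, but the two products α(x)α(y) arising in the
kernel cancel by antisymmetry. Bounds on x- and y-derivatives thus control the z-derivative when
|k|x is large. -/
theorem two_mul_kernelZ (z : ℂ) (x y : ℝ) :
    2 * z * kernelZ z x y = (alpha1 z x * beta z y - alpha z y * beta1 z x)
      + (alpha z x * beta1 z y - alpha1 z y * beta z x) := by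
  simp only [kernelZ, alphaZ, betaZ, alpha1, beta1, alpha, beta]
  ring

/-! ### Identification with the Bessel and Neumann functions -/

theorem besselJ0_eq (w : ℂ) : besselJ0 w = serA (-w ^ 2 / 4) := by
  simp [besselJ0, serA, besselSeries]

theorem cpow_half_mul_sq (z : ℂ) (x : ℝ) : (z ^ (1 / 2 : ℂ) * x) ^ 2 = z * x ^ 2 := by
  rw [mul_pow]
  congr 1
  simp

theorem phi0_eq (z : ℂ) (x : ℝ) :
    phi0 z x = (Real.sqrt (Real.pi * x / 2) : ℂ) * alpha z x := by
  rw [phi0, besselJ0_eq, cpow_half_mul_sq, alpha, neg_mul]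

/-- The principal root has argument in (−π/2, π/2], so its logarithm is exactly half of log z, with
no multiple of 2πi, and a positive factor does not change the argument. -/
theorem log_cpow_half_mul {z : ℂ} (hz : z ≠ 0) {x : ℝ} (hx : 0 < x) :
    Complex.log (z ^ (1 / 2 : ℂ) * x / 2) = Complex.log z / 2 + Real.log (x / 2) := by
  have h1 : z ^ (1 / 2 : ℂ) * x / 2 = ((x / 2 : ℝ) : ℂ) * z ^ (1 / 2 : ℂ) := by
    push_cast; ring
  have h2 : z ^ (1 / 2 : ℂ) ≠ 0 := by simp [Complex.cpow_eq_zero_iff, hz]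
  have h3 : Complex.log (z ^ (1 / 2 : ℂ)) = Complex.log z / 2 := by
    rw [Complex.cpow_def_of_ne_zero hz, Complex.log_exp]
    · ring
    · simp [Complex.log_im]
      linarith [Complex.neg_pi_lt_arg z, Real.pi_pos]
    · simp [Complex.log_im]
      linarith [Complex.arg_le_pi z, Real.pi_pos]
  rw [h1, Complex.log_ofReal_mul (by positivity) h2, h3]
  ring

/-- The term (1/π) log z cancels the logarithm of √z inside Y₀, which leaves an expression without
branches that also covers z = 0, where ψ(1) = −γ matches the prescribed limit. -/
theorem theta0_eq (z : ℂ) {x : ℝ} (hx : 0 < x) :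
    theta0 z x = (Real.sqrt (Real.pi * x / 2) : ℂ) * (2 / Real.pi) *
      (beta z x + Real.log 2 * alpha z x) := by
  have hpi : (Real.pi : ℂ) ≠ 0 := by exact_mod_cast Real.pi_ne_zero
  have hl : Real.log (x / 2) = Real.log x - Real.log 2 := Real.log_div hx.ne' (by norm_num)
  rw [theta0]
  split_ifs with hz
  · subst hz
    have h1 : Real.sqrt (2 * x / Real.pi) = Real.sqrt (Real.pi * x / 2) * (2 / Real.pi) := by
      rw [← Real.sqrt_sq (show 0 ≤ 2 / Real.pi by positivity), ← Real.sqrt_mul (by positivity)]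
      congr 1
      have := Real.pi_ne_zero
      field_simp
    rw [h1, hl]
    simp only [beta, alpha, neg_zero, zero_mul, zero_div, serA_zero, serB_zero]
    push_cast
    ring
  · rw [besselY0, besselJ0_eq, log_cpow_half_mul hz hx, hl, cpow_half_mul_sq, alpha, beta]
    have h2 : (∑' n : ℕ, Complex.digamma ((n : ℂ) + 1) *
        ((-(z * (x : ℂ) ^ 2) / 4) ^ n / ((n.factorial : ℂ) ^ 2))) = serB (-z * x ^ 2 / 4) := by
      simp [serB, besselSeries, digammaCoeff]
    rw [h2, neg_mul]
    push_cast
    field_simp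
    ring

/-- The log 2 multiples of `alpha` drop out by antisymmetry. -/
theorem green0_eq (z : ℂ) {x y : ℝ} (hx : 0 < x) (hy : 0 < y) :
    green0 z x y = (Real.sqrt (Real.pi * x / 2) : ℂ) * (Real.sqrt (Real.pi * y / 2) : ℂ)
      * (2 / Real.pi) * kernel z x y := by
  rw [green0, phi0_eq, phi0_eq, theta0_eq z hx, theta0_eq z hy, kernel]
  ring

/-! ### Energy estimate for the free equation -/

/-- The left side is the derivative of ‖G‖² + ‖k‖²‖F‖² along F' = G, G' = −(k² + c)F. Because |k|² −
k² = k(k̄ − k) has norm 2|k||Im k|, only the imaginary part of k contributes to growth. -/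
theorem inner_energy_le (k F G : ℂ) {c : ℝ} (hc : 0 ≤ c) (hk : k ≠ 0) :
    2 * inner ℝ G (-(k ^ 2 + c) * F) + ‖k‖ ^ 2 * (2 * inner ℝ F G)
      ≤ (2 * |k.im| + c / ‖k‖) * (‖G‖ ^ 2 + ‖k‖ ^ 2 * ‖F‖ ^ 2) := by
  have hk0 : 0 < ‖k‖ := norm_pos_iff.2 hk
  have h1 : 2 * inner ℝ G (-(k ^ 2 + c) * F) + ‖k‖ ^ 2 * (2 * inner ℝ F G)
      = 2 * inner ℝ G (((‖k‖ : ℂ) ^ 2 - k ^ 2 - c) * F) := by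
    rw [real_inner_comm G F]
    have : ((‖k‖ : ℂ) ^ 2 - k ^ 2 - c) * F = -(k ^ 2 + c) * F + (‖k‖ ^ 2 : ℝ) • F := by
      rw [Complex.real_smul]; push_cast; ring
    rw [this, inner_add_right, inner_smul_right]
    ring
  have h2 : ‖(‖k‖ : ℂ) ^ 2 - k ^ 2 - c‖ ≤ 2 * ‖k‖ * |k.im| + c := by
    have : (‖k‖ : ℂ) ^ 2 - k ^ 2 = k * ((starRingEnd ℂ) k - k) := by
      rw [← Complex.mul_conj']; ring
    refine (norm_sub_le _ _).trans ?_
    rw [this, norm_mul, ← norm_neg (_ - _), neg_sub, Complex.sub_conj, Complex.norm_real,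
      Real.norm_of_nonneg hc]
    simp
    linarith
  have h3 := real_inner_le_norm G (((‖k‖ : ℂ) ^ 2 - k ^ 2 - c) * F)
  rw [norm_mul] at h3
  have h4 : ‖G‖ * (‖(‖k‖ : ℂ) ^ 2 - k ^ 2 - c‖ * ‖F‖) ≤
      ‖G‖ * ((2 * ‖k‖ * |k.im| + c) * ‖F‖) := by gcongr
  have h5 : 2 * (‖k‖ * ‖F‖ * ‖G‖) ≤ ‖G‖ ^ 2 + ‖k‖ ^ 2 * ‖F‖ ^ 2 := by
    nlinarith [sq_nonneg (‖G‖ - ‖k‖ * ‖F‖)]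
  rw [h1]
  calc _ ≤ 2 * (‖G‖ * ((2 * ‖k‖ * |k.im| + c) * ‖F‖)) := by linarith
    _ = (2 * |k.im| + c / ‖k‖) * (2 * (‖k‖ * ‖F‖ * ‖G‖)) := by field_simp
    _ ≤ _ := by gcongr

/-- The 1/(4x²) potential enters the growth rate as 1/(4|k|x²), which is integrable at infinity.
Starting at |k|a ≥ 1 it costs only a bounded factor. -/
theorem energy_growth {k : ℂ} (hk : k ≠ 0) {F G : ℝ → ℂ}
    (hF : ∀ x, 0 < x → HasDerivAt F (G x) x)
    (hG : ∀ x, 0 < x → HasDerivAt G (-(k ^ 2 + (1 / (4 * x ^ 2) : ℝ)) * F x) x)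
    {a x : ℝ} (ha : 1 ≤ ‖k‖ * a) (hax : a ≤ x) :
    ‖G x‖ ^ 2 + ‖k‖ ^ 2 * ‖F x‖ ^ 2
      ≤ 4 * (‖G a‖ ^ 2 + ‖k‖ ^ 2 * ‖F a‖ ^ 2) * Real.exp (|k.im| * (x - a)) ^ 2 := by
  have hk0 : 0 < ‖k‖ := norm_pos_iff.2 hk
  have ha0 : 0 < a := by
    by_contra! h
    nlinarith
  set E : ℝ → ℝ := fun x => ‖G x‖ ^ 2 + ‖k‖ ^ 2 * ‖F x‖ ^ 2 with hE
  -- Integrating factor: the exponent has derivative −(2|Im k| + 1/(4|k|x²)), the negative of the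
  -- growth rate in `inner_energy_le` with c = 1/(4x²).
  set W : ℝ → ℝ := fun x => Real.exp (-(2 * |k.im|) * x + 1 / (4 * ‖k‖) * x⁻¹) with hW
  have hd : ∀ y, 0 < y → HasDerivAt (fun y => E y * W y)
      ((2 * inner ℝ (G y) (-(k ^ 2 + (1 / (4 * y ^ 2) : ℝ)) * F y)
        + ‖k‖ ^ 2 * (2 * inner ℝ (F y) (G y))) * W y
        + E y * (W y * (-(2 * |k.im|) * 1 + 1 / (4 * ‖k‖) * (-(y ^ 2)⁻¹)))) y := by
    intro y hy
    exact ((hG y hy).norm_sq.add ((hF y hy).norm_sq.const_mul _)).mul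
      ((((hasDerivAt_id y).const_mul _).add ((hasDerivAt_inv hy.ne').const_mul _)).exp)
  have hanti : AntitoneOn (fun y => E y * W y) (Icc a x) := by
    have hpos : ∀ y ∈ Icc a x, 0 < y := fun y hy => ha0.trans_le hy.1
    refine antitoneOn_of_deriv_nonpos (convex_Icc _ _)
      (fun y hy => (hd y (hpos y hy)).continuousAt.continuousWithinAt)
      (fun y hy => (hd y (hpos y (interior_subset hy))).differentiableAt.differentiableWithinAt)
      (fun y hy => ?_)
    have hy0 := hpos y (interior_subset hy)
    rw [(hd y hy0).deriv]
    have h1 := inner_energy_le k (F y) (G y) (c := 1 / (4 * y ^ 2)) (by positivity) hk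
    have h2 : (1 / (4 * y ^ 2)) / ‖k‖ = 1 / (4 * ‖k‖) * (y ^ 2)⁻¹ := by field_simp
    rw [h2] at h1
    have hWp : 0 < W y := Real.exp_pos _
    calc _ = W y * ((2 * inner ℝ (G y) (-(k ^ 2 + (1 / (4 * y ^ 2) : ℝ)) * F y)
        + ‖k‖ ^ 2 * (2 * inner ℝ (F y) (G y)))
        - (2 * |k.im| + 1 / (4 * ‖k‖) * (y ^ 2)⁻¹) * E y) := by ring
      _ ≤ 0 := mul_nonpos_of_nonneg_of_nonpos hWp.le (by simp only [hE]; linarith)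
  have h := hanti (left_mem_Icc.2 hax) (right_mem_Icc.2 hax) hax
  simp only at h
  have hEa : 0 ≤ E a := by positivity
  have hEx : 0 ≤ E x := by positivity
  have h1 : Real.exp (-(2 * |k.im|) * x) ≤ W x := by
    apply Real.exp_le_exp.2
    have : 0 < x := ha0.trans_le hax
    have : 0 ≤ 1 / (4 * ‖k‖) * x⁻¹ := by positivity
    linarith
  -- Since |k|a ≥ 1, the second part of the exponent is at most 1 and e < 4.
  have h2 : W a ≤ 4 * Real.exp (-(2 * |k.im|) * a) := by
    have h3 : 1 / (4 * ‖k‖) * a⁻¹ ≤ 1 := by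
      rw [← div_eq_mul_inv, div_div, div_le_one (by positivity)]
      linarith
    have h4 : Real.exp (1 / (4 * ‖k‖) * a⁻¹) ≤ 4 :=
      (Real.exp_le_exp.2 h3).trans (by linarith [Real.exp_one_lt_d9])
    simp only [hW, Real.exp_add]
    nlinarith [Real.exp_pos (-(2 * |k.im|) * a)]
  have h5 : E x * Real.exp (-(2 * |k.im|) * x) ≤ E a * (4 * Real.exp (-(2 * |k.im|) * a)) :=
    (mul_le_mul_of_nonneg_left h1 hEx).trans (h.trans (mul_le_mul_of_nonneg_left h2 hEa))
  have h6 : Real.exp (-(2 * |k.im|) * x) * Real.exp ((2 * |k.im|) * x) = 1 := by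
    rw [← Real.exp_add]; simp
  have h7 : Real.exp (|k.im| * (x - a)) ^ 2
      = Real.exp (-(2 * |k.im|) * a) * Real.exp ((2 * |k.im|) * x) := by
    rw [← Real.exp_add, ← Real.exp_nat_mul]; congr 1; push_cast; ring
  calc E x = E x * Real.exp (-(2 * |k.im|) * x) * Real.exp ((2 * |k.im|) * x) := by
        rw [mul_assoc, h6, mul_one]
    _ ≤ E a * (4 * Real.exp (-(2 * |k.im|) * a)) * Real.exp ((2 * |k.im|) * x) := by gcongr
    _ = _ := by rw [h7]; ring

set_option maxHeartbeats 800000 in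
/-- Solutions of the free equation, in the form `x (x u')' = - k² x² u` with `v = x u'`, grow at
most like `x^{-1/2} e^{|Im k| x}` for `|k| x ≥ 1`. -/
theorem free_growth {k : ℂ} (hk : k ≠ 0) {u v : ℝ → ℂ}
    (hu : ∀ x, 0 < x → HasDerivAt u (v x / x) x)
    (hv : ∀ x, 0 < x → HasDerivAt v (-k ^ 2 * x * u x) x)
    {a x M : ℝ} (ha : 1 ≤ ‖k‖ * a) (hax : a ≤ x)
    (hua : ‖u a‖ ≤ M) (hva : ‖v a‖ ≤ M * (‖k‖ * a)) :
    ‖u x‖ ≤ 8 * M * (√(‖k‖ * a) / √(‖k‖ * x)) * Real.exp (|k.im| * (x - a)) ∧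
    ‖v x‖ ≤ 8 * M * (√(‖k‖ * a) * √(‖k‖ * x)) * Real.exp (|k.im| * (x - a)) := by
  have hk0 : 0 < ‖k‖ := norm_pos_iff.2 hk
  have ha0 : 0 < a := by
    by_contra! h
    nlinarith
  have hx0 : 0 < x := ha0.trans_le hax
  have hM : 0 ≤ M := (norm_nonneg _).trans hua
  have hs : ∀ x : ℝ, 0 < x → HasDerivAt (fun x : ℝ => ((√x : ℝ) : ℂ)) (1 / (2 * √x) : ℝ) x :=
    fun x hx => (Real.hasDerivAt_sqrt hx.ne').ofReal_comp
  have hsq : ∀ x : ℝ, 0 < x → ((√x : ℝ) : ℂ) ^ 2 = x := fun x hx => by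
    rw [← Complex.ofReal_pow, Real.sq_sqrt hx.le]
  have hsn : ∀ x : ℝ, 0 < x → ((√x : ℝ) : ℂ) ≠ 0 := fun x hx => by
    exact_mod_cast (Real.sqrt_pos.2 hx).ne'
  -- Liouville substitution: F = √x u removes the first order term and turns the equation into F'' =
  -- −(k² + 1/(4x²))F, with F' = (u/2 + v)/√x.
  have key := energy_growth hk (F := fun x => (√x : ℝ) * u x)
    (G := fun x => (u x / 2 + v x) / (√x : ℝ)) ?_ ?_ ha hax
  · set e := Real.exp (|k.im| * (x - a)) with he
    have he0 : 0 < e := Real.exp_pos _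
    set p := √(‖k‖ * x) with hp
    set r := √(‖k‖ * a) with hr
    have hr1 : 1 ≤ r := by rw [hr]; exact Real.one_le_sqrt.2 ha
    have hrp : r ≤ p := Real.sqrt_le_sqrt (by gcongr)
    have hp1 : 1 ≤ p := hr1.trans hrp
    have hpx : √‖k‖ * √x = p := (Real.sqrt_mul hk0.le _).symm
    have hra : √‖k‖ * √a = r := (Real.sqrt_mul hk0.le _).symm
    have hkk : √‖k‖ ^ 2 = ‖k‖ := Real.sq_sqrt hk0.le
    have hkp : 0 < √‖k‖ := Real.sqrt_pos.2 hk0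
    have hxp : 0 < √x := Real.sqrt_pos.2 hx0
    have hap : 0 < √a := Real.sqrt_pos.2 ha0
    have hr2 : r ^ 2 = ‖k‖ * a := Real.sq_sqrt (by positivity)
    simp only [norm_div, norm_mul, Complex.norm_real, Real.norm_of_nonneg (Real.sqrt_nonneg _)]
      at key
    have hGa : ‖u a / 2 + v a‖ / √a ≤ √‖k‖ * (3 / 2 * M * r) := by
      rw [div_le_iff₀ hap]
      have : ‖u a / 2 + v a‖ ≤ M / 2 + M * r ^ 2 := by
        refine (norm_add_le _ _).trans ?_
        rw [hr2, norm_div, Complex.norm_ofNat]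
        gcongr
      calc _ ≤ M / 2 + M * r ^ 2 := this
        _ ≤ 3 / 2 * M * r ^ 2 := by nlinarith [mul_nonneg hM (show 0 ≤ r ^ 2 - 1 by nlinarith)]
        _ = _ := by rw [← hra]; ring
    have hFa : ‖k‖ * (√a * ‖u a‖) ≤ √‖k‖ * (M * r) := by
      calc _ ≤ ‖k‖ * (√a * M) := by gcongr
        _ = √‖k‖ ^ 2 * (√a * M) := by rw [hkk]
        _ = _ := by rw [← hra]; ring
    -- The two contributions are (3/2)² and 1, and 9/4 + 1 ≤ 4.
    have hEa : (‖u a / 2 + v a‖ / √a) ^ 2 + ‖k‖ ^ 2 * (√a * ‖u a‖) ^ 2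
        ≤ 4 * (√‖k‖ * (M * r)) ^ 2 := by
      have h1 := pow_le_pow_left₀ (by positivity) hGa 2
      have h2 := pow_le_pow_left₀ (by positivity) hFa 2
      nlinarith [sq_nonneg (√‖k‖ * (M * r))]
    have hEx : (‖u x / 2 + v x‖ / √x) ^ 2 + ‖k‖ ^ 2 * (√x * ‖u x‖) ^ 2
        ≤ (4 * (√‖k‖ * (M * r)) * e) ^ 2 := by
      refine key.trans ?_
      calc _ ≤ 4 * (4 * (√‖k‖ * (M * r)) ^ 2) * e ^ 2 := by gcongr
        _ = _ := by ring
    have h1 : ‖u x / 2 + v x‖ / √x ≤ 4 * (√‖k‖ * (M * r)) * e := by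
      refine le_of_sq_le_sq (le_trans ?_ hEx) (by positivity)
      have : 0 ≤ ‖k‖ ^ 2 * (√x * ‖u x‖) ^ 2 := by positivity
      linarith
    have h2 : ‖k‖ * (√x * ‖u x‖) ≤ 4 * (√‖k‖ * (M * r)) * e := by
      refine le_of_sq_le_sq (le_trans ?_ hEx) (by positivity)
      have : 0 ≤ (‖u x / 2 + v x‖ / √x) ^ 2 := by positivity
      rw [mul_pow]
      linarith
    have h3 : ‖u x‖ ≤ 4 * M * (r / p) * e := by
      have : ‖k‖ * (√x * ‖u x‖) = √‖k‖ * (p * ‖u x‖) := by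
        rw [← hpx]; nth_rw 1 [← hkk]; ring
      rw [this] at h2
      have h4 : p * ‖u x‖ ≤ 4 * M * r * e :=
        le_of_mul_le_mul_left (h2.trans_eq (by ring)) hkp
      rw [show 4 * M * (r / p) * e = (4 * M * r * e) / p by ring, le_div_iff₀ (by positivity)]
      linarith
    have h5 : ‖u x / 2 + v x‖ ≤ 4 * M * (r * p) * e := by
      rw [div_le_iff₀ hxp] at h1
      refine h1.trans_eq ?_
      rw [← hpx]; ring
    have h6 : ‖v x‖ ≤ ‖u x / 2 + v x‖ + ‖u x‖ / 2 := by
      have : v x = (u x / 2 + v x) - u x / 2 := by ring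
      calc ‖v x‖ = ‖(u x / 2 + v x) - u x / 2‖ := by rw [← this]
        _ ≤ _ := norm_sub_le _ _
        _ = _ := by rw [norm_div, Complex.norm_ofNat]
    have hr0 : 0 ≤ r := by positivity
    have h7 : r / p ≤ r * p := (div_le_self hr0 hp1).trans (le_mul_of_one_le_right hr0 hp1)
    have hMe : 0 ≤ M * e := by positivity
    constructor
    · refine h3.trans ?_
      have : 0 ≤ M * (r / p) * e := by positivity
      linarith
    · have h8 := mul_le_mul_of_nonneg_left h7 hMe
      have : 0 ≤ M * e * (r * p) := by positivity
      have h9 : 4 * M * (r / p) * e = 4 * (M * e * (r / p)) := by ring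
      have h10 : 4 * M * (r * p) * e = 4 * (M * e * (r * p)) := by ring
      have h11 : 8 * M * (r * p) * e = 8 * (M * e * (r * p)) := by ring
      rw [h9] at h3
      rw [h10] at h5
      rw [h11]
      linarith
  · intro x hx
    refine ((hs x hx).mul (hu x hx)).congr_deriv ?_
    have h1 := hsn x hx
    have h2 := hsq x hx
    have h3 : (x : ℂ) ≠ 0 := by exact_mod_cast hx.ne'
    push_cast
    rw [← h2]
    field_simp
  · intro x hx
    refine ((((hu x hx).div_const 2).add (hv x hx)).div (hs x hx) (hsn x hx)).congr_deriv ?_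
    have h1 := hsn x hx
    have h2 := hsq x hx
    have h3 : (x : ℂ) ≠ 0 := by exact_mod_cast hx.ne'
    simp only [Pi.add_apply]
    push_cast
    rw [← h2]
    field_simp
    ring

/-! ### Uniform bounds on the free solution and the kernel -/

/-- The weight `(1 + t)^{-1/2}`. -/
def wt (t : ℝ) : ℝ := (√(1 + t))⁻¹

theorem wt_pos {t : ℝ} (ht : 0 ≤ t) : 0 < wt t := inv_pos.2 (Real.sqrt_pos.2 (by linarith))

theorem wt_sq {t : ℝ} (ht : 0 ≤ t) : wt t ^ 2 = (1 + t)⁻¹ := by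
  rw [wt, inv_pow, Real.sq_sqrt (by linarith)]

theorem one_le_two_wt {t : ℝ} (h0 : 0 ≤ t) (h1 : t ≤ 1) : 1 ≤ 2 * wt t := by
  have h2 : √(1 + t) ≤ 2 := Real.sqrt_le_iff.2 ⟨by norm_num, by linarith⟩
  have h3 : 0 < √(1 + t) := Real.sqrt_pos.2 (by linarith)
  rw [wt, ← div_eq_mul_inv, le_div_iff₀ h3]
  linarith

theorem inv_sqrt_le_two_wt {t : ℝ} (h1 : 1 ≤ t) : (√t)⁻¹ ≤ 2 * wt t := by
  have h2 : √(1 + t) ≤ 2 * √t := by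
    refine Real.sqrt_le_iff.2 ⟨by positivity, ?_⟩
    rw [mul_pow, Real.sq_sqrt (by linarith)]
    linarith
  have h3 : 0 < √(1 + t) := Real.sqrt_pos.2 (by linarith)
  have h4 : 0 < √t := Real.sqrt_pos.2 (by linarith)
  rw [wt, ← div_eq_mul_inv, le_div_iff₀ h3, inv_mul_le_iff₀ h4]
  linarith

theorem exists_ser_bound : ∃ C : ℝ, 1 ≤ C ∧ ∀ s : ℂ, ‖s‖ ≤ 1 →
    ‖serA s‖ ≤ C ∧ ‖serB s‖ ≤ C ∧ ‖serA' s‖ ≤ C ∧ ‖serB' s‖ ≤ C := by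
  have hK : IsCompact (Metric.closedBall (0 : ℂ) 1) := isCompact_closedBall _ _
  obtain ⟨c1, h1⟩ := hK.exists_bound_of_continuousOn differentiable_serA.continuous.continuousOn
  obtain ⟨c2, h2⟩ := hK.exists_bound_of_continuousOn differentiable_serB.continuous.continuousOn
  obtain ⟨c3, h3⟩ := hK.exists_bound_of_continuousOn differentiable_serA'.continuous.continuousOn
  obtain ⟨c4, h4⟩ := hK.exists_bound_of_continuousOn differentiable_serB'.continuous.continuousOn
  refine ⟨1 + |c1| + |c2| + |c3| + |c4|, ?_, fun s hs => ?_⟩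
  · linarith [abs_nonneg c1, abs_nonneg c2, abs_nonneg c3, abs_nonneg c4]
  · have hs' : s ∈ Metric.closedBall (0 : ℂ) 1 := by simpa using hs
    refine ⟨(h1 s hs').trans ?_, (h2 s hs').trans ?_, (h3 s hs').trans ?_, (h4 s hs').trans ?_⟩ <;>
    linarith [abs_nonneg c1, abs_nonneg c2, abs_nonneg c3, abs_nonneg c4, le_abs_self c1,
      le_abs_self c2, le_abs_self c3, le_abs_self c4]

theorem norm_arg_le {k : ℂ} {x : ℝ} (hx : 0 ≤ x) (h : ‖k‖ * x ≤ 1) :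
    ‖-k ^ 2 * (x : ℂ) ^ 2 / 4‖ ≤ 1 / 4 := by
  have : -k ^ 2 * (x : ℂ) ^ 2 / 4 = -((k * x) ^ 2) / 4 := by ring
  rw [this, norm_div, norm_neg, norm_pow, norm_mul, Complex.norm_real, Real.norm_of_nonneg hx,
    Complex.norm_ofNat]
  have : (‖k‖ * x) ^ 2 ≤ 1 := pow_le_one₀ (by positivity) h
  linarith

/-- Every quantity built from the kernel near the origin has this shape with L = log(x/y) and
products of bounded series. Missing terms are taken to be 0. -/
theorem norm_log_comb_le {D L : ℝ} (hL : 0 ≤ L) {p₁ p₂ p₃ p₄ p₅ : ℂ}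
    (h₁ : ‖p₁‖ ≤ D) (h₂ : ‖p₂‖ ≤ D) (h₃ : ‖p₃‖ ≤ D) (h₄ : ‖p₄‖ ≤ D) (h₅ : ‖p₅‖ ≤ D) :
    ‖(L : ℂ) * p₁ + p₂ - p₃ - p₄ + p₅‖ ≤ 4 * D * (1 + L) := by
  have hD : 0 ≤ D := (norm_nonneg _).trans h₁
  have h6 : ‖(L : ℂ) * p₁‖ ≤ L * D := by
    rw [norm_mul, Complex.norm_real, Real.norm_of_nonneg hL]; gcongr
  have h7 := norm_add_le ((L : ℂ) * p₁ + p₂ - p₃ - p₄) p₅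
  have h8 := norm_sub_le ((L : ℂ) * p₁ + p₂ - p₃) p₄
  have h9 := norm_sub_le ((L : ℂ) * p₁ + p₂) p₃
  have h10 := norm_add_le ((L : ℂ) * p₁) p₂
  nlinarith [mul_nonneg hL hD]

theorem norm_mul_le_sq {C : ℝ} {a b : ℂ} (ha : ‖a‖ ≤ C) (hb : ‖b‖ ≤ C) : ‖a * b‖ ≤ C ^ 2 := by
  rw [norm_mul, sq]
  exact mul_le_mul ha hb (norm_nonneg _) ((norm_nonneg _).trans ha)

/-- Bounds on the kernel and its logarithmic derivatives when `|k| x ≤ 1`. -/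
theorem kernel_local_bound {C : ℝ} (hC : 1 ≤ C) (hs : ∀ s : ℂ, ‖s‖ ≤ 1 →
    ‖serA s‖ ≤ C ∧ ‖serB s‖ ≤ C ∧ ‖serA' s‖ ≤ C ∧ ‖serB' s‖ ≤ C) {k : ℂ} {x y : ℝ}
    (hy : 0 < y) (hyx : y ≤ x) (hkx : ‖k‖ * x ≤ 1) :
    ‖kernel (k ^ 2) x y‖ ≤ 4 * C ^ 2 * (1 + Real.log (x / y)) ∧
    ‖alpha1 (k ^ 2) x * beta (k ^ 2) y - alpha (k ^ 2) y * beta1 (k ^ 2) x‖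
      ≤ 4 * C ^ 2 * (1 + Real.log (x / y)) ∧
    ‖alpha (k ^ 2) x * beta1 (k ^ 2) y - alpha1 (k ^ 2) y * beta (k ^ 2) x‖
      ≤ 4 * C ^ 2 * (1 + Real.log (x / y)) ∧
    ‖alpha1 (k ^ 2) x * beta1 (k ^ 2) y - alpha1 (k ^ 2) y * beta1 (k ^ 2) x‖
      ≤ 4 * C ^ 2 * (1 + Real.log (x / y)) ∧
    ‖kernelZ (k ^ 2) x y‖ ≤ x ^ 2 * (4 * C ^ 2 * (1 + Real.log (x / y))) := by
  have hx : 0 < x := hy.trans_le hyx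
  have hL : 0 ≤ Real.log (x / y) := Real.log_nonneg ((one_le_div hy).2 hyx)
  -- Log x and log y occur only through their difference, with a common coefficient, so the
  -- singularity is measured by log(x/y) alone.
  have hlog : ((Real.log (x / y) : ℝ) : ℂ) = (Real.log x : ℂ) - (Real.log y : ℂ) := by
    rw [Real.log_div hx.ne' hy.ne']; push_cast; ring
  have hky : ‖k‖ * y ≤ 1 := le_trans (by gcongr) hkx
  have hsx := norm_arg_le hx.le hkx
  have hsy := norm_arg_le hy.le hky
  obtain ⟨hAx, hBx, hA'x, hB'x⟩ := hs _ (hsx.trans (by norm_num))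
  obtain ⟨hAy, hBy, hA'y, hB'y⟩ := hs _ (hsy.trans (by norm_num))
  have hS : ∀ s c : ℂ, ‖s‖ ≤ 1 / 4 → ‖c‖ ≤ C → ‖2 * (s * c)‖ ≤ C := by
    intro s c h1 h2
    rw [norm_mul, norm_mul, Complex.norm_ofNat]
    nlinarith [norm_nonneg c, norm_nonneg s]
  have hSx := hS _ _ hsx hA'x
  have hTx := hS _ _ hsx hB'x
  have hSy := hS _ _ hsy hA'y
  have hTy := hS _ _ hsy hB'y
  have h0 : ‖(0 : ℂ)‖ ≤ C ^ 2 := by rw [norm_zero]; positivity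
  refine ⟨?_, ?_, ?_, ?_, ?_⟩
  · refine le_of_eq_of_le (congrArg norm ?_) (norm_log_comb_le hL (norm_mul_le_sq hAx hAy)
      (norm_mul_le_sq hAx hBy) (norm_mul_le_sq hAy hBx) h0 h0)
    rw [hlog, kernel, alpha, alpha, beta, beta]; ring
  · refine le_of_eq_of_le (congrArg norm ?_) (norm_log_comb_le hL (norm_mul_le_sq hSx hAy)
      (norm_mul_le_sq hSx hBy) (norm_mul_le_sq hAy hTx) h0 (norm_mul_le_sq hAx hAy))
    rw [hlog, alpha1, alpha, beta, beta1]; ring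
  · refine le_of_eq_of_le (congrArg norm ?_) (norm_log_comb_le hL (norm_mul_le_sq hAx hSy)
      (norm_mul_le_sq hAx hTy) (norm_mul_le_sq hAx hAy) (norm_mul_le_sq hSy hBx) h0)
    rw [hlog, alpha1, alpha, beta, beta1]; ring
  · refine le_of_eq_of_le (congrArg norm ?_) (norm_log_comb_le hL (norm_mul_le_sq hSx hSy)
      (norm_mul_le_sq hSx hTy) (norm_mul_le_sq hSx hAy) (norm_mul_le_sq hSy hTx)
      (norm_mul_le_sq hSy hAx))
    rw [hlog, alpha1, alpha1, beta1, beta1]; ring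
  · have h1 := norm_log_comb_le hL (norm_mul_le_sq hA'x hAy)
      (norm_mul_le_sq hA'x hBy) (norm_mul_le_sq hAy hB'x) h0 h0
    have h2 := norm_log_comb_le hL (norm_mul_le_sq hAx hA'y)
      (norm_mul_le_sq hAx hB'y) (norm_mul_le_sq hA'y hBx) h0 h0
    set D := 4 * C ^ 2 * (1 + Real.log (x / y)) with hD
    have hD0 : 0 ≤ D := by positivity
    have hn : ∀ (t : ℝ) (p : ℂ), 0 ≤ t → t ≤ x → ‖p‖ ≤ D →
        ‖(-(t : ℂ) ^ 2 / 4) * p‖ ≤ x ^ 2 / 4 * D := by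
      intro t p h1 h2 h3
      rw [norm_mul, norm_div, norm_neg, norm_pow, Complex.norm_real, Real.norm_of_nonneg h1,
        Complex.norm_ofNat]
      gcongr
    have h3 := hn x _ hx.le le_rfl h1
    have h4 := hn y _ hy.le hyx h2
    have h5 := (norm_add_le _ _).trans (add_le_add h3 h4)
    refine (le_of_eq_of_le (congrArg norm ?_) h5).trans ?_
    · rw [hlog, kernelZ, alphaZ, alphaZ, betaZ, betaZ, alpha, alpha, beta, beta]; ring
    · have : 0 ≤ x ^ 2 * D := by positivity
      linarith

/-- For |k|x ≤ 1 the series is bounded and the weight is at least 1/2. For |k|x > 1 the bound at a =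
1/|k| is propagated by `free_growth`. -/
theorem alpha_bound : ∃ C : ℝ, 0 ≤ C ∧ ∀ (k : ℂ) (x : ℝ), 0 < x →
    ‖alpha (k ^ 2) x‖ ≤ C * wt (‖k‖ * x) * Real.exp (|k.im| * x) ∧
    ‖2 * k * alphaZ (k ^ 2) x‖
      ≤ C * (‖k‖ * x ^ 2 * wt (‖k‖ * x) ^ 3) * Real.exp (|k.im| * x) := by
  obtain ⟨C, hC, hs⟩ := exists_ser_bound
  refine ⟨64 * C, by positivity, fun k x hx => ?_⟩
  have hk0 := norm_nonneg k
  have hC0 : 0 ≤ C := by linarith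
  rcases le_or_gt (‖k‖ * x) 1 with h | h
  · have hsx := norm_arg_le hx.le h
    obtain ⟨hA, -, hA', -⟩ := hs _ (hsx.trans (by norm_num))
    have he : 1 ≤ Real.exp (|k.im| * x) := Real.one_le_exp (by positivity)
    have hw := one_le_two_wt (by positivity) h
    set w := wt (‖k‖ * x)
    set e := Real.exp (|k.im| * x)
    have hw0 : 0 ≤ w := by linarith
    constructor
    · calc ‖alpha (k ^ 2) x‖ ≤ C := hA
        _ ≤ C * (2 * w) * e := by
          have := one_le_mul_of_one_le_of_one_le hw he
          nlinarith
        _ ≤ _ := by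
          have : 0 ≤ C * w * e := by positivity
          nlinarith
    · have h1 : ‖2 * k * alphaZ (k ^ 2) x‖ ≤ ‖k‖ * x ^ 2 * C := by
        rw [alphaZ, norm_mul, norm_mul, norm_mul, norm_div, norm_neg, norm_pow,
          Complex.norm_real, Real.norm_of_nonneg hx.le, Complex.norm_ofNat, Complex.norm_ofNat]
        calc _ ≤ 2 * ‖k‖ * (x ^ 2 / 4 * C) := by gcongr
          _ ≤ _ := by
            have : 0 ≤ ‖k‖ * x ^ 2 * C := by positivity
            linarith
      have h2 : 1 ≤ (2 * w) ^ 3 * e := one_le_mul_of_one_le_of_one_le (one_le_pow₀ hw) he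
      have h3 : 0 ≤ ‖k‖ * x ^ 2 * C := by positivity
      have h4 : 0 ≤ ‖k‖ * x ^ 2 * C * (w ^ 3 * e) := by positivity
      calc _ ≤ ‖k‖ * x ^ 2 * C * 1 := by rw [mul_one]; exact h1
        _ ≤ ‖k‖ * x ^ 2 * C * ((2 * w) ^ 3 * e) := by gcongr
        _ = 8 * (‖k‖ * x ^ 2 * C * (w ^ 3 * e)) := by ring
        _ ≤ 64 * (‖k‖ * x ^ 2 * C * (w ^ 3 * e)) := by linarith
        _ = _ := by ring
  · have hkp : 0 < ‖k‖ := by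
      by_contra! h'
      nlinarith
    have hk : k ≠ 0 := norm_pos_iff.1 hkp
    have ha : ‖k‖ * ‖k‖⁻¹ = 1 := mul_inv_cancel₀ hkp.ne'
    have hax : ‖k‖⁻¹ ≤ x := by
      rw [inv_le_iff_one_le_mul₀ hkp]; linarith
    have hsa := norm_arg_le (inv_nonneg.2 hkp.le) ha.le
    obtain ⟨hA, -, hA', -⟩ := hs _ (hsa.trans (by norm_num))
    have hva : ‖alpha1 (k ^ 2) ‖k‖⁻¹‖ ≤ C * (‖k‖ * ‖k‖⁻¹) := by
      rw [ha, mul_one, alpha1, norm_mul, norm_mul, Complex.norm_ofNat]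
      nlinarith [norm_nonneg (serA' (-k ^ 2 * ((‖k‖⁻¹ : ℝ) : ℂ) ^ 2 / 4)),
        norm_nonneg (-k ^ 2 * ((‖k‖⁻¹ : ℝ) : ℂ) ^ 2 / 4)]
    obtain ⟨h1, h2⟩ := free_growth hk (fun x hx => hasDerivAt_alpha (k ^ 2) hx.ne')
      (fun x hx => hasDerivAt_alpha1 (k ^ 2) hx.ne') ha.ge hax hA hva
    have he : Real.exp (|k.im| * (x - ‖k‖⁻¹)) ≤ Real.exp (|k.im| * x) := by
      apply Real.exp_le_exp.2
      have := inv_nonneg.2 hkp.le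
      gcongr
      linarith
    have hw := inv_sqrt_le_two_wt h.le
    rw [ha, Real.sqrt_one] at h1 h2
    rw [one_div] at h1
    rw [one_mul] at h2
    have hp2 : √(‖k‖ * x) ^ 2 = ‖k‖ * x := Real.sq_sqrt (by positivity)
    have hp0 : 0 < √(‖k‖ * x) := Real.sqrt_pos.2 (by positivity)
    set p := √(‖k‖ * x)
    set w := wt (‖k‖ * x)
    set e := Real.exp (|k.im| * x)
    have hw0 : 0 ≤ w := (wt_pos (by positivity)).le
    have he0 : 0 < e := Real.exp_pos _
    constructor
    · calc _ ≤ _ := h1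
        _ ≤ 8 * C * (2 * w) * e := by gcongr
        _ ≤ _ := by
          have : 0 ≤ C * w * e := by positivity
          linarith
    · have h3 : k * (2 * k * alphaZ (k ^ 2) x) = alpha1 (k ^ 2) x := by
        rw [alphaZ, alpha1]; ring
      have h4 : ‖k‖ * ‖2 * k * alphaZ (k ^ 2) x‖ ≤ 8 * C * p * e := by
        rw [← norm_mul, h3]
        exact h2.trans (by gcongr)
      refine le_of_mul_le_mul_left (h4.trans ?_) hkp
      have h5 : 1 ≤ p * (2 * w) := by
        rw [inv_le_iff_one_le_mul₀ hp0] at hw; linarith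
      -- With p² = |k|x, the factor (2pw)³ ≥ 1 turns p into 8 p⁴ w³ = 8 (|k|x)² w³, the form that is
      -- also correct for small |k|x.
      calc 8 * C * p * e = 8 * C * p * e * 1 := by ring
        _ ≤ 8 * C * p * e * (p * (2 * w)) ^ 3 := by
          gcongr; exact one_le_pow₀ h5
        _ = 64 * C * ((p ^ 2) ^ 2 * w ^ 3) * e := by ring
        _ = _ := by rw [hp2]; ring

/-- For fixed y, both the kernel and its derivative y ∂_y solve the free equation in x. There are
three regimes: both arguments below 1/|k| (local bound); y below and x above (propagate from 1/|k|);
both above (propagate from the diagonal x = y, where the Wronskian supplies the initial data). -/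
theorem kernel_bound : ∃ C : ℝ, 0 ≤ C ∧ ∀ (k : ℂ) (x y : ℝ), 0 < y → y ≤ x →
    ‖kernel (k ^ 2) x y‖ ≤ C * (wt (‖k‖ * x) * wt (‖k‖ * y)) * (1 + Real.log (x / y))
      * Real.exp (|k.im| * (x - y)) ∧
    ‖2 * k * kernelZ (k ^ 2) x y‖
      ≤ C * (‖k‖ * x ^ 2 * wt (‖k‖ * x) ^ 3 * wt (‖k‖ * y)) * (1 + Real.log (x / y))
        * Real.exp (|k.im| * (x - y)) := by
  obtain ⟨C, hC, hs⟩ := exists_ser_bound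
  refine ⟨1024 * C ^ 2, by positivity, fun k x y hy hyx => ?_⟩
  have hk0 := norm_nonneg k
  have hC1 : 1 ≤ C ^ 2 := one_le_pow₀ hC
  have hx : 0 < x := hy.trans_le hyx
  have hL : 0 ≤ Real.log (x / y) := Real.log_nonneg ((one_le_div hy).2 hyx)
  have he : 1 ≤ Real.exp (|k.im| * (x - y)) :=
    Real.one_le_exp (mul_nonneg (abs_nonneg _) (by linarith))
  have hkyx : ‖k‖ * y ≤ ‖k‖ * x := by gcongr
  have hwx0 : 0 ≤ wt (‖k‖ * x) := (wt_pos (by positivity)).le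
  have hwy0 : 0 ≤ wt (‖k‖ * y) := (wt_pos (by positivity)).le
  have hpos : ∀ l : ℝ, 0 ≤ l → 0 ≤ C ^ 2 * (1 + Real.log (x / y)) * l * Real.exp (|k.im| * (x - y)) :=
    fun l hl => by positivity
  rcases le_or_gt (‖k‖ * x) 1 with h | h
  · obtain ⟨h1, -, -, -, h2⟩ := kernel_local_bound hC hs hy hyx h
    have hwx := one_le_two_wt (by positivity) h
    have hwy := one_le_two_wt (by positivity) (hkyx.trans h)
    set wx := wt (‖k‖ * x)
    set wy := wt (‖k‖ * y)
    set e := Real.exp (|k.im| * (x - y))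
    set l := 1 + Real.log (x / y)
    have hl : 0 ≤ l := by positivity
    constructor
    · have h3 : 1 ≤ (2 * wx) * (2 * wy) * e :=
        one_le_mul_of_one_le_of_one_le (one_le_mul_of_one_le_of_one_le hwx hwy) he
      calc _ ≤ 4 * C ^ 2 * l * 1 := by rw [mul_one]; exact h1
        _ ≤ 4 * C ^ 2 * l * ((2 * wx) * (2 * wy) * e) := by gcongr
        _ = 16 * (C ^ 2 * l * (wx * wy) * e) := by ring
        _ ≤ 1024 * (C ^ 2 * l * (wx * wy) * e) := by linarith [hpos (wx * wy) (by positivity)]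
        _ = _ := by ring
    · have h3 : 1 ≤ (2 * wx) ^ 3 * (2 * wy) * e :=
        one_le_mul_of_one_le_of_one_le (one_le_mul_of_one_le_of_one_le (one_le_pow₀ hwx) hwy) he
      rw [norm_mul, norm_mul, Complex.norm_ofNat]
      calc _ ≤ 2 * ‖k‖ * (x ^ 2 * (4 * C ^ 2 * l)) * 1 := by rw [mul_one]; gcongr
        _ ≤ 2 * ‖k‖ * (x ^ 2 * (4 * C ^ 2 * l)) * ((2 * wx) ^ 3 * (2 * wy) * e) := by gcongr
        _ = 128 * (C ^ 2 * l * (‖k‖ * x ^ 2 * wx ^ 3 * wy) * e) := by ring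
        _ ≤ 1024 * (C ^ 2 * l * (‖k‖ * x ^ 2 * wx ^ 3 * wy) * e) := by
          linarith [hpos (‖k‖ * x ^ 2 * wx ^ 3 * wy) (by positivity)]
        _ = _ := by ring
  have hkp : 0 < ‖k‖ := by
    by_contra! h'
    nlinarith
  have hk : k ≠ 0 := norm_pos_iff.1 hkp
  have hp2 : √(‖k‖ * x) ^ 2 = ‖k‖ * x := Real.sq_sqrt (by positivity)
  have hp0 : 0 < √(‖k‖ * x) := Real.sqrt_pos.2 (by positivity)
  have hwx : 1 ≤ √(‖k‖ * x) * (2 * wt (‖k‖ * x)) := by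
    have := inv_sqrt_le_two_wt h.le
    rw [inv_le_iff_one_le_mul₀ hp0] at this; linarith
  have hu : ∀ (a b : ℂ) (x : ℝ), 0 < x → HasDerivAt
      (fun x => alpha (k ^ 2) x * a - b * beta (k ^ 2) x)
      ((alpha1 (k ^ 2) x * a - b * beta1 (k ^ 2) x) / x) x := fun a b x hx =>
    (((hasDerivAt_alpha (k ^ 2) hx.ne').mul_const a).sub
      ((hasDerivAt_beta (k ^ 2) hx.ne').const_mul b)).congr_deriv (by ring)
  have hv : ∀ (a b : ℂ) (x : ℝ), 0 < x → HasDerivAt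
      (fun x => alpha1 (k ^ 2) x * a - b * beta1 (k ^ 2) x)
      (-k ^ 2 * x * (alpha (k ^ 2) x * a - b * beta (k ^ 2) x)) x := fun a b x hx =>
    (((hasDerivAt_alpha1 (k ^ 2) hx.ne').mul_const a).sub
      ((hasDerivAt_beta1 (k ^ 2) hx.ne').const_mul b)).congr_deriv (by ring)
  have hdec : k * (2 * k * kernelZ (k ^ 2) x y) =
      (alpha1 (k ^ 2) x * beta (k ^ 2) y - alpha (k ^ 2) y * beta1 (k ^ 2) x)
      + (alpha (k ^ 2) x * beta1 (k ^ 2) y - alpha1 (k ^ 2) y * beta (k ^ 2) x) := by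
    rw [← two_mul_kernelZ]; ring
  set p := √(‖k‖ * x) with hp
  set wx := wt (‖k‖ * x)
  set wy := wt (‖k‖ * y)
  set e := Real.exp (|k.im| * (x - y)) with he_def
  set l := 1 + Real.log (x / y) with hl_def
  have hl1 : 1 ≤ l := by linarith
  have hp1 : 1 ≤ p := Real.one_le_sqrt.2 h.le
  rcases le_or_gt (‖k‖ * y) 1 with h' | h'
  · have ha : ‖k‖ * ‖k‖⁻¹ = 1 := mul_inv_cancel₀ hkp.ne'
    have hax : ‖k‖⁻¹ ≤ x := by
      rw [inv_le_iff_one_le_mul₀ hkp]; linarith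
    have hay : y ≤ ‖k‖⁻¹ := by
      rw [le_inv_comm₀ hy hkp, ← one_div, le_div_iff₀ hy]; exact h'
    obtain ⟨h1, h2, h3, h4, -⟩ := kernel_local_bound hC hs hy hay ha.le
    have hll : Real.log (‖k‖⁻¹ / y) ≤ Real.log (x / y) := by
      apply Real.log_le_log (by positivity); gcongr
    have hM : 4 * C ^ 2 * (1 + Real.log (‖k‖⁻¹ / y)) ≤ 4 * C ^ 2 * l := by
      rw [hl_def]; gcongr
    have hM' : 4 * C ^ 2 * l = 4 * C ^ 2 * l * (‖k‖ * ‖k‖⁻¹) := by rw [ha, mul_one]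
    -- Initial data at x = 1/|k| come from the local bound. Replacing log(1/(|k|y)) by log(x/y) only
    -- enlarges them.
    obtain ⟨h5, h6⟩ := free_growth hk (hu (beta (k ^ 2) y) (alpha (k ^ 2) y))
      (hv (beta (k ^ 2) y) (alpha (k ^ 2) y)) ha.ge hax (h1.trans hM) ((h2.trans hM).trans_eq hM')
    obtain ⟨h7, -⟩ := free_growth hk (hu (beta1 (k ^ 2) y) (alpha1 (k ^ 2) y))
      (hv (beta1 (k ^ 2) y) (alpha1 (k ^ 2) y)) ha.ge hax (h3.trans hM)
      ((h4.trans hM).trans_eq hM')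
    have hee : Real.exp (|k.im| * (x - ‖k‖⁻¹)) ≤ e := by
      apply Real.exp_le_exp.2
      gcongr
    rw [ha, Real.sqrt_one, ← hp] at h5 h6 h7
    have hwy := one_le_two_wt (by positivity) h'
    have hM0 : 0 ≤ 4 * C ^ 2 * l := by positivity
    constructor
    · calc _ ≤ _ := h5
        _ ≤ 8 * (4 * C ^ 2 * l) * (1 / p) * e * 1 * 1 := by rw [mul_one, mul_one]; gcongr
        _ ≤ 8 * (4 * C ^ 2 * l) * (1 / p) * e * (p * (2 * wx)) * (2 * wy) := by gcongr
        _ = 128 * (C ^ 2 * l * (wx * wy) * e) := by field_simp; ring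
        _ ≤ 1024 * (C ^ 2 * l * (wx * wy) * e) := by linarith [hpos (wx * wy) (by positivity)]
        _ = _ := by ring
    · refine le_of_mul_le_mul_left ?_ hkp
      rw [← norm_mul, hdec]
      refine (norm_add_le _ _).trans ((add_le_add h6 h7).trans ?_)
      have hpp : 1 / p ≤ p := by
        rw [div_le_iff₀ hp0]; nlinarith
      calc _ ≤ 8 * (4 * C ^ 2 * l) * (1 * p) * e + 8 * (4 * C ^ 2 * l) * p * e := by gcongr
        _ = 64 * C ^ 2 * l * p * e * 1 * 1 := by ring
        _ ≤ 64 * C ^ 2 * l * p * e * (p * (2 * wx)) ^ 3 * (2 * wy) := by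
          gcongr; exact one_le_pow₀ hwx
        _ = 1024 * C ^ 2 * ((p ^ 2) ^ 2 * wx ^ 3 * wy) * l * e := by ring
        _ = _ := by rw [hp2]; ring
  · have hr0 : 0 < √(‖k‖ * y) := Real.sqrt_pos.2 (by positivity)
    have hr2 : √(‖k‖ * y) ^ 2 = ‖k‖ * y := Real.sq_sqrt (by positivity)
    have hwy : 1 ≤ √(‖k‖ * y) * (2 * wt (‖k‖ * y)) := by
      have := inv_sqrt_le_two_wt h'.le
      rw [inv_le_iff_one_le_mul₀ hr0] at this; linarith
    have hrp : √(‖k‖ * y) ≤ p := Real.sqrt_le_sqrt hkyx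
    have hky0 : 0 < ‖k‖ * y := by positivity
    -- On the diagonal the kernel vanishes and its derivative x ∂ₓ equals 1, so M must satisfy M
    -- |k|y = 1.
    obtain ⟨h5, h6⟩ := free_growth hk (hu (beta (k ^ 2) y) (alpha (k ^ 2) y))
      (hv (beta (k ^ 2) y) (alpha (k ^ 2) y)) (M := 1 / (‖k‖ * y)) h'.le hyx
      (by rw [mul_comm, sub_self, norm_zero]; positivity)
      (by rw [alpha_wronskian, norm_one, one_div_mul_cancel hky0.ne'])
    -- The y-derivative has the complementary data: modulus 1 on the diagonal, and vanishing x ∂ₓ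
    -- there.
    obtain ⟨h7, -⟩ := free_growth hk (hu (beta1 (k ^ 2) y) (alpha1 (k ^ 2) y))
      (hv (beta1 (k ^ 2) y) (alpha1 (k ^ 2) y)) (M := 1) h'.le hyx
      (by rw [← norm_neg, neg_sub, alpha_wronskian, norm_one])
      (by rw [mul_comm, sub_self, norm_zero]; positivity)
    rw [← hp, ← he_def, ← hr2] at h5 h6
    rw [← hp, ← he_def] at h7
    set r := √(‖k‖ * y)
    rw [Real.sqrt_sq hr0.le] at h5 h6
    constructor
    · calc _ ≤ _ := h5
        _ = 8 * (1 / (p * r)) * e * 1 * 1 * 1 * 1 := by field_simp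
        _ ≤ 8 * (1 / (p * r)) * e * (p * (2 * wx)) * (r * (2 * wy)) * C ^ 2 * l := by gcongr
        _ = 32 * (C ^ 2 * l * (wx * wy) * e) := by field_simp; ring
        _ ≤ 1024 * (C ^ 2 * l * (wx * wy) * e) := by linarith [hpos (wx * wy) (by positivity)]
        _ = _ := by ring
    · refine le_of_mul_le_mul_left ?_ hkp
      rw [← norm_mul, hdec]
      refine (norm_add_le _ _).trans ((add_le_add h6 h7).trans ?_)
      have hpp : r / p ≤ p / r := by
        rw [div_le_div_iff₀ hp0 hr0]; gcongr
      calc _ ≤ 8 * (1 / r ^ 2) * (r * p) * e + 8 * 1 * (p / r) * e := by gcongr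
        _ = 16 * (p / r) * e * 1 * 1 * 1 * 1 := by field_simp; ring
        _ ≤ 16 * (p / r) * e * (p * (2 * wx)) ^ 3 * (r * (2 * wy)) * C ^ 2 * l := by
          gcongr; exact one_le_pow₀ hwx
        _ = 256 * (C ^ 2 * l * ((p ^ 2) ^ 2 * wx ^ 3 * wy) * e) := by field_simp; ring
        _ ≤ 1024 * (C ^ 2 * l * ((p ^ 2) ^ 2 * wx ^ 3 * wy) * e) := by
          linarith [hpos ((p ^ 2) ^ 2 * wx ^ 3 * wy) (by positivity)]
        _ = _ := by rw [hp2]; ring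

/-! ### Absolute continuity, primitives, and Grönwall's inequality -/

open Filter Topology

open AbsolutelyContinuousOnInterval in
/-- The primitive of an integrable vector-valued function is absolutely continuous. -/
theorem absolutelyContinuousOnInterval_integral {E : Type*} [NormedAddCommGroup E]
    [NormedSpace ℝ E] {f : ℝ → E} {a b c : ℝ} (hf : IntervalIntegrable f volume a b)
    (hc : c ∈ uIcc a b) :
    AbsolutelyContinuousOnInterval (fun x => ∫ t in c..x, f t) a b := by
  -- Increments are dominated by those of the primitive of ‖f‖, a real function for which the result
  -- is known.
  have hN := hf.norm.absolutelyContinuousOnInterval_intervalIntegral hc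
  refine squeeze_zero' (Eventually.of_forall fun E => Finset.sum_nonneg fun _ _ => dist_nonneg)
    ?_ hN
  have hmem : ∀ᶠ E in totalLengthFilter ⊓ 𝓟 (disjWithin a b), E ∈ disjWithin a b :=
    mem_inf_of_right (mem_principal_self _)
  filter_upwards [hmem] with E hE
  refine Finset.sum_le_sum fun i hi => ?_
  obtain ⟨h1, h2⟩ := hE.1 i hi
  have hint : ∀ x ∈ uIcc a b, ∀ y ∈ uIcc a b, IntervalIntegrable f volume x y :=
    fun x hx y hy => hf.mono_set (uIcc_subset_uIcc hx hy)
  rw [dist_eq_norm, dist_eq_norm,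
    intervalIntegral.integral_interval_sub_left (hint _ hc _ h1) (hint _ hc _ h2),
    intervalIntegral.integral_interval_sub_left (hint _ hc _ h1).norm (hint _ hc _ h2).norm]
  exact intervalIntegral.norm_integral_le_abs_integral_norm

/-- Fundamental theorem of calculus for absolutely continuous functions with an integrable
almost everywhere derivative. -/
theorem integral_eq_sub_of_absolutelyContinuous {E : Type*} [NormedAddCommGroup E]
    [NormedSpace ℝ E] [CompleteSpace E] {f f' : ℝ → E} {a b : ℝ}
    (hf : AbsolutelyContinuousOnInterval f a b) (hf' : IntervalIntegrable f' volume a b)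
    (hd : ∀ᵐ x, x ∈ uIcc a b → HasDerivAt f (f' x) x) :
    ∫ x in a..b, f' x = f b - f a := by
  have hac := hf.sub (absolutelyContinuousOnInterval_integral hf' left_mem_uIcc)
  have h0 : ∀ᵐ x, x ∈ uIcc a b → HasDerivAt (f - fun x => ∫ t in a..x, f' t) 0 x := by
    filter_upwards [hd, hf'.ae_hasDerivAt_integral] with x h1 h2 hx
    exact ((h1 hx).sub (h2 hx a left_mem_uIcc)).congr_deriv (sub_self _)
  obtain ⟨C, hC⟩ := hac.const_of_ae_hasDerivAt_zero h0
  have h1 := hC a left_mem_uIcc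
  have h2 := hC b right_mem_uIcc
  simp only [Pi.sub_apply, intervalIntegral.integral_same, sub_zero] at h1 h2
  rw [h1, ← h2]
  abel

theorem absolutelyContinuousOnInterval_pow_succ {f : ℝ → ℝ} {a b : ℝ}
    (hf : AbsolutelyContinuousOnInterval f a b) (n : ℕ) :
    AbsolutelyContinuousOnInterval (fun x => f x ^ (n + 1)) a b := by
  induction n with
  | zero => simpa using hf
  | succ n ih =>
    have := ih.mul hf
    exact this

/-- The integrand is the almost everywhere derivative of Mⁿ⁺¹/(n+1), M being the primitive of m.
This is the source of the factorials in both the Grönwall and the Neumann series arguments, for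
coefficients that are merely integrable. -/
theorem integral_mul_primitive_pow {m : ℝ → ℝ} {a x : ℝ} (hm : IntervalIntegrable m volume a x)
    (n : ℕ) :
    ∫ y in a..x, m y * (∫ t in a..y, m t) ^ n = (∫ t in a..x, m t) ^ (n + 1) / (n + 1) := by
  have hac := absolutelyContinuousOnInterval_integral hm left_mem_uIcc
  have h := integral_eq_sub_of_absolutelyContinuous
    (f := fun y => (∫ t in a..y, m t) ^ (n + 1))
    (f' := fun y => (n + 1) * (m y * (∫ t in a..y, m t) ^ n))
    (absolutelyContinuousOnInterval_pow_succ hac n)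
    ((hm.mul_continuousOn (hac.continuousOn.pow n)).const_mul _) ?_
  · rw [intervalIntegral.integral_const_mul] at h
    have hn : (n + 1 : ℝ) ≠ 0 := Nat.cast_add_one_ne_zero n
    rw [eq_div_iff hn, mul_comm, h]
    simp
  · filter_upwards [hm.ae_hasDerivAt_integral] with y hy hyx
    refine ((hy hyx a left_mem_uIcc).pow (n + 1)).congr_deriv ?_
    rw [Nat.add_sub_cancel]
    push_cast
    ring

theorem intervalIntegrable_of_Icc {E : Type*} [NormedAddCommGroup E] {f : ℝ → E} {a b x : ℝ}
    (hf : IntervalIntegrable f volume a b) (hx : x ∈ Icc a b) :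
    IntervalIntegrable f volume a x :=
  hf.mono_set (by
    rw [uIcc_of_le hx.1, uIcc_of_le (hx.1.trans hx.2)]; exact Icc_subset_Icc_right hx.2)

theorem primitive_nonneg {m : ℝ → ℝ} {b x : ℝ} (hm0 : ∀ y ∈ Ioc 0 b, 0 ≤ m y)
    (hx : x ∈ Icc 0 b) : 0 ≤ ∫ t in (0 : ℝ)..x, m t := by
  rw [intervalIntegral.integral_of_le hx.1]
  exact setIntegral_nonneg measurableSet_Ioc fun y hy => hm0 y ⟨hy.1, hy.2.trans hx.2⟩

theorem primitive_mono {m : ℝ → ℝ} {b x y : ℝ} (hm : IntervalIntegrable m volume 0 b)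
    (hm0 : ∀ y ∈ Ioc 0 b, 0 ≤ m y) (hx : x ∈ Icc 0 b) (hy : y ∈ Icc 0 b) (hxy : x ≤ y) :
    ∫ t in (0 : ℝ)..x, m t ≤ ∫ t in (0 : ℝ)..y, m t := by
  rw [intervalIntegral.integral_of_le hx.1, intervalIntegral.integral_of_le hy.1]
  refine setIntegral_mono_set (intervalIntegrable_of_Icc hm hy).1 ?_
    (LE.le.eventuallyLE (Ioc_subset_Ioc_right hxy))
  filter_upwards [ae_restrict_mem measurableSet_Ioc] with t ht
  exact hm0 t ⟨ht.1, ht.2.trans hy.2⟩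

/-- Grönwall's inequality in integral form, with an integrable coefficient. -/
theorem gronwall_integral {b c H : ℝ} {m E : ℝ → ℝ} (hm : IntervalIntegrable m volume 0 b)
    (hm0 : ∀ y ∈ Ioc 0 b, 0 ≤ m y) (hc : 0 ≤ c) (hE : ∀ x ∈ Ioc 0 b, E x ≤ H)
    (hmE : IntervalIntegrable (fun y => m y * E y) volume 0 b)
    (h : ∀ x ∈ Ioc 0 b, E x ≤ c + ∫ y in (0 : ℝ)..x, m y * E y) :
    ∀ x ∈ Ioc 0 b, E x ≤ c * Real.exp (∫ t in (0 : ℝ)..b, m t) := by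
  set M : ℝ → ℝ := fun x => ∫ t in (0 : ℝ)..x, m t with hM
  -- Iterating the hypothesis builds the exponential series. The a priori bound H is needed only for
  -- the remainder, which tends to 0.
  have hstep : ∀ n : ℕ, ∀ x ∈ Ioc 0 b, E x ≤
      c * ∑ j ∈ Finset.range n, M x ^ j / j.factorial + H * (M x ^ n / n.factorial) := by
    intro n
    induction n with
    | zero => intro x hx; simpa using hE x hx
    | succ n ih =>
      intro x hx
      have hxI : x ∈ Icc 0 b := Ioc_subset_Icc_self hx
      have hmx := intervalIntegrable_of_Icc hm hxI
      have hcont : ContinuousOn M (uIcc 0 x) :=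
        (absolutelyContinuousOnInterval_integral hmx left_mem_uIcc).continuousOn
      have hint : ∀ j : ℕ, IntervalIntegrable (fun y => m y * M y ^ j) volume 0 x :=
        fun j => hmx.mul_continuousOn (hcont.pow j)
      have hint' : ∀ (d : ℝ) (j : ℕ),
          IntervalIntegrable (fun y => d * (m y * M y ^ j)) volume 0 x :=
        fun d j => (hint j).const_mul d
      have hsum : IntervalIntegrable (fun y => ∑ j ∈ Finset.range n,
          c / j.factorial * (m y * M y ^ j)) volume 0 x := by
        have := IntervalIntegrable.sum (μ := volume) (a := (0 : ℝ)) (b := x) (Finset.range n)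
          (f := fun j y => c / j.factorial * (m y * M y ^ j)) (fun j _ => hint' _ j)
        exact this.congr fun y _ => by simp
      have hle : ∫ y in (0 : ℝ)..x, m y * E y ≤ ∫ y in (0 : ℝ)..x,
          ((∑ j ∈ Finset.range n, c / j.factorial * (m y * M y ^ j))
            + H / n.factorial * (m y * M y ^ n)) := by
        refine intervalIntegral.integral_mono_on_of_le_Ioo hx.1.le
          (intervalIntegrable_of_Icc hmE hxI) (hsum.add (hint' _ n)) fun y hy => ?_
        have hyb : y ∈ Ioc 0 b := ⟨hy.1, hy.2.le.trans hx.2⟩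
        refine (mul_le_mul_of_nonneg_left (ih y hyb) (hm0 y hyb)).trans_eq ?_
        rw [Finset.mul_sum, mul_add, Finset.mul_sum]
        congr 1
        · exact Finset.sum_congr rfl fun j _ => by ring
        · ring
      refine (h x hx).trans ((add_le_add_right hle c).trans_eq ?_)
      rw [intervalIntegral.integral_add hsum (hint' _ n), intervalIntegral.integral_const_mul,
        intervalIntegral.integral_finsetSum (fun j _ => hint' _ j)]
      simp only [intervalIntegral.integral_const_mul]
      have hpow : ∀ j : ℕ, ∫ y in (0 : ℝ)..x, m y * M y ^ j = M x ^ (j + 1) / (j + 1) :=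
        fun j => integral_mul_primitive_pow hmx j
      simp only [hpow]
      rw [Finset.sum_range_succ', mul_add, Finset.mul_sum]
      simp only [Nat.factorial_succ, pow_zero, Nat.factorial_zero, Nat.cast_one, div_one, mul_one]
      have hfac : ∀ (d : ℝ) (j : ℕ), d / j.factorial * (M x ^ (j + 1) / (j + 1))
          = d * (M x ^ (j + 1) / (((j + 1) * j.factorial : ℕ) : ℝ)) := by
        intro d j
        have h1 : (j + 1 : ℝ) ≠ 0 := Nat.cast_add_one_ne_zero j
        have h2 : (j.factorial : ℝ) ≠ 0 := by exact_mod_cast j.factorial_ne_zero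
        push_cast
        field_simp
      rw [Finset.sum_congr rfl fun j _ => hfac c j, hfac H n]
      ring
  intro x hx
  have hxI : x ∈ Icc 0 b := Ioc_subset_Icc_self hx
  have hb : b ∈ Icc 0 b := ⟨hx.1.le.trans hx.2, le_rfl⟩
  have hMx : 0 ≤ M x := primitive_nonneg hm0 hxI
  have hlim : Tendsto (fun n : ℕ => c * Real.exp (M b) + H * (M x ^ n / n.factorial)) atTop
      (𝓝 (c * Real.exp (M b) + H * 0)) :=
    tendsto_const_nhds.add ((FloorSemiring.tendsto_pow_div_factorial_atTop (M x)).const_mul H)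
  rw [mul_zero, add_zero] at hlim
  refine ge_of_tendsto' hlim fun n => (hstep n x hx).trans ?_
  gcongr
  exact (Real.sum_le_exp_of_nonneg hMx n).trans
    (Real.exp_le_exp.2 (primitive_mono hm hm0 hxI hb hx.2))

/-! ### Integrability of the averaged primitive -/

theorem hasDerivAt_log_div {b x : ℝ} (hb : 0 < b) (hx : 0 < x) :
    HasDerivAt (fun y => Real.log (b / y)) (-x⁻¹) x := by
  have h : HasDerivAt (fun y => Real.log b - Real.log y) (-x⁻¹) x := by
    simpa using (Real.hasDerivAt_log hx.ne').const_sub (Real.log b)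
  refine h.congr_of_eventuallyEq ?_
  filter_upwards [lt_mem_nhds hx] with y hy
  exact Real.log_div hb.ne' hy.ne'

/-- Integrate by parts against log(b/s), whose derivative is −1/s. The boundary term at b vanishes,
and the one at e is at most ∫₀ᵉ log(b/y) w(y) dy since log(b/·) decreases. The integrals over (e,b)
are thus bounded independently of e. This is where the logarithm in the moment condition on the
potential is used. -/
theorem integrable_primitive_div {w : ℝ → ℝ} {b : ℝ} (hb : 0 < b)
    (hw0 : ∀ y ∈ Ioc 0 b, 0 ≤ w y) (hw : IntervalIntegrable w volume 0 b)
    (hlw : IntervalIntegrable (fun y => Real.log (b / y) * w y) volume 0 b) :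
    IntervalIntegrable (fun s => (∫ y in (0 : ℝ)..s, w y) / s) volume 0 b := by
  set P : ℝ → ℝ := fun s => ∫ y in (0 : ℝ)..s, w y with hP
  have hPac := absolutelyContinuousOnInterval_integral hw left_mem_uIcc
  have hsub : ∀ e ∈ Ioc 0 b, uIcc e b ⊆ uIcc 0 b := fun e he => by
    rw [uIcc_of_le he.2, uIcc_of_le hb.le]; exact Icc_subset_Icc_left he.1.le
  have hlog0 : ∀ y ∈ Ioc 0 b, 0 ≤ Real.log (b / y) := fun y hy =>
    Real.log_nonneg ((one_le_div hy.1).2 hy.2)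
  have hint : ∀ e ∈ Ioc 0 b, IntervalIntegrable (fun s => P s / s) volume e b := by
    intro e he
    refine ContinuousOn.intervalIntegrable ((hPac.continuousOn.mono (hsub e he)).div
      continuousOn_id fun y hy => ?_)
    rw [uIcc_of_le he.2] at hy
    exact (he.1.trans_le hy.1).ne'
  have hbound : ∀ e ∈ Ioc 0 b, ∫ s in e..b, P s / s ≤ ∫ y in (0 : ℝ)..b, Real.log (b / y) * w y := by
    intro e he
    have hae : ∀ᵐ x, x ∈ uIcc e b → HasDerivAt (fun y => Real.log (b / y) * P y)
        (Real.log (b / x) * w x - P x / x) x := by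
      filter_upwards [hw.ae_hasDerivAt_integral] with x hx hxe
      have hx0 : 0 < x := by
        rw [uIcc_of_le he.2] at hxe; exact he.1.trans_le hxe.1
      refine ((hasDerivAt_log_div hb hx0).mul
        (hx (hsub e he hxe) 0 left_mem_uIcc)).congr_deriv ?_
      ring
    have hlac : AbsolutelyContinuousOnInterval (fun y => Real.log (b / y)) e b := by
      refine ContDiffOn.absolutelyContinuousOnInterval fun x hx => ?_
      rw [uIcc_of_le he.2] at hx
      have hx0 : 0 < x := he.1.trans_le hx.1
      refine ContDiffAt.contDiffWithinAt (ContDiffAt.log ?_ (by positivity))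
      exact contDiffAt_const.div contDiffAt_id hx0.ne'
    have hlwe := hlw.mono_set (hsub e he)
    have h1 := integral_eq_sub_of_absolutelyContinuous (hlac.mul (hPac.mono (hsub e he)))
      (hlwe.sub (hint e he)) hae
    rw [intervalIntegral.integral_sub hlwe (hint e he)] at h1
    simp only [Pi.mul_apply, div_self hb.ne', Real.log_one, zero_mul, zero_sub] at h1
    have heI : e ∈ Icc 0 b := Ioc_subset_Icc_self he
    have h2 : Real.log (b / e) * P e ≤ ∫ y in (0 : ℝ)..e, Real.log (b / y) * w y := by
      rw [hP, ← intervalIntegral.integral_const_mul]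
      refine intervalIntegral.integral_mono_on_of_le_Ioo he.1.le
        ((intervalIntegrable_of_Icc hw heI).const_mul _) (intervalIntegrable_of_Icc hlw heI)
        fun y hy => ?_
      have hyb : y ∈ Ioc 0 b := ⟨hy.1, hy.2.le.trans he.2⟩
      refine mul_le_mul_of_nonneg_right (Real.log_le_log (div_pos hb he.1) ?_) (hw0 y hyb)
      exact div_le_div_of_nonneg_left hb.le hy.1 hy.2.le
    have h3 := intervalIntegral.integral_add_adjacent_intervals
      (intervalIntegrable_of_Icc hlw heI) hlwe
    linarith
  rw [intervalIntegrable_iff_integrableOn_Ioc_of_le hb.le]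
  have hmem : ∀ᶠ e in 𝓝[>] (0 : ℝ), e ∈ Ioc 0 b := Ioc_mem_nhdsGT hb
  -- For e outside (0,b] the endpoint is set to b, so that the interval is empty and integrability
  -- holds for every e.
  refine integrableOn_Ioc_of_intervalIntegral_norm_bounded_left (l := 𝓝[>] (0 : ℝ))
    (a := fun e => if e ∈ Ioc 0 b then e else b)
    (I := ∫ y in (0 : ℝ)..b, Real.log (b / y) * w y) (fun e => ?_) ?_ ?_
  · split_ifs with h
    · exact (hint e h).1
    · simp
  · have : Tendsto (fun e : ℝ => e) (𝓝[>] (0 : ℝ)) (𝓝 0) := tendsto_id.mono_left nhdsWithin_le_nhds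
    refine this.congr' ?_
    filter_upwards [hmem] with e he
    rw [if_pos he]
  · filter_upwards [hmem] with e he
    rw [if_pos he]
    refine le_of_eq_of_le ?_ (hbound e he)
    rw [intervalIntegral.integral_of_le he.2]
    refine setIntegral_congr_fun measurableSet_Ioc fun s hs => ?_
    have hs0 : 0 < s := he.1.trans hs.1
    exact Real.norm_of_nonneg (div_nonneg (primitive_nonneg hw0 ⟨hs0.le, hs.2⟩) hs0.le)

/-! ### The Volterra operator on C([0,b]) -/

open BoundedContinuousFunction
/-- The integrability needed for the Volterra operator with potential `p` on `[0, b]`. -/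
def VolterraAdmissible (p : ℝ → ℂ) (b : ℝ) : Prop :=
  IntervalIntegrable (fun y : ℝ => (y : ℂ) * p y) volume 0 b ∧
    IntervalIntegrable (fun s : ℝ => (∫ y in (0 : ℝ)..s, ‖(y : ℂ) * p y‖) / s) volume 0 b

/-- `∫₀ˢ y p(y) u(y) dy`. -/
def flux (p u : ℝ → ℂ) (s : ℝ) : ℂ := ∫ y in (0 : ℝ)..s, (y : ℂ) * p y * u y

/-- The Volterra operator inverting `u ↦ (x u')' / x`, applied to `p u`. -/
def volterra (p u : ℝ → ℂ) (x : ℝ) : ℂ := ∫ s in (0 : ℝ)..x, flux p u s / (s : ℂ)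

theorem volterra_congr {p u v : ℝ → ℂ} {x : ℝ} (hx : 0 ≤ x) (h : EqOn u v (Icc 0 x)) :
    volterra p u x = volterra p v x := by
  refine intervalIntegral.integral_congr fun s hs => ?_
  rw [uIcc_of_le hx] at hs
  simp only [flux]
  congr 1
  refine intervalIntegral.integral_congr fun y hy => ?_
  rw [uIcc_of_le hs.1] at hy
  simp only [h ⟨hy.1, hy.2.trans hs.2⟩]

section
variable {p u : ℝ → ℂ} {b : ℝ}

theorem VolterraAdmissible.integrable_mul (hp : VolterraAdmissible p b) (hb : 0 ≤ b)
    (hu : ContinuousOn u (Icc 0 b)) :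
    IntervalIntegrable (fun y : ℝ => (y : ℂ) * p y * u y) volume 0 b :=
  hp.1.mul_continuousOn (by rwa [uIcc_of_le hb])

theorem VolterraAdmissible.absolutelyContinuous_flux (hp : VolterraAdmissible p b) (hb : 0 ≤ b)
    (hu : ContinuousOn u (Icc 0 b)) : AbsolutelyContinuousOnInterval (flux p u) 0 b :=
  absolutelyContinuousOnInterval_integral (hp.integrable_mul hb hu) left_mem_uIcc

theorem VolterraAdmissible.norm_flux_le (hp : VolterraAdmissible p b) (hb : 0 ≤ b)
    (hu : ContinuousOn u (Icc 0 b)) {D s : ℝ} (hs : s ∈ Icc 0 b) (hD : ∀ t ∈ Icc 0 s, ‖u t‖ ≤ D) :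
    ‖flux p u s‖ ≤ (∫ y in (0 : ℝ)..s, ‖(y : ℂ) * p y‖) * D := by
  have hi := intervalIntegrable_of_Icc (hp.integrable_mul hb hu) hs
  rw [← intervalIntegral.integral_mul_const]
  refine (intervalIntegral.norm_integral_le_integral_norm hs.1).trans
    (intervalIntegral.integral_mono_on hs.1 hi.norm
      ((intervalIntegrable_of_Icc hp.1.norm hs).mul_const _) fun y hy => ?_)
  rw [norm_mul]
  gcongr
  exact hD y hy

theorem VolterraAdmissible.norm_flux_div_le (hp : VolterraAdmissible p b) (hb : 0 ≤ b)
    (hu : ContinuousOn u (Icc 0 b)) {D s : ℝ} (hs : s ∈ Icc 0 b) (hD : ∀ t ∈ Icc 0 s, ‖u t‖ ≤ D) :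
    ‖flux p u s / (s : ℂ)‖ ≤ (∫ y in (0 : ℝ)..s, ‖(y : ℂ) * p y‖) / s * D := by
  rw [norm_div, Complex.norm_real, Real.norm_of_nonneg hs.1, div_mul_eq_mul_div]
  exact div_le_div_of_nonneg_right (hp.norm_flux_le hb hu hs hD) hs.1

theorem VolterraAdmissible.integrable_flux_div (hp : VolterraAdmissible p b) (hb : 0 ≤ b)
    (hu : ContinuousOn u (Icc 0 b)) :
    IntervalIntegrable (fun s : ℝ => flux p u s / (s : ℂ)) volume 0 b := by
  obtain ⟨D, hD⟩ := isCompact_Icc.exists_bound_of_continuousOn hu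
  refine (hp.2.mul_const D).mono_fun' ?_ ?_
  · rw [uIoc_of_le hb]
    have h1 := (hp.absolutelyContinuous_flux hb hu).continuousOn
    rw [uIcc_of_le hb] at h1
    refine ContinuousOn.aestronglyMeasurable ((h1.mono Ioc_subset_Icc_self).div
      Complex.continuous_ofReal.continuousOn fun y hy => ?_) measurableSet_Ioc
    exact_mod_cast hy.1.ne'
  · rw [uIoc_of_le hb]
    filter_upwards [ae_restrict_mem measurableSet_Ioc] with s hs
    exact hp.norm_flux_div_le hb hu (Ioc_subset_Icc_self hs)
      fun t ht => hD t ⟨ht.1, ht.2.trans hs.2⟩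

theorem VolterraAdmissible.absolutelyContinuous_volterra (hp : VolterraAdmissible p b)
    (hb : 0 ≤ b) (hu : ContinuousOn u (Icc 0 b)) :
    AbsolutelyContinuousOnInterval (volterra p u) 0 b :=
  absolutelyContinuousOnInterval_integral (hp.integrable_flux_div hb hu) left_mem_uIcc

/-- A monotone majorant can be taken out of the inner integral at its upper endpoint. The double
integral collapses to a single one with an integrable density, the shape required for iteration. -/
theorem VolterraAdmissible.norm_volterra_le (hp : VolterraAdmissible p b) (hb : 0 ≤ b)
    (hu : ContinuousOn u (Icc 0 b)) {Φ : ℝ → ℝ} (hΦc : ContinuousOn Φ (Icc 0 b))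
    (hΦ : MonotoneOn Φ (Icc 0 b)) (huΦ : ∀ t ∈ Icc 0 b, ‖u t‖ ≤ Φ t) {x : ℝ}
    (hx : x ∈ Icc 0 b) :
    ‖volterra p u x‖ ≤ ∫ s in (0 : ℝ)..x, (∫ y in (0 : ℝ)..s, ‖(y : ℂ) * p y‖) / s * Φ s := by
  have hi := intervalIntegrable_of_Icc (hp.integrable_flux_div hb hu) hx
  refine (intervalIntegral.norm_integral_le_integral_norm hx.1).trans
    (intervalIntegral.integral_mono_on hx.1 hi.norm
      (intervalIntegrable_of_Icc (hp.2.mul_continuousOn (by rwa [uIcc_of_le hb])) hx)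
      fun s hs => ?_)
  have hsb : s ∈ Icc 0 b := ⟨hs.1, hs.2.trans hx.2⟩
  refine hp.norm_flux_div_le hb hu hsb fun t ht => ?_
  have htb : t ∈ Icc 0 b := ⟨ht.1, ht.2.trans hsb.2⟩
  exact (huΦ t htb).trans (hΦ htb hsb ht.2)

theorem flux_sub_const_mul {q : ℝ → ℂ} (hq : VolterraAdmissible q b)
    (h1 : VolterraAdmissible (fun _ => 1) b) (hb : 0 ≤ b) (hu : ContinuousOn u (Icc 0 b)) (z : ℂ)
    {s : ℝ} (hs : s ∈ Icc 0 b) :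
    flux (fun y => q y - z) u s = flux q u s - z * flux (fun _ => 1) u s := by
  rw [flux, flux, flux, ← intervalIntegral.integral_const_mul, ← intervalIntegral.integral_sub
    (intervalIntegrable_of_Icc (hq.integrable_mul hb hu) hs)
    ((intervalIntegrable_of_Icc (h1.integrable_mul hb hu) hs).const_mul z)]
  congr 1
  funext y
  ring

/-- Affine dependence on the energy, the reason why the resolvent is analytic in z. -/
theorem volterra_sub_const_mul {q : ℝ → ℂ} (hq : VolterraAdmissible q b)
    (h1 : VolterraAdmissible (fun _ => 1) b) (hb : 0 ≤ b) (hu : ContinuousOn u (Icc 0 b)) (z : ℂ)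
    {x : ℝ} (hx : x ∈ Icc 0 b) :
    volterra (fun y => q y - z) u x = volterra q u x - z * volterra (fun _ => 1) u x := by
  rw [volterra, volterra, volterra, ← intervalIntegral.integral_const_mul,
    ← intervalIntegral.integral_sub (intervalIntegrable_of_Icc (hq.integrable_flux_div hb hu) hx)
    ((intervalIntegrable_of_Icc (h1.integrable_flux_div hb hu) hx).const_mul z)]
  refine intervalIntegral.integral_congr fun s hs => ?_
  rw [uIcc_of_le hx.1] at hs
  simp only [flux_sub_const_mul hq h1 hb hu z ⟨hs.1, hs.2.trans hx.2⟩]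
  ring

end

theorem flux_add {p u v : ℝ → ℂ} {s : ℝ}
    (hu : IntervalIntegrable (fun y : ℝ => (y : ℂ) * p y * u y) volume 0 s)
    (hv : IntervalIntegrable (fun y : ℝ => (y : ℂ) * p y * v y) volume 0 s) :
    flux p (fun y => u y + v y) s = flux p u s + flux p v s := by
  rw [flux, flux, flux, ← intervalIntegral.integral_add hu hv]
  congr 1
  funext y
  ring

theorem continuousOn_IccExtend {b : ℝ} (hb : 0 ≤ b) (U : (Icc (0 : ℝ) b →ᵇ ℂ)) (s : Set ℝ) :
    ContinuousOn (IccExtend hb U) s := U.continuous.Icc_extend'.continuousOn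

/-- The Volterra operator on `C([0, b])`. -/
def volterraCLM {p : ℝ → ℂ} {b : ℝ} (hb : 0 ≤ b) (hp : VolterraAdmissible p b) :
    (Icc (0 : ℝ) b →ᵇ ℂ) →L[ℂ] (Icc (0 : ℝ) b →ᵇ ℂ) :=
  LinearMap.mkContinuous
    { toFun := fun U => mkOfCompact ⟨fun x => volterra p (IccExtend hb U) x, by
        have h := (hp.absolutelyContinuous_volterra hb
          (continuousOn_IccExtend hb U _)).continuousOn
        rw [uIcc_of_le hb] at h
        exact h.domRestrict⟩
      map_add' := fun U V => by
        ext x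
        change volterra p (IccExtend hb ⇑(U + V)) x
          = volterra p (IccExtend hb ⇑U) x + volterra p (IccExtend hb ⇑V) x
        have hu := continuousOn_IccExtend hb U (Icc 0 b)
        have hv := continuousOn_IccExtend hb V (Icc 0 b)
        rw [volterra, volterra, volterra, ← intervalIntegral.integral_add
          (intervalIntegrable_of_Icc (hp.integrable_flux_div hb hu) x.2)
          (intervalIntegrable_of_Icc (hp.integrable_flux_div hb hv) x.2)]
        refine intervalIntegral.integral_congr fun s hs => ?_
        rw [uIcc_of_le x.2.1] at hs
        have hs' : s ∈ Icc 0 b := ⟨hs.1, hs.2.trans x.2.2⟩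
        rw [← add_div, ← flux_add (intervalIntegrable_of_Icc (hp.integrable_mul hb hu) hs')
          (intervalIntegrable_of_Icc (hp.integrable_mul hb hv) hs')]
        rfl
      map_smul' := fun c U => by
        ext x
        change volterra p (IccExtend hb ⇑(c • U)) x = c * volterra p (IccExtend hb ⇑U) x
        rw [volterra, volterra, ← intervalIntegral.integral_const_mul]
        refine intervalIntegral.integral_congr fun s hs => ?_
        rw [← mul_div_assoc, flux, flux, ← intervalIntegral.integral_const_mul]
        congr 2
        funext y
        have : IccExtend hb (⇑(c • U)) y = c * IccExtend hb (⇑U) y := rfl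
        rw [this]
        ring }
    (∫ s in (0 : ℝ)..b, (∫ y in (0 : ℝ)..s, ‖(y : ℂ) * p y‖) / s) (by
      intro U
      have hN : ∀ s ∈ Ioc 0 b, 0 ≤ (∫ y in (0 : ℝ)..s, ‖(y : ℂ) * p y‖) / s := fun s hs =>
        div_nonneg (primitive_nonneg (b := b) (fun y _ => norm_nonneg _)
          (Ioc_subset_Icc_self hs)) hs.1.le
      have hI := primitive_nonneg hN (right_mem_Icc.2 hb)
      rw [BoundedContinuousFunction.norm_le (by positivity)]
      intro x
      refine (hp.norm_volterra_le hb (continuousOn_IccExtend hb U _)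
        (Φ := fun _ => ‖U‖) continuousOn_const monotoneOn_const
        (fun t _ => U.norm_coe_le_norm _) x.2).trans ?_
      rw [intervalIntegral.integral_mul_const]
      gcongr
      exact primitive_mono hp.2 hN x.2 (right_mem_Icc.2 hb) x.2.2)

theorem continuousOn_primitive {m : ℝ → ℝ} {b : ℝ} (hb : 0 ≤ b)
    (hm : IntervalIntegrable m volume 0 b) :
    ContinuousOn (fun x => ∫ t in (0 : ℝ)..x, m t) (Icc 0 b) := by
  have := (absolutelyContinuousOnInterval_integral hm left_mem_uIcc).continuousOn
  rwa [uIcc_of_le hb] at this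

/-! ### Quasinilpotency and the analytic family of solutions -/

/-- An operator on `C([0, b])` of Volterra type is quasinilpotent. -/
theorem isUnit_one_sub_of_volterra_bound {b : ℝ} (hb : 0 ≤ b)
    (T : (Icc (0 : ℝ) b →ᵇ ℂ) →L[ℂ] (Icc (0 : ℝ) b →ᵇ ℂ)) {m : ℝ → ℝ}
    (hm : IntervalIntegrable m volume 0 b) (hm0 : ∀ y ∈ Ioc 0 b, 0 ≤ m y)
    (hT : ∀ (V : (Icc (0 : ℝ) b →ᵇ ℂ)) (Φ : ℝ → ℝ), ContinuousOn Φ (Icc 0 b) →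
      MonotoneOn Φ (Icc 0 b) → (∀ x, ‖V x‖ ≤ Φ x) →
      ∀ x : Icc (0 : ℝ) b, ‖T V x‖ ≤ ∫ s in (0 : ℝ)..x, m s * Φ s) :
    IsUnit (1 - T) := by
  set M : ℝ → ℝ := fun x => ∫ t in (0 : ℝ)..x, m t with hM
  have hMb : 0 ≤ M b := primitive_nonneg hm0 (right_mem_Icc.2 hb)
  -- Each majorant ‖U‖ Mⁿ/n! is monotone, so the hypothesis applies again and one integration raises
  -- n by one.
  have hpow : ∀ (n : ℕ) (U : (Icc (0 : ℝ) b →ᵇ ℂ)) (x : Icc (0 : ℝ) b),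
      ‖(T ^ n) U x‖ ≤ ‖U‖ / n.factorial * M x ^ n := by
    intro n U
    induction n with
    | zero => intro x; simpa using U.norm_coe_le_norm x
    | succ n ih =>
      intro x
      have h := hT ((T ^ n) U) (fun x => ‖U‖ / n.factorial * M x ^ n)
        (continuousOn_const.mul ((continuousOn_primitive hb hm).pow n)) (fun x hx y hy hxy => ?_) ih x
      · rw [pow_succ']
        refine h.trans_eq ?_
        have h1 : ∀ s, m s * (‖U‖ / n.factorial * M s ^ n)
            = ‖U‖ / n.factorial * (m s * M s ^ n) := fun s => by ring
        simp only [h1]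
        rw [intervalIntegral.integral_const_mul,
          integral_mul_primitive_pow (intervalIntegrable_of_Icc hm x.2) n, Nat.factorial_succ]
        have h2 : (n + 1 : ℝ) ≠ 0 := Nat.cast_add_one_ne_zero n
        simp only [hM]
        push_cast
        field_simp
      · have := primitive_mono hm hm0 hx hy hxy
        have h0 := primitive_nonneg hm0 hx
        simp only [hM]
        gcongr
  have hsum : Summable fun n => T ^ n := by
    refine Summable.of_norm_bounded (Real.summable_pow_div_factorial (M b)) fun n => ?_
    have h1 : 0 ≤ M b ^ n / n.factorial := by positivity
    refine ContinuousLinearMap.opNorm_le_bound _ h1 fun U => ?_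
    rw [BoundedContinuousFunction.norm_le (by positivity)]
    intro x
    refine (hpow n U x).trans ?_
    have := primitive_mono hm hm0 x.2 (right_mem_Icc.2 hb) x.2.2
    have h0 := primitive_nonneg hm0 x.2
    calc _ ≤ ‖U‖ / n.factorial * M b ^ n := by gcongr
      _ = _ := by ring
  exact isUnit_iff_exists.2
    ⟨∑' n, T ^ n, hsum.one_sub_mul_tsum_pow, hsum.tsum_pow_mul_one_sub⟩

theorem differentiableAt_comp_inverse {R : Type*} [NormedRing R] [HasSummableGeomSeries R]
    [NormedAlgebra ℂ R] {f : ℂ → R} {z : ℂ} (hf : DifferentiableAt ℂ f z) (hz : IsUnit (f z)) :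
    DifferentiableAt ℂ (fun z => Ring.inverse (f z)) z :=
  (differentiableAt_inverse (𝕜 := ℂ) hz).comp z hf

theorem volterraAdmissible_one {b : ℝ} (hb : 0 ≤ b) : VolterraAdmissible (fun _ => 1) b := by
  refine ⟨Continuous.intervalIntegrable (by fun_prop) _ _, ?_⟩
  have h : ∀ s ∈ Icc (0 : ℝ) b, (∫ y in (0 : ℝ)..s, ‖(y : ℂ) * 1‖) / s = s / 2 := by
    intro s hs
    have : ∫ y in (0 : ℝ)..s, ‖(y : ℂ) * 1‖ = ∫ y in (0 : ℝ)..s, y := by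
      refine intervalIntegral.integral_congr fun y hy => ?_
      rw [uIcc_of_le hs.1] at hy
      simp [abs_of_nonneg hy.1]
    rw [this, integral_id]
    rcases hs.1.eq_or_lt with h0 | h0
    · simp [← h0]
    · field_simp
      ring
  refine (Continuous.intervalIntegrable (u := fun s : ℝ => s / 2) (by fun_prop) 0 b).congr
    fun s hs => ?_
  rw [uIoc_of_le hb] at hs
  exact (h s (Ioc_subset_Icc_self hs)).symm

section
variable {q : ℝ → ℂ} {b : ℝ}

/-- The Volterra operator with potential `q - z`. -/
def energyCLM (hb : 0 ≤ b) (hq : VolterraAdmissible q b) (z : ℂ) :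
    (Icc (0 : ℝ) b →ᵇ ℂ) →L[ℂ] (Icc (0 : ℝ) b →ᵇ ℂ) :=
  volterraCLM hb hq - z • volterraCLM hb (volterraAdmissible_one hb)

theorem isUnit_one_sub_energyCLM (hb : 0 ≤ b) (hq : VolterraAdmissible q b) (z : ℂ) :
    IsUnit (1 - energyCLM hb hq z) := by
  have h1 := volterraAdmissible_one hb
  refine isUnit_one_sub_of_volterra_bound hb _ (hq.2.add (h1.2.const_mul ‖z‖))
    (fun s hs => ?_) fun V Φ hc hΦ hV x => ?_
  · have hs' : s ∈ Icc 0 b := Ioc_subset_Icc_self hs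
    have h2 := primitive_nonneg (b := b) (m := fun y : ℝ => ‖(y : ℂ) * q y‖)
      (fun y _ => norm_nonneg _) hs'
    have h3 := primitive_nonneg (b := b) (m := fun y : ℝ => ‖(y : ℂ) * 1‖)
      (fun y _ => norm_nonneg _) hs'
    have := hs.1
    positivity
  · have hV' : ∀ t ∈ Icc 0 b, ‖IccExtend hb V t‖ ≤ Φ t := fun t ht => by
      rw [IccExtend_of_mem hb V ht]; exact hV ⟨t, ht⟩
    have h2 := hq.norm_volterra_le hb (continuousOn_IccExtend hb V _) hc hΦ hV' x.2
    have h3 := h1.norm_volterra_le hb (continuousOn_IccExtend hb V _) hc hΦ hV' x.2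
    have hcu : ContinuousOn Φ (uIcc 0 b) := by rwa [uIcc_of_le hb]
    have hi2 := intervalIntegrable_of_Icc (hq.2.mul_continuousOn hcu) x.2
    have hi3 := intervalIntegrable_of_Icc (h1.2.mul_continuousOn hcu) x.2
    have h4 : ∀ s : ℝ, ((∫ y in (0 : ℝ)..s, ‖(y : ℂ) * q y‖) / s
        + ‖z‖ * ((∫ y in (0 : ℝ)..s, ‖(y : ℂ) * 1‖) / s)) * Φ s
        = (∫ y in (0 : ℝ)..s, ‖(y : ℂ) * q y‖) / s * Φ s
        + ‖z‖ * ((∫ y in (0 : ℝ)..s, ‖(y : ℂ) * 1‖) / s * Φ s) := fun s => by ring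
    simp only [h4]
    rw [intervalIntegral.integral_add hi2 (hi3.const_mul _), intervalIntegral.integral_const_mul]
    have h5 : energyCLM hb hq z V x = volterra q (IccExtend hb V) x
        - z * volterra (fun _ => 1) (IccExtend hb V) x := rfl
    rw [h5]
    refine (norm_sub_le _ _).trans (add_le_add h2 ?_)
    rw [norm_mul]
    gcongr

/-- The solution of `u = 1 + volterra (q - z) u` on `[0, b]`. -/
def volterraSol (hb : 0 ≤ b) (hq : VolterraAdmissible q b) (z : ℂ) : (Icc (0 : ℝ) b →ᵇ ℂ) :=
  Ring.inverse (1 - energyCLM hb hq z) 1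

/-- Inversion is analytic on the units of the operator algebra and 1 − T(z) is affine in z.
Differentiability holds in the sup norm, which later gives bounds uniform in the space variable. -/
theorem differentiable_volterraSol (hb : 0 ≤ b) (hq : VolterraAdmissible q b) :
    Differentiable ℂ (volterraSol hb hq) := by
  intro z
  have h1 : DifferentiableAt ℂ (fun z => 1 - energyCLM hb hq z) z :=
    (differentiableAt_const _).sub ((differentiableAt_const _).sub
      (differentiableAt_id.smul_const (volterraCLM hb (volterraAdmissible_one hb))))
  have h3 := differentiableAt_comp_inverse
    (R := (Icc (0 : ℝ) b →ᵇ ℂ) →L[ℂ] (Icc (0 : ℝ) b →ᵇ ℂ))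
    (f := fun z => 1 - energyCLM hb hq z) h1 (isUnit_one_sub_energyCLM hb hq z)
  exact h3.clm_apply (differentiableAt_const 1)

theorem volterraSol_eq (hb : 0 ≤ b) (hq : VolterraAdmissible q b) (z : ℂ) {x : ℝ}
    (hx : x ∈ Icc 0 b) :
    IccExtend hb (volterraSol hb hq z) x
      = 1 + volterra (fun y => q y - z) (IccExtend hb (volterraSol hb hq z)) x := by
  have h1 : (1 - energyCLM hb hq z) (volterraSol hb hq z) = 1 := by
    rw [volterraSol, ← mul_apply_eq_comp,
      Ring.mul_inverse_cancel _ (isUnit_one_sub_energyCLM hb hq z)]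
    rfl
  have h2 := congrArg (fun U : (Icc (0 : ℝ) b →ᵇ ℂ) => U ⟨x, hx⟩) h1
  have h5 : (1 - energyCLM hb hq z) (volterraSol hb hq z) ⟨x, hx⟩
      = volterraSol hb hq z ⟨x, hx⟩ - (volterra q (IccExtend hb (volterraSol hb hq z)) x
        - z * volterra (fun _ => 1) (IccExtend hb (volterraSol hb hq z)) x) := rfl
  simp only [h5, BoundedContinuousFunction.coe_one, Pi.one_apply] at h2
  rw [volterra_sub_const_mul hq (volterraAdmissible_one hb) hb (continuousOn_IccExtend hb _ _) z hx,
    IccExtend_of_mem hb _ hx]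
  linear_combination h2

theorem eq_volterraSol (hb : 0 ≤ b) (hq : VolterraAdmissible q b) (z : ℂ) {u : ℝ → ℂ}
    (hu : ContinuousOn u (Icc 0 b))
    (h : ∀ x ∈ Icc 0 b, u x = 1 + volterra (fun y => q y - z) u x) {x : ℝ} (hx : x ∈ Icc 0 b) :
    u x = volterraSol hb hq z ⟨x, hx⟩ := by
  set U : (Icc (0 : ℝ) b →ᵇ ℂ) := mkOfCompact ⟨fun x => u x, hu.domRestrict⟩ with hU
  have hUe : EqOn u (IccExtend hb U) (Icc 0 b) := fun t ht => by
    rw [IccExtend_of_mem hb _ ht]; rfl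
  have h1 : (1 - energyCLM hb hq z) U = 1 := by
    ext t
    have h5 : (1 - energyCLM hb hq z) U t
      = U t - (volterra q (IccExtend hb U) t
        - z * volterra (fun _ => 1) (IccExtend hb U) t) := rfl
    have h6 : U t = u t := rfl
    rw [h5, ← volterra_sub_const_mul hq (volterraAdmissible_one hb) hb
      (continuousOn_IccExtend hb _ _) z t.2, h6, h t t.2,
      volterra_congr t.2.1 (hUe.mono (Icc_subset_Icc_right t.2.2))]
    simp
  have h2 : U = volterraSol hb hq z := by
    rw [volterraSol, ← h1, ← mul_apply_eq_comp,
      Ring.inverse_mul_cancel _ (isUnit_one_sub_energyCLM hb hq z)]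
    rfl
  rw [← h2]
  rfl

end

/-! ### Potentials with a logarithmic moment -/

/-- Integrability of `p` on `(0, b)` with the weight `y (1 + |log y|)`. -/
def LogIntegrable (p : ℝ → ℂ) (b : ℝ) : Prop :=
  IntervalIntegrable (fun y : ℝ => ((y * (1 + |Real.log y|) : ℝ) : ℂ) * p y) volume 0 b

/-- Measurability is obtained by writing the product as the known integrable function times h/(1 +
|log y|), so none is required of p by itself. -/
theorem LogIntegrable.weight {p : ℝ → ℂ} {b : ℝ} (hb : 0 ≤ b) (hp : LogIntegrable p b)
    {h : ℝ → ℂ} (hc : ContinuousOn h (Ioc 0 b)) {D : ℝ}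
    (hD : ∀ y ∈ Ioc 0 b, ‖h y‖ ≤ D * (1 + |Real.log y|)) :
    IntervalIntegrable (fun y : ℝ => (y : ℂ) * h y * p y) volume 0 b := by
  have hpos : ∀ y : ℝ, 0 < 1 + |Real.log y| := fun y => by positivity
  have hlc : ContinuousOn (fun y : ℝ => ((1 + |Real.log y| : ℝ) : ℂ)) (Ioc 0 b) :=
    Complex.continuous_ofReal.comp_continuousOn (continuousOn_const.add
      (Real.continuousOn_log.mono (fun y hy => by simpa using hy.1.ne')).abs)
  refine (hp.norm.const_mul D).mono_fun' ?_ ?_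
  · rw [uIoc_of_le hb]
    have h1 : AEStronglyMeasurable (fun y : ℝ => h y / ((1 + |Real.log y| : ℝ) : ℂ))
        (volume.restrict (Ioc 0 b)) :=
      (hc.div hlc fun y _ => by exact_mod_cast (hpos y).ne').aestronglyMeasurable measurableSet_Ioc
    refine (h1.mul hp.1.aestronglyMeasurable).congr (Eventually.of_forall fun y => ?_)
    have : ((1 + |Real.log y| : ℝ) : ℂ) ≠ 0 := by exact_mod_cast (hpos y).ne'
    simp only [Pi.mul_apply]
    rw [Complex.ofReal_mul]
    field_simp
  · rw [uIoc_of_le hb]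
    filter_upwards [ae_restrict_mem measurableSet_Ioc] with y hy
    simp only [norm_mul, Complex.norm_real, Real.norm_of_nonneg hy.1.le,
      Real.norm_of_nonneg (hpos y).le]
    calc _ ≤ y * (D * (1 + |Real.log y|)) * ‖p y‖ := by
          have := hy.1; gcongr; exact hD y hy
      _ = _ := by ring

theorem LogIntegrable.sub_const {p : ℝ → ℂ} {b : ℝ} (hb : 0 ≤ b) (hp : LogIntegrable p b)
    (z : ℂ) : LogIntegrable (fun y => p y - z) b := by
  have h1 : IntervalIntegrable (fun y : ℝ => ((y + |y * Real.log y| : ℝ) : ℂ) * z) volume 0 b := by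
    have := Real.continuous_mul_log
    exact Continuous.intervalIntegrable (by fun_prop) _ _
  refine (hp.sub h1).congr fun y hy => ?_
  rw [uIoc_of_le hb] at hy
  simp only [abs_mul, abs_of_pos hy.1]
  push_cast
  ring

theorem LogIntegrable.volterraAdmissible {p : ℝ → ℂ} {b : ℝ} (hb : 0 < b)
    (hp : LogIntegrable p b) : VolterraAdmissible p b := by
  have h1 : IntervalIntegrable (fun y : ℝ => (y : ℂ) * p y) volume 0 b := by
    have := hp.weight hb.le (h := fun _ => 1) continuousOn_const (D := 1)
      (fun y _ => by rw [norm_one, one_mul]; linarith [abs_nonneg (Real.log y)])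
    simpa using this
  refine ⟨h1, integrable_primitive_div hb (fun y _ => norm_nonneg _) h1.norm ?_⟩
  have h2 := hp.weight hb.le (h := fun y => (Real.log (b / y) : ℂ)) (D := 1 + |Real.log b|) ?_ ?_
  · refine h2.norm.congr fun y hy => ?_
    rw [uIoc_of_le hb.le] at hy
    have h0 : 0 ≤ Real.log (b / y) := Real.log_nonneg ((one_le_div hy.1).2 hy.2)
    simp only [norm_mul, Complex.norm_real, Real.norm_of_nonneg h0]
    ring
  · refine Complex.continuous_ofReal.comp_continuousOn (ContinuousOn.log
      (continuousOn_const.div continuousOn_id fun y hy => hy.1.ne') fun y hy => ?_)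
    exact (div_pos hb hy.1).ne'
  · intro y hy
    rw [Complex.norm_real, Real.norm_eq_abs, Real.log_div hb.ne' hy.1.ne']
    have h3 := abs_sub (Real.log b) (Real.log y)
    have h4 := abs_nonneg (Real.log b)
    have h5 := abs_nonneg (Real.log y)
    nlinarith

/-- On (0,1] the weight 1 − log y equals 1 + |log y|; on [1,b] it is continuous and local
integrability suffices. -/
theorem AdmissiblePotential.logIntegrable {q : ℝ → ℝ} (hq : AdmissiblePotential q) {b : ℝ}
    (hb : 0 ≤ b) : LogIntegrable (fun y => (q y : ℂ)) b := by
  have hc : ContinuousOn (fun y : ℝ => y * (1 + |Real.log y|)) (Ioi 0) :=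
    continuousOn_id.mul (continuousOn_const.add
      (Real.continuousOn_log.mono (fun y hy => by simpa using (ne_of_gt hy))).abs)
  have hr : IntegrableOn (fun y : ℝ => y * (1 + |Real.log y|) * q y) (Ioc 0 b) := by
    have h1 : IntegrableOn (fun y : ℝ => y * (1 + |Real.log y|) * q y) (Ioc 0 1) := by
      refine Integrable.mono hq.2 ?_ ?_
      · exact ((hc.mono fun y hy => hy.1).aestronglyMeasurable measurableSet_Ioc).mul
          (hq.1.aestronglyMeasurable.mono_measure (Measure.restrict_mono (fun y hy => hy.1) le_rfl))
      · filter_upwards [ae_restrict_mem measurableSet_Ioc] with y hy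
        rw [abs_of_nonpos (Real.log_nonpos hy.1.le hy.2), ← sub_eq_add_neg]
        exact le_of_eq (by simp)
    have h2 : IntegrableOn (fun y : ℝ => y * (1 + |Real.log y|) * q y) (Icc 1 b) := by
      have hs : Icc 1 b ⊆ Ioi (0 : ℝ) := fun y hy => lt_of_lt_of_le one_pos hy.1
      exact (hq.1.integrableOn_compact_subset hs isCompact_Icc).continuousOn_mul (hc.mono hs)
        isCompact_Icc
    refine (h1.union h2).mono_set fun y hy => ?_
    rcases le_total y 1 with h | h
    · exact Or.inl ⟨hy.1, h⟩
    · exact Or.inr ⟨h, hy.2⟩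
  have h3 : IntervalIntegrable (fun y : ℝ => y * (1 + |Real.log y|) * q y) volume 0 b :=
    (intervalIntegrable_iff_integrableOn_Ioc_of_le hb).2 hr
  have h4 : IntervalIntegrable (fun y : ℝ => ((y * (1 + |Real.log y|) * q y : ℝ) : ℂ)) volume 0 b :=
    ⟨h3.1.ofReal, h3.2.ofReal⟩
  refine h4.congr fun y _ => ?_
  push_cast
  ring

theorem absolutelyContinuousOnInterval_congr {X : Type*} [PseudoMetricSpace X] {f g : ℝ → X}
    {a b : ℝ} (hf : AbsolutelyContinuousOnInterval f a b) (h : EqOn f g (uIcc a b)) :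
    AbsolutelyContinuousOnInterval g a b := by
  rw [absolutelyContinuousOnInterval_iff] at hf ⊢
  intro ε hε
  obtain ⟨δ, hδ, h1⟩ := hf ε hε
  refine ⟨δ, hδ, fun E hE hEδ => ?_⟩
  refine lt_of_eq_of_lt (Finset.sum_congr rfl fun i hi => ?_) (h1 E hE hEδ)
  rw [h (hE.1 i hi).1, h (hE.1 i hi).2]

theorem absolutelyContinuousOnInterval_of_hasDerivAt {f f' : ℝ → ℂ} {a b : ℝ}
    (hf : ∀ x ∈ uIcc a b, HasDerivAt f (f' x) x) (hf' : ContinuousOn f' (uIcc a b)) :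
    AbsolutelyContinuousOnInterval f a b := by
  obtain ⟨C, hC⟩ := isCompact_uIcc.exists_bound_of_continuousOn hf'
  refine LipschitzOnWith.absolutelyContinuousOnInterval (K := C.toNNReal)
    ((convex_uIcc a b).lipschitzOnWith_of_nnnorm_hasDerivWithin_le
      (fun x hx => (hf x hx).hasDerivWithinAt) fun x hx => ?_)
  rw [← NNReal.coe_le_coe, coe_nnnorm]
  exact (hC x hx).trans (Real.le_coe_toNNReal C)

theorem absolutelyContinuousOnInterval_mul {f g : ℝ → ℂ} {a b : ℝ}
    (hf : AbsolutelyContinuousOnInterval f a b) (hg : AbsolutelyContinuousOnInterval g a b) :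
    AbsolutelyContinuousOnInterval (fun x => f x * g x) a b := hf.smul hg

/-! ### Regular solutions and the Volterra equation -/

/-- `√(πx/2)` as a complex number. -/
def rt (x : ℝ) : ℂ := (Real.sqrt (Real.pi * x / 2) : ℂ)

theorem rt_sq {x : ℝ} (hx : 0 ≤ x) : rt x ^ 2 = Real.pi * x / 2 := by
  rw [rt, ← Complex.ofReal_pow, Real.sq_sqrt (by positivity)]
  push_cast
  ring

theorem rt_ne_zero {x : ℝ} (hx : 0 < x) : rt x ≠ 0 := by
  rw [rt]
  exact_mod_cast (Real.sqrt_pos.2 (by positivity)).ne'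

theorem hasDerivAt_rt {x : ℝ} (hx : 0 < x) : HasDerivAt rt (rt x / (2 * x)) x := by
  have h1 : HasDerivAt (fun x : ℝ => Real.pi * x / 2) (Real.pi / 2) x := by
    simpa using ((hasDerivAt_id x).const_mul Real.pi).div_const 2
  have h2 := (h1.sqrt (by positivity)).ofReal_comp
  refine h2.congr_deriv ?_
  have h3 := rt_sq hx.le
  have h4 := rt_ne_zero hx
  have h5 : (x : ℂ) ≠ 0 := by exact_mod_cast hx.ne'
  rw [rt] at *
  push_cast
  field_simp
  rw [h3]
  ring

/-- `u` is a continuous solution of `u = 1 + volterra (q - z) u` on `[0, ∞)`. -/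
def IsVolterraSolution (q : ℝ → ℝ) (z : ℂ) (u : ℝ → ℂ) : Prop :=
  ContinuousOn u (Ici 0) ∧ ∀ x, 0 ≤ x → u x = 1 + volterra (fun y => (q y : ℂ) - z) u x

section
variable {p u : ℝ → ℂ}

theorem continuousAt_flux (hp : ∀ b, 0 < b → VolterraAdmissible p b) (hu : ContinuousOn u (Ici 0))
    {x : ℝ} (hx : 0 < x) : ContinuousAt (flux p u) x := by
  have h := ((hp (x + 1) (by linarith)).absolutelyContinuous_flux (by linarith)
    (hu.mono Icc_subset_Ici_self)).continuousOn
  rw [uIcc_of_le (by linarith)] at h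
  exact h.continuousAt (Icc_mem_nhds hx (by linarith))

theorem hasDerivAt_volterra (hp : ∀ b, 0 < b → VolterraAdmissible p b)
    (hu : ContinuousOn u (Ici 0)) {x : ℝ} (hx : 0 < x) :
    HasDerivAt (volterra p u) (flux p u x / x) x := by
  have hc : ∀ y, 0 < y → ContinuousAt (fun s : ℝ => flux p u s / (s : ℂ)) y := fun y hy =>
    (continuousAt_flux hp hu hy).div Complex.continuous_ofReal.continuousAt
      (by exact_mod_cast hy.ne')
  refine intervalIntegral.integral_hasDerivAt_right
    ((hp x hx).integrable_flux_div hx.le (hu.mono Icc_subset_Ici_self)) ?_ (hc x hx)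
  exact ContinuousOn.stronglyMeasurableAtFilter isOpen_Ioi
    (fun y hy => (hc y hy).continuousWithinAt) x hx

theorem ae_hasDerivAt_flux (hp : ∀ b, 0 < b → VolterraAdmissible p b)
    (hu : ContinuousOn u (Ici 0)) :
    ∀ᵐ x : ℝ, 0 < x → HasDerivAt (flux p u) (x * p x * u x) x := by
  have h : ∀ n : ℕ, ∀ᵐ x : ℝ, x ∈ uIcc (0 : ℝ) (n + 1) → ∀ c ∈ uIcc (0 : ℝ) (n + 1),
      HasDerivAt (fun x => ∫ t in c..x, (t : ℂ) * p t * u t) (x * p x * u x) x := fun n =>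
    ((hp (n + 1) (by positivity)).integrable_mul (by positivity)
      (hu.mono Icc_subset_Ici_self)).ae_hasDerivAt_integral
  filter_upwards [ae_all_iff.2 h] with x hx hx0
  obtain ⟨n, hn⟩ := exists_nat_ge x
  refine hx n ?_ 0 left_mem_uIcc
  rw [uIcc_of_le (by positivity)]
  exact ⟨hx0.le, by linarith⟩

end

theorem AdmissiblePotential.volterraAdmissible {q : ℝ → ℝ} (hq : AdmissiblePotential q) (z : ℂ)
    (b : ℝ) (hb : 0 < b) : VolterraAdmissible (fun y => (q y : ℂ) - z) b :=
  ((hq.logIntegrable hb.le).sub_const hb.le z).volterraAdmissible hb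

/-- The reduced function `φ(z,x) / √(πx/2)`, extended by `1` to `x = 0`. -/
def reduced (f : ℝ → ℂ) (x : ℝ) : ℂ := if x = 0 then 1 else f x / rt x

theorem reduced_of_pos (f : ℝ → ℂ) {x : ℝ} (hx : 0 < x) : reduced f x = f x / rt x :=
  if_neg hx.ne'

/-- With v = x u', the equation reads v' = x(q − z)u almost everywhere, so v is the flux plus a
constant c. Integrating v/x gives u = volterra + c log x + const. Continuity of u at 0 forces c = 0,
and u(0) = 1 fixes the remaining constant. -/
theorem isVolterraSolution_of_isSolution {q : ℝ → ℝ} (hq : AdmissiblePotential q) {z : ℂ}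
    {f : ℝ → ℂ} (hf : IsSolution q z f) (hac : AbsolutelyContinuousOnInterval (reduced f) 0 1) :
    IsVolterraSolution q z (reduced f) := by
  obtain ⟨g, hfg, hg, hode⟩ := hf
  set u := reduced f with hu_def
  set p : ℝ → ℂ := fun y => (q y : ℂ) - z with hp_def
  have hp : ∀ b, 0 < b → VolterraAdmissible p b := hq.volterraAdmissible z
  -- This is x u' written in terms of f and its derivative g.
  set v : ℝ → ℂ := fun x => (x * g x - f x / 2) / rt x with hv_def
  have hu' : ∀ x, 0 < x → HasDerivAt u (v x / x) x := by
    intro x hx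
    have h1 : HasDerivAt (fun x => f x / rt x) (v x / x) x := by
      refine ((hfg x hx).div (hasDerivAt_rt hx) (rt_ne_zero hx)).congr_deriv ?_
      have h2 := rt_ne_zero hx
      have h3 : (x : ℂ) ≠ 0 := by exact_mod_cast hx.ne'
      simp only [hv_def]
      field_simp
    refine h1.congr_of_eventuallyEq ?_
    filter_upwards [lt_mem_nhds hx] with y hy
    exact reduced_of_pos f hy
  have huc : ContinuousOn u (Ici 0) := by
    intro x hx
    rcases (mem_Ici.1 hx).eq_or_lt with h | h
    · have h1 := hac.continuousOn
      rw [uIcc_of_le zero_le_one] at h1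
      have h2 := h1 0 (by simp)
      rw [← h]
      exact h2.mono_of_mem_nhdsWithin (Icc_mem_nhdsGE one_pos)
    · exact (hu' x h).continuousAt.continuousWithinAt
  have hvd : ∀ᵐ x : ℝ, 0 < x → HasDerivAt v (x * p x * u x) x := by
    rw [ae_restrict_iff' measurableSet_Ioi] at hode
    filter_upwards [hode] with x hx hx0
    obtain ⟨f2, h1, h2⟩ := hx hx0
    have h4 := rt_ne_zero hx0
    have h5 : (x : ℂ) ≠ 0 := by exact_mod_cast hx0.ne'
    have h6 : HasDerivAt (fun x : ℝ => (x : ℂ)) 1 x := Complex.ofRealCLM.hasDerivAt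
    refine (((h6.mul h1).sub ((hfg x hx0).div_const 2)).div
      (hasDerivAt_rt hx0) h4).congr_deriv ?_
    rw [show u x = f x / rt x from reduced_of_pos f hx0]
    have h7 : f2 = -(1 / (4 * (x : ℂ) ^ 2) * f x) + (q x - z) * f x := by linear_combination -h2
    simp only [hp_def, h7, Pi.sub_apply, Pi.mul_apply]
    field_simp
    ring
  have hvac : ∀ a b, 0 < a → a ≤ b → AbsolutelyContinuousOnInterval v a b := by
    intro a b ha hab
    have hpos : ∀ x ∈ uIcc a b, 0 < x := fun x hx => by
      rw [uIcc_of_le hab] at hx; exact ha.trans_le hx.1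
    have hgac := hg a b ha hab
    have hfac : AbsolutelyContinuousOnInterval f a b :=
      absolutelyContinuousOnInterval_of_hasDerivAt (fun x hx => hfg x (hpos x hx))
        hgac.continuousOn
    have hxac : AbsolutelyContinuousOnInterval (fun x : ℝ => (x : ℂ)) a b :=
      absolutelyContinuousOnInterval_of_hasDerivAt (f' := fun _ => 1)
        (fun x _ => Complex.ofRealCLM.hasDerivAt) continuousOn_const
    have hrc : ContinuousOn rt (uIcc a b) := fun x hx =>
      (hasDerivAt_rt (hpos x hx)).continuousAt.continuousWithinAt
    have hrac : AbsolutelyContinuousOnInterval (fun x => (rt x)⁻¹) a b := by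
      refine absolutelyContinuousOnInterval_of_hasDerivAt
        (fun x hx => (hasDerivAt_rt (hpos x hx)).inv (rt_ne_zero (hpos x hx))) ?_
      refine ((hrc.div (by fun_prop) fun x hx => ?_).neg).div (hrc.pow 2)
        fun x hx => pow_ne_zero 2 (rt_ne_zero (hpos x hx))
      have : (x : ℂ) ≠ 0 := by exact_mod_cast (hpos x hx).ne'
      simpa using this
    have h1 := absolutelyContinuousOnInterval_mul ((absolutelyContinuousOnInterval_mul hxac hgac).sub
      (hfac.const_smul (1 / 2 : ℂ))) hrac
    refine absolutelyContinuousOnInterval_congr h1 fun x _ => ?_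
    simp only [hv_def, Pi.sub_apply, smul_eq_mul]
    ring
  -- `v` differs from the flux by a constant
  have hconst : ∀ x, 0 < x → v x - flux p u x = v 1 - flux p u 1 := by
    have key : ∀ a b, 0 < a → a ≤ b → v b - flux p u b = v a - flux p u a := by
      intro a b ha hab
      have hb : 0 < b := ha.trans_le hab
      have hi := (hp b hb).integrable_mul hb.le (huc.mono Icc_subset_Ici_self)
      have hia : IntervalIntegrable (fun y : ℝ => (y : ℂ) * p y * u y) volume a b :=
        hi.mono_set (by
          rw [uIcc_of_le hab, uIcc_of_le hb.le]; exact Icc_subset_Icc_left ha.le)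
      have h1 := integral_eq_sub_of_absolutelyContinuous (hvac a b ha hab) hia (by
        filter_upwards [hvd] with x hx hxab
        rw [uIcc_of_le hab] at hxab
        exact hx (ha.trans_le hxab.1))
      have h2 := intervalIntegral.integral_interval_sub_left hi
        (intervalIntegrable_of_Icc hi ⟨ha.le, hab⟩)
      have h3 : flux p u b - flux p u a = v b - v a := h2.trans h1
      linear_combination -h3
    intro x hx
    rcases le_total x 1 with h | h
    · exact (key x 1 hx h).symm
    · exact key 1 x one_pos h
  set c := v 1 - flux p u 1
  have hlogconst : ∀ x, 0 < x → u x - volterra p u x - c * Real.log x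
      = u 1 - volterra p u 1 := by
    intro x hx
    have hd : ∀ x, 0 < x → HasDerivAt (fun x : ℝ => u x - volterra p u x - c * Real.log x) 0 x := by
      intro x hx
      refine (((hu' x hx).sub (hasDerivAt_volterra hp huc hx)).sub
        ((hasDerivAt_ofReal_log hx.ne').const_mul c)).congr_deriv ?_
      rw [← hconst x hx]
      ring
    have := isOpen_Ioi.is_const_of_deriv_eq_zero (convex_Ioi (0 : ℝ)).isPreconnected
      (fun x hx => (hd x hx).differentiableAt.differentiableWithinAt)
      (fun x hx => (hd x hx).deriv) hx (mem_Ioi.2 one_pos)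
    simpa using this
  have hVc : ContinuousOn (fun x => u x - volterra p u x) (Icc 0 1) := by
    have h1 := ((hp 1 one_pos).absolutelyContinuous_volterra zero_le_one
      (huc.mono Icc_subset_Ici_self)).continuousOn
    rw [uIcc_of_le zero_le_one] at h1
    exact (huc.mono Icc_subset_Ici_self).sub h1
  have hc0 : c = 0 := by
    obtain ⟨B, hB⟩ := isCompact_Icc.exists_bound_of_continuousOn hVc
    by_contra hc
    have hcn : 0 < ‖c‖ := norm_pos_iff.2 hc
    have hB1 := hB 1 (by simp)
    have hB0 : 0 ≤ B := (norm_nonneg _).trans hB1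
    -- Chosen so that |c log x| = 2B + 1, which exceeds the oscillation 2B allowed by the bound.
    set x := Real.exp (-((2 * B + 1) / ‖c‖)) with hx_def
    have hx0 : 0 < x := Real.exp_pos _
    have hx1 : x ≤ 1 := Real.exp_le_one_iff.2 (by
      have : 0 ≤ (2 * B + 1) / ‖c‖ := by positivity
      linarith)
    have h1 := hlogconst x hx0
    have h2 : c * Real.log x = (u x - volterra p u x) - (u 1 - volterra p u 1) := by
      linear_combination -h1
    have h3 : ‖c * Real.log x‖ = 2 * B + 1 := by
      rw [hx_def, Real.log_exp, norm_mul, Complex.norm_real, norm_neg,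
        Real.norm_of_nonneg (by positivity)]
      field_simp
    have h4 := norm_sub_le (u x - volterra p u x) (u 1 - volterra p u 1)
    rw [← h2, h3] at h4
    linarith [hB x ⟨hx0.le, hx1⟩]
  have hpos : ∀ x, 0 < x → u x - volterra p u x = u 1 - volterra p u 1 := by
    intro x hx
    have := hlogconst x hx
    rwa [hc0, zero_mul, sub_zero] at this
  have h0 : u 0 - volterra p u 0 = 1 := by simp [hu_def, reduced, volterra]
  have h1 : u 1 - volterra p u 1 = 1 := by
    have h2 : Tendsto (fun x => u x - volterra p u x) (𝓝[>] 0) (𝓝 (u 0 - volterra p u 0)) :=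
      (hVc 0 (by simp)).mono_left (nhdsWithin_le_of_mem (mem_of_superset
        (Ioc_mem_nhdsGT one_pos) Ioc_subset_Icc_self))
    have h3 : Tendsto (fun x => u x - volterra p u x) (𝓝[>] 0) (𝓝 (u 1 - volterra p u 1)) :=
      tendsto_const_nhds.congr' (by
        filter_upwards [self_mem_nhdsWithin] with x hx
        exact (hpos x hx).symm)
    rw [tendsto_nhds_unique h3 h2, h0]
  refine ⟨huc, fun x hx => ?_⟩
  rcases hx.eq_or_lt with h | h
  · rw [← h]; linear_combination h0
  · linear_combination hpos x h + h1

theorem IsVolterraSolution.isSolution {q : ℝ → ℝ} (hq : AdmissiblePotential q) {z : ℂ}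
    {u : ℝ → ℂ} (hu : IsVolterraSolution q z u) :
    IsSolution q z (fun x => rt x * u x) ∧
      AbsolutelyContinuousOnInterval (reduced fun x => rt x * u x) 0 1 := by
  obtain ⟨huc, hue⟩ := hu
  set p : ℝ → ℂ := fun y => (q y : ℂ) - z with hp_def
  have hp : ∀ b, 0 < b → VolterraAdmissible p b := hq.volterraAdmissible z
  set v := flux p u with hv_def
  have hu' : ∀ x, 0 < x → HasDerivAt u (v x / x) x := by
    intro x hx
    refine ((hasDerivAt_volterra hp huc hx).const_add 1).congr_of_eventuallyEq ?_
    filter_upwards [lt_mem_nhds hx] with y hy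
    exact hue y hy.le
  constructor
  · refine ⟨fun x => rt x / x * (u x / 2 + v x), fun x hx => ?_, fun a b ha hab => ?_, ?_⟩
    · refine ((hasDerivAt_rt hx).mul (hu' x hx)).congr_deriv ?_
      have h3 : (x : ℂ) ≠ 0 := by exact_mod_cast hx.ne'
      field_simp
    · have hpos : ∀ x ∈ uIcc a b, 0 < x := fun x hx => by
        rw [uIcc_of_le hab] at hx; exact ha.trans_le hx.1
      have hb : 0 < b := ha.trans_le hab
      have hrc : ContinuousOn rt (uIcc a b) := fun x hx =>
        (hasDerivAt_rt (hpos x hx)).continuousAt.continuousWithinAt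
      have hne : ∀ x ∈ uIcc a b, (x : ℂ) ≠ 0 := fun x hx => by
        exact_mod_cast (hpos x hx).ne'
      have hsub : uIcc a b ⊆ uIcc 0 b := by
        rw [uIcc_of_le hab, uIcc_of_le hb.le]; exact Icc_subset_Icc_left ha.le
      have hvac : AbsolutelyContinuousOnInterval v a b :=
        ((hp b hb).absolutelyContinuous_flux hb.le (huc.mono Icc_subset_Ici_self)).mono hsub
      have huac : AbsolutelyContinuousOnInterval u a b :=
        absolutelyContinuousOnInterval_of_hasDerivAt (fun x hx => hu' x (hpos x hx))
          (hvac.continuousOn.div (by fun_prop) hne)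
      have hrac : AbsolutelyContinuousOnInterval (fun x => rt x / (x : ℂ)) a b := by
        refine absolutelyContinuousOnInterval_of_hasDerivAt
          (fun x hx => (hasDerivAt_rt (hpos x hx)).div Complex.ofRealCLM.hasDerivAt (hne x hx)) ?_
        refine ContinuousOn.div (ContinuousOn.sub (ContinuousOn.mul (hrc.div (by fun_prop)
          fun x hx => ?_) ?_) (hrc.mul continuousOn_const)) ?_
          fun x hx => pow_ne_zero 2 (hne x hx)
        · simpa using hne x hx
        · exact Complex.continuous_ofReal.continuousOn
        · exact (Complex.continuous_ofReal.pow 2).continuousOn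
      have h1 := absolutelyContinuousOnInterval_mul hrac ((huac.const_smul (1 / 2 : ℂ)).add hvac)
      refine absolutelyContinuousOnInterval_congr h1 fun x _ => ?_
      simp only [Pi.add_apply, smul_eq_mul]
      ring
    · rw [ae_restrict_iff' measurableSet_Ioi]
      filter_upwards [ae_hasDerivAt_flux hp huc] with x hx hx0
      have h3 : (x : ℂ) ≠ 0 := by exact_mod_cast (ne_of_gt hx0)
      refine ⟨_, ((hasDerivAt_rt hx0).div Complex.ofRealCLM.hasDerivAt h3).mul
        (((hu' x hx0).div_const 2).add (hx hx0)), ?_⟩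
      simp only [hp_def, Complex.ofRealCLM_apply, Pi.div_apply, Complex.ofReal_one]
      field_simp
      ring
  · have h1 := (hp 1 one_pos).absolutelyContinuous_volterra zero_le_one
      (huc.mono Icc_subset_Ici_self)
    have h2 : AbsolutelyContinuousOnInterval (fun _ : ℝ => (1 : ℂ)) 0 1 :=
      absolutelyContinuousOnInterval_of_hasDerivAt (f' := fun _ => 0)
        (fun x _ => hasDerivAt_const x 1) continuousOn_const
    refine absolutelyContinuousOnInterval_congr (h2.add h1) fun x hx => ?_
    rw [uIcc_of_le zero_le_one] at hx
    simp only [Pi.add_apply]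
    rw [← hue x hx.1]
    rcases hx.1.eq_or_lt with h | h
    · rw [← h, hue 0 le_rfl]
      simp [reduced, volterra]
    · rw [reduced_of_pos _ h, mul_div_cancel_left₀ _ (rt_ne_zero h)]

/-! ### Gluing the solutions on [0,b] into one on [0,∞) -/

/-- The Volterra solution on `[0, ∞)`. -/
def radialSol {q : ℝ → ℝ} (hq : AdmissiblePotential q) (z : ℂ) (x : ℝ) : ℂ :=
  if hx : 0 < x then
    volterraSol hx.le ((hq.logIntegrable hx.le).volterraAdmissible hx) z ⟨x, hx.le, le_rfl⟩
  else 1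

theorem volterraSol_satisfies {q : ℝ → ℝ} (hq : AdmissiblePotential q) (z : ℂ) {b : ℝ}
    (hb : 0 < b) {u : ℝ → ℂ} (hu : IsVolterraSolution q z u) {x : ℝ} (hx : x ∈ Icc 0 b) :
    u x = volterraSol hb.le ((hq.logIntegrable hb.le).volterraAdmissible hb) z ⟨x, hx⟩ :=
  eq_volterraSol hb.le _ z (hu.1.mono Icc_subset_Ici_self) (fun x hx => hu.2 x hx.1) hx

/-- The solution on [0,b] also solves the equation on [0,x], so uniqueness there identifies its
value at x with the one chosen in `radialSol`. -/
theorem radialSol_eqOn {q : ℝ → ℝ} (hq : AdmissiblePotential q) (z : ℂ) {b : ℝ} (hb : 0 < b) :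
    EqOn (radialSol hq z) (IccExtend hb.le
      (volterraSol hb.le ((hq.logIntegrable hb.le).volterraAdmissible hb) z)) (Icc 0 b) := by
  intro x hx
  rcases hx.1.eq_or_lt with h | h
  · rw [volterraSol_eq hb.le _ z hx, ← h]
    simp [radialSol, volterra]
  · rw [radialSol, dif_pos h]
    refine (eq_volterraSol h.le _ z (continuousOn_IccExtend hb.le _ _) (fun y hy => ?_)
      (right_mem_Icc.2 h.le)).symm
    exact volterraSol_eq hb.le _ z ⟨hy.1, hy.2.trans hx.2⟩

theorem isVolterraSolution_radialSol {q : ℝ → ℝ} (hq : AdmissiblePotential q) (z : ℂ) :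
    IsVolterraSolution q z (radialSol hq z) := by
  constructor
  · intro x hx
    have hb : 0 < x + 1 := by linarith [mem_Ici.1 hx]
    have h1 : ContinuousOn (radialSol hq z) (Icc 0 (x + 1)) :=
      (continuousOn_IccExtend hb.le _ _).congr (radialSol_eqOn hq z hb)
    refine (h1 x ⟨hx, by linarith⟩).mono_of_mem_nhdsWithin ?_
    rw [← Ici_inter_Iic]
    exact inter_mem self_mem_nhdsWithin (mem_nhdsWithin_of_mem_nhds (Iic_mem_nhds (by linarith)))
  · intro x hx
    have hb : 0 < x + 1 := by linarith
    have h1 := radialSol_eqOn hq z hb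
    rw [h1 ⟨hx, by linarith⟩, volterraSol_eq hb.le _ z ⟨hx, by linarith⟩,
      volterra_congr hx (h1.symm.mono (Icc_subset_Icc_right (by linarith)))]

theorem exists_isRegularSolution {q : ℝ → ℝ} (hq : AdmissiblePotential q) :
    ∃ φ : ℂ → ℝ → ℂ, IsRegularSolution q φ :=
  ⟨fun z x => rt x * radialSol hq z x, fun z => (isVolterraSolution_radialSol hq z).isSolution hq⟩

theorem IsRegularSolution.isVolterraSolution {q : ℝ → ℝ} (hq : AdmissiblePotential q)
    {φ : ℂ → ℝ → ℂ} (hφ : IsRegularSolution q φ) (z : ℂ) :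
    IsVolterraSolution q z (reduced (φ z)) :=
  isVolterraSolution_of_isSolution hq (hφ z).1 (hφ z).2

theorem eq_rt_mul_reduced (f : ℝ → ℂ) {x : ℝ} (hx : 0 < x) : f x = rt x * reduced f x := by
  rw [reduced_of_pos f hx, mul_div_cancel₀ _ (rt_ne_zero hx)]

/-! ### Behaviour of the kernel and the flux near y = 0 -/

theorem exists_ser_bound_ball (R : ℝ) : ∃ C : ℝ, 0 ≤ C ∧ ∀ s : ℂ, ‖s‖ ≤ R →
    ‖serA s‖ ≤ C ∧ ‖serB s‖ ≤ C ∧ ‖serA' s‖ ≤ C ∧ ‖serB' s‖ ≤ C := by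
  have hK : IsCompact (Metric.closedBall (0 : ℂ) R) := isCompact_closedBall _ _
  obtain ⟨c1, h1⟩ := hK.exists_bound_of_continuousOn differentiable_serA.continuous.continuousOn
  obtain ⟨c2, h2⟩ := hK.exists_bound_of_continuousOn differentiable_serB.continuous.continuousOn
  obtain ⟨c3, h3⟩ := hK.exists_bound_of_continuousOn differentiable_serA'.continuous.continuousOn
  obtain ⟨c4, h4⟩ := hK.exists_bound_of_continuousOn differentiable_serB'.continuous.continuousOn
  refine ⟨|c1| + |c2| + |c3| + |c4|, by positivity, fun s hs => ?_⟩
  have hs' : s ∈ Metric.closedBall (0 : ℂ) R := by simpa using hs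
  refine ⟨(h1 s hs').trans ?_, (h2 s hs').trans ?_, (h3 s hs').trans ?_, (h4 s hs').trans ?_⟩ <;>
  linarith [abs_nonneg c1, abs_nonneg c2, abs_nonneg c3, abs_nonneg c4, le_abs_self c1,
    le_abs_self c2, le_abs_self c3, le_abs_self c4]

/-- The kernel and its energy derivative have at most a logarithmic singularity at `y = 0`,
locally uniformly in the energy. -/
theorem exists_kernel_log_bound (z₀ : ℂ) {x : ℝ} (hx : 0 < x) : ∃ D : ℝ, 0 ≤ D ∧
    ∀ z ∈ Metric.closedBall z₀ 1, ∀ y ∈ Ioc 0 x,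
      ‖kernel z x y‖ ≤ D * (1 + |Real.log y|) ∧ ‖kernelZ z x y‖ ≤ D * (1 + |Real.log y|) := by
  obtain ⟨C, hC0, hC⟩ := exists_ser_bound_ball ((‖z₀‖ + 1) * x ^ 2 / 4)
  refine ⟨(1 + 2 * x ^ 2) * (C ^ 2 * (2 + |Real.log x|)), by positivity, fun z hz y hy => ?_⟩
  have hzn : ‖z‖ ≤ ‖z₀‖ + 1 := by
    have h1 : ‖z - z₀‖ ≤ 1 := by simpa [dist_eq_norm] using hz
    have h2 := norm_add_le (z - z₀) z₀
    rw [sub_add_cancel] at h2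
    linarith
  have hs : ∀ y ∈ Ioc 0 x, ‖-z * (y : ℂ) ^ 2 / 4‖ ≤ (‖z₀‖ + 1) * x ^ 2 / 4 := by
    intro y hy
    rw [norm_div, norm_mul, norm_neg, norm_pow, Complex.norm_real, Real.norm_of_nonneg hy.1.le,
      Complex.norm_ofNat]
    have := hy.1.le
    have := hy.2
    gcongr
  have hmem : x ∈ Ioc 0 x := ⟨hx, le_rfl⟩
  set lx := |Real.log x|
  set ly := |Real.log y|
  have hlx : 0 ≤ lx := abs_nonneg _
  have hly : 0 ≤ ly := abs_nonneg _
  have hlog : ∀ (t : ℝ) (b a : ℂ), ‖b‖ ≤ C → ‖a‖ ≤ C → ‖b - (Real.log t : ℂ) * a‖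
      ≤ C * (1 + |Real.log t|) := by
    intro t b a hb ha
    refine (norm_sub_le _ _).trans ?_
    rw [norm_mul, Complex.norm_real, Real.norm_eq_abs]
    have := mul_le_mul_of_nonneg_left ha (abs_nonneg (Real.log t))
    linarith
  have hq4 : ∀ t ∈ Ioc 0 x, ∀ (a : ℂ) (d : ℝ), ‖a‖ ≤ d → ‖(-(t : ℂ) ^ 2 / 4) * a‖ ≤ x ^ 2 * d := by
    intro t ht a d ha
    rw [norm_mul, norm_div, norm_neg, norm_pow, Complex.norm_real, Real.norm_of_nonneg ht.1.le,
      Complex.norm_ofNat]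
    have hd : 0 ≤ d := (norm_nonneg _).trans ha
    have h1 : t ^ 2 ≤ x ^ 2 := pow_le_pow_left₀ ht.1.le ht.2 2
    calc _ ≤ (x ^ 2 / 4) * d := by gcongr
      _ ≤ _ := by
        have : 0 ≤ x ^ 2 * d := by positivity
        linarith
  obtain ⟨a1, a2, a3, a4⟩ := hC _ (hs x hmem)
  obtain ⟨b1, b2, b3, b4⟩ := hC _ (hs y hy)
  have hβx : ‖beta z x‖ ≤ C * (1 + lx) := hlog x _ _ a2 a1
  have hβy : ‖beta z y‖ ≤ C * (1 + ly) := hlog y _ _ b2 b1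
  have hαx : ‖alpha z x‖ ≤ C := a1
  have hαy : ‖alpha z y‖ ≤ C := b1
  have hαZx : ‖alphaZ z x‖ ≤ x ^ 2 * C := hq4 x hmem _ _ a3
  have hαZy : ‖alphaZ z y‖ ≤ x ^ 2 * C := hq4 y hy _ _ b3
  have hβZx : ‖betaZ z x‖ ≤ x ^ 2 * (C * (1 + lx)) := hq4 x hmem _ _ (hlog x _ _ a4 a3)
  have hβZy : ‖betaZ z y‖ ≤ x ^ 2 * (C * (1 + ly)) := hq4 y hy _ _ (hlog y _ _ b4 b3)
  have hm : ∀ (a b : ℂ) (c d : ℝ), ‖a‖ ≤ c → ‖b‖ ≤ d → ‖a * b‖ ≤ c * d := fun a b c d h1 h2 => by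
    rw [norm_mul]
    exact mul_le_mul h1 h2 (norm_nonneg _) ((norm_nonneg _).trans h1)
  have hE : 0 ≤ C ^ 2 * (lx * ly) := by positivity
  have hE1 : 0 ≤ C ^ 2 * lx := by positivity
  have hE2 : 0 ≤ C ^ 2 * ly := by positivity
  have hE3 : 0 ≤ C ^ 2 := by positivity
  have hkey : C * (C * (1 + ly)) + C * (C * (1 + lx)) ≤ C ^ 2 * (2 + lx) * (1 + ly) := by nlinarith
  have hT : 0 ≤ C ^ 2 * (2 + lx) * (1 + ly) := by positivity
  have hX : 0 ≤ x ^ 2 := by positivity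
  have hXT : 0 ≤ x ^ 2 * (C ^ 2 * (2 + lx) * (1 + ly)) := by positivity
  constructor
  · have h1 := norm_sub_le (alpha z x * beta z y) (alpha z y * beta z x)
    have h2 := hm _ _ _ _ hαx hβy
    have h3 := hm _ _ _ _ hαy hβx
    rw [kernel]
    linarith
  · have h1 := norm_sub_le (alphaZ z x * beta z y + alpha z x * betaZ z y)
      (alphaZ z y * beta z x + alpha z y * betaZ z x)
    have h2 := norm_add_le (alphaZ z x * beta z y) (alpha z x * betaZ z y)
    have h3 := norm_add_le (alphaZ z y * beta z x) (alpha z y * betaZ z x)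
    have h4 := hm _ _ _ _ hαZx hβy
    have h5 := hm _ _ _ _ hαx hβZy
    have h6 := hm _ _ _ _ hαZy hβx
    have h7 := hm _ _ _ _ hαy hβZx
    have h8 := mul_le_mul_of_nonneg_left hkey hX
    rw [kernelZ]
    have h9 : x ^ 2 * C * (C * (1 + ly)) + C * (x ^ 2 * (C * (1 + ly)))
        + (x ^ 2 * C * (C * (1 + lx)) + C * (x ^ 2 * (C * (1 + lx))))
        = 2 * (x ^ 2 * (C * (C * (1 + ly)) + C * (C * (1 + lx)))) := by ring
    linarith

theorem continuousOn_kernel (z : ℂ) (x : ℝ) : ContinuousOn (kernel z x) (Ioi 0) := by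
  intro y hy
  have hy0 : y ≠ 0 := ne_of_gt hy
  exact ((continuousAt_const.mul (hasDerivAt_beta z hy0).continuousAt).sub
    ((hasDerivAt_alpha z hy0).continuousAt.mul continuousAt_const)).continuousWithinAt

theorem continuous_arg (z : ℂ) : Continuous fun y : ℝ => -z * (y : ℂ) ^ 2 / 4 := by fun_prop

theorem continuous_alphaZ (z : ℂ) : Continuous (alphaZ z) := by
  have h := differentiable_serA'.continuous.comp (continuous_arg z)
  exact (show Continuous fun y : ℝ => -(y : ℂ) ^ 2 / 4 by fun_prop).mul h

theorem continuousOn_betaZ (z : ℂ) : ContinuousOn (betaZ z) (Ioi 0) := by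
  have h1 := differentiable_serA'.continuous.comp (continuous_arg z)
  have h2 := differentiable_serB'.continuous.comp (continuous_arg z)
  have h3 : ContinuousOn (fun y : ℝ => (Real.log y : ℂ)) (Ioi 0) := fun y hy =>
    (hasDerivAt_ofReal_log (ne_of_gt hy)).continuousAt.continuousWithinAt
  exact (show Continuous fun y : ℝ => -(y : ℂ) ^ 2 / 4 by fun_prop).continuousOn.mul
    (h2.continuousOn.sub (h3.mul h1.continuousOn))

theorem continuousOn_kernelZ (z : ℂ) (x : ℝ) : ContinuousOn (kernelZ z x) (Ioi 0) := by
  have h1 : ContinuousOn (alpha z) (Ioi 0) := fun y hy =>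
    (hasDerivAt_alpha z (ne_of_gt hy)).continuousAt.continuousWithinAt
  have h2 : ContinuousOn (beta z) (Ioi 0) := fun y hy =>
    (hasDerivAt_beta z (ne_of_gt hy)).continuousAt.continuousWithinAt
  exact ((continuousOn_const.mul h2).add (continuousOn_const.mul (continuousOn_betaZ z))).sub
    (((continuous_alphaZ z).continuousOn.mul continuousOn_const).add
      (h1.mul continuousOn_const))

theorem continuous_alpha1 (z : ℂ) : Continuous (alpha1 z) :=
  continuous_const.mul ((continuous_arg z).mul
    (differentiable_serA'.continuous.comp (continuous_arg z)))

/-- The logarithm in x ∂ₓ β carries a factor x², and x² log x is continuous with value 0 at 0. The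
value −1 at 0 produces the inhomogeneous term in the Green equation. -/
theorem continuous_beta1 (z : ℂ) : Continuous (beta1 z) := by
  have h1 := differentiable_serA'.continuous.comp (continuous_arg z)
  have h2 := differentiable_serB'.continuous.comp (continuous_arg z)
  have h3 := differentiable_serA.continuous.comp (continuous_arg z)
  have h4 : Continuous fun y : ℝ => ((y * (y * Real.log y) : ℝ) : ℂ) := by
    have := Real.continuous_mul_log
    fun_prop
  have h5 : beta1 z = fun y : ℝ => 2 * ((-z * (y : ℂ) ^ 2 / 4) * serB' (-z * y ^ 2 / 4))
      - serA (-z * y ^ 2 / 4)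
      - 2 * (-z / 4) * ((y * (y * Real.log y) : ℝ) : ℂ) * serA' (-z * y ^ 2 / 4) := by
    funext y
    rw [beta1]
    push_cast
    ring
  rw [h5]
  exact ((continuous_const.mul ((continuous_arg z).mul h2)).sub h3).sub
    ((continuous_const.mul h4).mul h1)

theorem alpha1_zero (z : ℂ) : alpha1 z 0 = 0 := by simp [alpha1]

theorem beta1_zero (z : ℂ) : beta1 z 0 = -1 := by simp [beta1, serA_zero]

section
variable {p u : ℝ → ℂ}

theorem tendsto_primitive_zero {m : ℝ → ℝ} {b : ℝ} (hb : 0 < b)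
    (hm : IntervalIntegrable m volume 0 b) :
    Tendsto (fun x => ∫ t in (0 : ℝ)..x, m t) (𝓝[>] 0) (𝓝 0) := by
  have h := continuousOn_primitive hb.le hm 0 (left_mem_Icc.2 hb.le)
  rw [ContinuousWithinAt, intervalIntegral.integral_same] at h
  exact h.mono_left (nhdsWithin_le_of_mem (mem_of_superset (Ioc_mem_nhdsGT hb) Ioc_subset_Icc_self))

/-- For y ≤ s ≤ 1 one has |log s| ≤ |log y|, so the logarithm moves inside the integral and the
product is bounded by a vanishing piece of a convergent integral. This removes the boundary term
flux · kernel at 0. -/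
theorem tendsto_flux_mul_log (hp : LogIntegrable p 1) (hu : ContinuousOn u (Icc 0 1)) :
    Tendsto (fun s => ‖flux p u s‖ * (1 + |Real.log s|)) (𝓝[>] 0) (𝓝 0) := by
  obtain ⟨D, hD⟩ := isCompact_Icc.exists_bound_of_continuousOn hu
  have hlc : ContinuousOn (fun y : ℝ => ((1 + |Real.log y| : ℝ) : ℂ)) (Ioc 0 1) :=
    Complex.continuous_ofReal.comp_continuousOn (continuousOn_const.add
      (Real.continuousOn_log.mono (fun y hy => by simpa using hy.1.ne')).abs)
  have hi := hp.weight zero_le_one (h := fun y => ((1 + |Real.log y| : ℝ) : ℂ) * u y) (D := D)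
    (hlc.mul (hu.mono Ioc_subset_Icc_self)) fun y hy => by
      rw [norm_mul, Complex.norm_real, Real.norm_of_nonneg (by positivity), mul_comm]
      gcongr
      exact hD y (Ioc_subset_Icc_self hy)
  have hfl := (hp.volterraAdmissible one_pos).integrable_mul zero_le_one hu
  refine squeeze_zero' (Eventually.of_forall fun s => by positivity) ?_
    (tendsto_primitive_zero one_pos hi.norm)
  filter_upwards [Ioc_mem_nhdsGT one_pos] with s hs
  have hsI : s ∈ Icc (0 : ℝ) 1 := Ioc_subset_Icc_self hs
  calc _ ≤ (∫ y in (0 : ℝ)..s, ‖(y : ℂ) * p y * u y‖) * (1 + |Real.log s|) := by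
        gcongr
        exact intervalIntegral.norm_integral_le_integral_norm hs.1.le
    _ = ∫ y in (0 : ℝ)..s, ‖(y : ℂ) * p y * u y‖ * (1 + |Real.log s|) :=
        (intervalIntegral.integral_mul_const _ _).symm
    _ ≤ _ := by
        refine intervalIntegral.integral_mono_on_of_le_Ioo hs.1.le
          ((intervalIntegrable_of_Icc hfl hsI).norm.mul_const _)
          (intervalIntegrable_of_Icc hi.norm hsI) fun y hy => ?_
        have h1 : |Real.log s| ≤ |Real.log y| := by
          rw [abs_of_nonpos (Real.log_nonpos hs.1.le hs.2),
            abs_of_nonpos (Real.log_nonpos hy.1.le (hy.2.le.trans hs.2)), neg_le_neg_iff]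
          exact Real.log_le_log hy.1 hy.2.le
        have h2 : ‖((1 + |Real.log y| : ℝ) : ℂ)‖ = 1 + |Real.log y| := by
          rw [Complex.norm_real, Real.norm_of_nonneg (by positivity)]
        rw [norm_mul, norm_mul, norm_mul, norm_mul, norm_mul, h2]
        calc _ ≤ ‖(y : ℂ)‖ * ‖p y‖ * ‖u y‖ * (1 + |Real.log y|) := by gcongr
          _ = _ := by ring

end

/-! ### The Green function equation -/

/-- The integral equation with the free Green kernel at the same energy. -/
theorem IsVolterraSolution.green_equation {q : ℝ → ℝ} (hq : AdmissiblePotential q) {z : ℂ}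
    {u : ℝ → ℂ} (hu : IsVolterraSolution q z u) {x : ℝ} (hx : 0 < x) :
    IntervalIntegrable (fun y : ℝ => (y : ℂ) * (kernel z x y * u y) * (q y : ℂ)) volume 0 x ∧
    u x = alpha z x + ∫ y in (0 : ℝ)..x, (y : ℂ) * (kernel z x y * u y) * (q y : ℂ) := by
  obtain ⟨huc, hue⟩ := hu
  set p : ℝ → ℂ := fun y => (q y : ℂ) - z with hp_def
  have hp : ∀ b, 0 < b → VolterraAdmissible p b := hq.volterraAdmissible z
  set v := flux p u with hv_def
  have hu' : ∀ x, 0 < x → HasDerivAt u (v x / x) x := by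
    intro x hx
    refine ((hasDerivAt_volterra hp huc hx).const_add 1).congr_of_eventuallyEq ?_
    filter_upwards [lt_mem_nhds hx] with y hy
    exact hue y hy.le
  have hucx : ContinuousOn u (Icc 0 x) := huc.mono Icc_subset_Ici_self
  obtain ⟨D, hD0, hD⟩ := exists_kernel_log_bound z hx
  replace hD : ∀ y ∈ Ioc 0 x, ‖kernel z x y‖ ≤ D * (1 + |Real.log y|) := fun y hy =>
    (hD z (by simp) y hy).1
  obtain ⟨B, hB⟩ := isCompact_Icc.exists_bound_of_continuousOn hucx
  have hint : IntervalIntegrable (fun y : ℝ => (y : ℂ) * (kernel z x y * u y) * (q y : ℂ))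
      volume 0 x := by
    refine (hq.logIntegrable hx.le).weight hx.le (D := D * B)
      (((continuousOn_kernel z x).mono fun y hy => hy.1).mul
        (hucx.mono Ioc_subset_Icc_self)) fun y hy => ?_
    rw [norm_mul]
    calc _ ≤ (D * (1 + |Real.log y|)) * B :=
          mul_le_mul (hD y hy) (hB y (Ioc_subset_Icc_self hy)) (norm_nonneg _) (by positivity)
      _ = _ := by ring
  refine ⟨hint, ?_⟩
  set κ : ℝ → ℂ := kernel z x
  set κ1 : ℝ → ℂ := fun y => alpha z x * beta1 z y - alpha1 z y * beta z x with hκ1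
  -- Lagrange bracket of u and κ. The energy terms cancel, leaving w' = −y κ u q almost everywhere.
  -- At y = x the Wronskian gives w = −u(x), and as y → 0 only u κ1 survives, with limit −α(x).
  set w : ℝ → ℂ := fun y => u y * κ1 y - v y * κ y with hw
  have hκ' : ∀ y, 0 < y → HasDerivAt κ (κ1 y / y) y := fun y hy =>
    (((hasDerivAt_beta z hy.ne').const_mul _).sub
      ((hasDerivAt_alpha z hy.ne').mul_const _)).congr_deriv (by simp only [hκ1]; ring)
  have hκ1' : ∀ y, 0 < y → HasDerivAt κ1 (-z * y * κ y) y := fun y hy =>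
    (((hasDerivAt_beta1 z hy.ne').const_mul _).sub
      ((hasDerivAt_alpha1 z hy.ne').mul_const _)).congr_deriv (by simp only [κ, kernel]; ring)
  have hftc : ∀ a ∈ Ioc 0 x, ∫ y in a..x, -((y : ℂ) * (κ y * u y) * (q y : ℂ)) = w x - w a := by
    intro a ha
    have hpos : ∀ y ∈ uIcc a x, 0 < y := fun y hy => by
      rw [uIcc_of_le ha.2] at hy; exact ha.1.trans_le hy.1
    have hne : ∀ y ∈ uIcc a x, (y : ℂ) ≠ 0 := fun y hy => by exact_mod_cast (hpos y hy).ne'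
    have hsub : uIcc a x ⊆ uIcc 0 x := by
      rw [uIcc_of_le ha.2, uIcc_of_le hx.le]; exact Icc_subset_Icc_left ha.1.le
    have hvac : AbsolutelyContinuousOnInterval v a x :=
      ((hp x hx).absolutelyContinuous_flux hx.le hucx).mono hsub
    have huac : AbsolutelyContinuousOnInterval u a x :=
      absolutelyContinuousOnInterval_of_hasDerivAt (fun y hy => hu' y (hpos y hy))
        (hvac.continuousOn.div (by fun_prop) hne)
    have hκ1c : ContinuousOn κ1 (uIcc a x) := fun y hy =>
      (hκ1' y (hpos y hy)).continuousAt.continuousWithinAt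
    have hκc : ContinuousOn κ (uIcc a x) := fun y hy =>
      (hκ' y (hpos y hy)).continuousAt.continuousWithinAt
    have hκac : AbsolutelyContinuousOnInterval κ a x :=
      absolutelyContinuousOnInterval_of_hasDerivAt (fun y hy => hκ' y (hpos y hy))
        (hκ1c.div (by fun_prop) hne)
    have hκ1ac : AbsolutelyContinuousOnInterval κ1 a x :=
      absolutelyContinuousOnInterval_of_hasDerivAt (fun y hy => hκ1' y (hpos y hy))
        (ContinuousOn.mul (by fun_prop) hκc)
    refine integral_eq_sub_of_absolutelyContinuous
      ((absolutelyContinuousOnInterval_mul huac hκ1ac).sub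
        (absolutelyContinuousOnInterval_mul hvac hκac)) (hint.mono_set hsub).neg ?_
    filter_upwards [ae_hasDerivAt_flux hp huc] with y hy hyx
    have hy0 := hpos y hyx
    refine (((hu' y hy0).mul (hκ1' y hy0)).sub ((hy hy0).mul (hκ' y hy0))).congr_deriv ?_
    have := hne y hyx
    simp only [hp_def]
    field_simp
    ring
  have hwx : w x = -u x := by
    have h1 := alpha_wronskian z x
    simp only [hw, hκ1, κ, kernel]
    linear_combination (-u x) * h1
  have hw0 : Tendsto w (𝓝[>] 0) (𝓝 (-alpha z x)) := by
    have hu0 : Tendsto u (𝓝[>] 0) (𝓝 1) := by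
      have h1 := huc 0 (mem_Ici.2 le_rfl)
      have h2 : u 0 = 1 := by rw [hue 0 le_rfl]; simp [volterra]
      rw [ContinuousWithinAt, h2] at h1
      exact h1.mono_left (nhdsWithin_mono _ Ioi_subset_Ici_self)
    have hκ10 : Tendsto κ1 (𝓝[>] 0) (𝓝 (-alpha z x)) := by
      have h1 : Continuous κ1 := (continuous_const.mul (continuous_beta1 z)).sub
        ((continuous_alpha1 z).mul continuous_const)
      have h2 := h1.tendsto 0
      have h3 : κ1 0 = -alpha z x := by
        simp only [hκ1, alpha1_zero, beta1_zero]; ring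
      rw [h3] at h2
      exact h2.mono_left nhdsWithin_le_nhds
    have hvκ : Tendsto (fun y => v y * κ y) (𝓝[>] 0) (𝓝 0) := by
      have h1 := (tendsto_flux_mul_log ((hq.logIntegrable zero_le_one).sub_const zero_le_one z)
        (huc.mono Icc_subset_Ici_self)).const_mul D
      rw [mul_zero] at h1
      refine squeeze_zero_norm' ?_ h1
      filter_upwards [Ioc_mem_nhdsGT hx] with y hy
      rw [norm_mul]
      calc _ ≤ ‖v y‖ * (D * (1 + |Real.log y|)) := by gcongr; exact hD y hy
        _ = _ := by ring
    have := (hu0.mul hκ10).sub hvκ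
    simpa using this
  have hlim : Tendsto (fun a => ∫ y in a..x, -((y : ℂ) * (κ y * u y) * (q y : ℂ))) (𝓝[>] 0)
      (𝓝 (∫ y in (0 : ℝ)..x, -((y : ℂ) * (κ y * u y) * (q y : ℂ)))) := by
    have h1 := (absolutelyContinuousOnInterval_integral hint.neg.symm left_mem_uIcc).continuousOn
    rw [uIcc_comm, uIcc_of_le hx.le] at h1
    have h2 := (h1 0 (left_mem_Icc.2 hx.le)).mono_left (nhdsWithin_le_of_mem (mem_of_superset
      (Ioc_mem_nhdsGT hx) Ioc_subset_Icc_self))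
    have h3 := h2.neg
    simp only [← intervalIntegral.integral_symm] at h3
    exact h3
  have hlim2 : Tendsto (fun a => ∫ y in a..x, -((y : ℂ) * (κ y * u y) * (q y : ℂ))) (𝓝[>] 0)
      (𝓝 (w x - -alpha z x)) := by
    refine (tendsto_const_nhds.sub hw0).congr' ?_
    filter_upwards [Ioc_mem_nhdsGT hx] with a ha
    exact (hftc a ha).symm
  have h := tendsto_nhds_unique hlim hlim2
  rw [intervalIntegral.integral_neg, hwx] at h
  linear_combination h

/-! ### Differentiation in the energy -/

section
variable {q : ℝ → ℝ} {U : ℂ → ℝ → ℂ}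

/-- Uniqueness identifies u(z,·) with the C([0,b])-valued entire solution, and evaluation at y is a
continuous linear functional. -/
theorem hasDerivAt_volterra_family (hq : AdmissiblePotential q)
    (hU : ∀ z, IsVolterraSolution q z (U z)) {b : ℝ} (hb : 0 < b) (z : ℂ) {y : ℝ}
    (hy : y ∈ Icc 0 b) :
    HasDerivAt (fun z => U z y) (deriv (volterraSol hb.le
      ((hq.logIntegrable hb.le).volterraAdmissible hb)) z ⟨y, hy⟩) z := by
  have h1 := (differentiable_volterraSol hb.le
    ((hq.logIntegrable hb.le).volterraAdmissible hb) z).hasDerivAt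
  have h2 := (BoundedContinuousFunction.evalCLM ℂ (⟨y, hy⟩ : Icc (0 : ℝ) b)
    (β := ℂ)).hasFDerivAt.comp_hasDerivAt z h1
  refine HasDerivAt.congr_of_eventuallyEq h2 (Eventually.of_forall fun z => ?_)
  exact volterraSol_satisfies hq z hb (hU z) hy

theorem continuousOn_deriv_family (hq : AdmissiblePotential q)
    (hU : ∀ z, IsVolterraSolution q z (U z)) {b : ℝ} (hb : 0 < b) (z : ℂ) :
    ContinuousOn (fun y => deriv (fun z => U z y) z) (Icc 0 b) :=
  (continuousOn_IccExtend hb.le (deriv (volterraSol hb.le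
    ((hq.logIntegrable hb.le).volterraAdmissible hb)) z) _).congr fun y hy => by
      rw [IccExtend_of_mem hb.le _ hy, (hasDerivAt_volterra_family hq hU hb z hy).deriv]

/-- Sup norms of an entire C([0,b])-valued map and of its derivative are bounded on a compact ball.
This is what dominates the integrand when differentiating under the integral. -/
theorem exists_family_bound (hq : AdmissiblePotential q)
    (hU : ∀ z, IsVolterraSolution q z (U z)) {b : ℝ} (hb : 0 < b) (z₀ : ℂ) :
    ∃ D : ℝ, 0 ≤ D ∧ ∀ z ∈ Metric.closedBall z₀ 1, ∀ y ∈ Icc 0 b,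
      ‖U z y‖ ≤ D ∧ ‖deriv (fun z => U z y) z‖ ≤ D := by
  have hd := differentiable_volterraSol hb.le ((hq.logIntegrable hb.le).volterraAdmissible hb)
  obtain ⟨c1, h1⟩ := (isCompact_closedBall z₀ 1).exists_bound_of_continuousOn
    hd.continuous.continuousOn
  obtain ⟨c2, h2⟩ := (isCompact_closedBall z₀ 1).exists_bound_of_continuousOn
    ((hd.contDiff (n := 1)).continuous_deriv le_rfl).continuousOn
  refine ⟨|c1| + |c2|, by positivity, fun z hz y hy => ⟨?_, ?_⟩⟩
  · rw [volterraSol_satisfies hq z hb (hU z) hy]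
    refine ((BoundedContinuousFunction.norm_coe_le_norm _ _).trans (h1 z hz)).trans ?_
    linarith [le_abs_self c1, abs_nonneg c2]
  · rw [(hasDerivAt_volterra_family hq hU hb z hy).deriv]
    refine ((BoundedContinuousFunction.norm_coe_le_norm _ _).trans (h2 z hz)).trans ?_
    linarith [le_abs_self c2, abs_nonneg c1]

/-- Differentiating the Green function equation with respect to the energy. -/
theorem deriv_green_equation (hq : AdmissiblePotential q)
    (hU : ∀ z, IsVolterraSolution q z (U z)) {x : ℝ} (hx : 0 < x) (z : ℂ) :
    IntervalIntegrable (fun y : ℝ => (y : ℂ) * (kernelZ z x y * U z y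
      + kernel z x y * deriv (fun z => U z y) z) * (q y : ℂ)) volume 0 x ∧
    deriv (fun z => U z x) z = alphaZ z x + ∫ y in (0 : ℝ)..x, (y : ℂ) * (kernelZ z x y * U z y
      + kernel z x y * deriv (fun z => U z y) z) * (q y : ℂ) := by
  obtain ⟨D, hD0, hD⟩ := exists_kernel_log_bound z hx
  obtain ⟨B, hB0, hB⟩ := exists_family_bound hq hU hx z
  have hsub : Ioc 0 x ⊆ Ioi (0 : ℝ) := fun y hy => hy.1
  have hlog := hq.logIntegrable hx.le
  have hbound : ∀ w ∈ Metric.closedBall z 1, ∀ y ∈ Ioc 0 x, ‖kernelZ w x y * U w y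
      + kernel w x y * deriv (fun z => U z y) w‖ ≤ 2 * D * B * (1 + |Real.log y|) := by
    intro w hw y hy
    obtain ⟨h1, h2⟩ := hD w hw y hy
    obtain ⟨h3, h4⟩ := hB w hw y (Ioc_subset_Icc_self hy)
    refine (norm_add_le _ _).trans ?_
    rw [norm_mul, norm_mul]
    have h5 := mul_le_mul h2 h3 (norm_nonneg _) (by positivity)
    have h6 := mul_le_mul h1 h4 (norm_nonneg _) (by positivity)
    linarith
  have hgi : IntervalIntegrable (fun y : ℝ => (y : ℂ) * (kernelZ z x y * U z y
      + kernel z x y * deriv (fun z => U z y) z) * (q y : ℂ)) volume 0 x := by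
    refine hlog.weight hx.le (((continuousOn_kernelZ z x).mono hsub).mul
      ((hU z).1.mono (hsub.trans Ioi_subset_Ici_self)) |>.add
      (((continuousOn_kernel z x).mono hsub).mul
        ((continuousOn_deriv_family hq hU hx z).mono Ioc_subset_Icc_self)))
      (hbound z (by simp))
  have hmaj : IntervalIntegrable (fun y : ℝ => 2 * D * B *
      ‖((y * (1 + |Real.log y|) : ℝ) : ℂ) * (q y : ℂ)‖) volume 0 x := hlog.norm.const_mul _
  have key := intervalIntegral.hasDerivAt_integral_of_dominated_loc_of_deriv_le
    (μ := volume) (a := 0) (b := x) (x₀ := z)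
    (F := fun w (y : ℝ) => (y : ℂ) * (kernel w x y * U w y) * (q y : ℂ))
    (F' := fun w (y : ℝ) => (y : ℂ) * (kernelZ w x y * U w y
      + kernel w x y * deriv (fun z => U z y) w) * (q y : ℂ))
    (Metric.closedBall_mem_nhds z one_pos)
    (Eventually.of_forall fun w => by
      rw [uIoc_of_le hx.le]
      exact ((hU w).green_equation hq hx).1.1.aestronglyMeasurable)
    ((hU z).green_equation hq hx).1
    (by rw [uIoc_of_le hx.le]; exact hgi.1.aestronglyMeasurable)
    (Eventually.of_forall fun y hy w hw => by
      rw [uIoc_of_le hx.le] at hy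
      have := hy.1.le
      have h2 : ‖((y * (1 + |Real.log y|) : ℝ) : ℂ)‖ = y * (1 + |Real.log y|) := by
        rw [Complex.norm_real, Real.norm_of_nonneg (by positivity)]
      rw [norm_mul, norm_mul, norm_mul, h2, Complex.norm_real y, Real.norm_of_nonneg hy.1.le]
      calc _ ≤ y * (2 * D * B * (1 + |Real.log y|)) * ‖(q y : ℂ)‖ := by
            gcongr; exact hbound w hw y hy
        _ = _ := by ring)
    hmaj
    (Eventually.of_forall fun y hy w hw => by
      rw [uIoc_of_le hx.le] at hy
      have h1 := (hasDerivAt_kernelZ w x y).mul (hasDerivAt_volterra_family hq hU hx w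
        (Ioc_subset_Icc_self hy)).differentiableAt.hasDerivAt
      exact (h1.const_mul (y : ℂ)).mul_const (q y : ℂ))
  refine ⟨hgi, ?_⟩
  have h1 : (fun z => U z x) = fun z => alpha z x
      + ∫ y in (0 : ℝ)..x, (y : ℂ) * (kernel z x y * U z y) * (q y : ℂ) :=
    funext fun w => ((hU w).green_equation hq hx).2
  have h2 := ((hasDerivAt_alphaZ z x).add key.2).deriv
  rw [← h2]
  conv_lhs => rw [h1]
  rfl

end

/-! ### Weighted Grönwall inequality and the bound on the solution -/

theorem AdmissiblePotential.integrable_weight {q : ℝ → ℝ} (hq : AdmissiblePotential q) {x : ℝ}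
    (hx : 0 < x) {g : ℝ → ℝ} (hg : ContinuousOn g (Ioc 0 x)) {D : ℝ}
    (h0 : ∀ y ∈ Ioc 0 x, 0 ≤ g y) (hD : ∀ y ∈ Ioc 0 x, g y ≤ D * (1 + |Real.log y|)) :
    IntervalIntegrable (fun y => y * g y * |q y|) volume 0 x := by
  have h := (hq.logIntegrable hx.le).weight hx.le (h := fun y => (g y : ℂ))
    (Complex.continuous_ofReal.comp_continuousOn hg) (D := D) fun y hy => by
      rw [Complex.norm_real, Real.norm_of_nonneg (h0 y hy)]; exact hD y hy
  refine h.norm.congr fun y hy => ?_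
  rw [uIoc_of_le hx.le] at hy
  simp only [norm_mul, Complex.norm_real, Real.norm_of_nonneg (h0 y hy),
    Real.norm_of_nonneg hy.1.le, Real.norm_eq_abs]

theorem continuousOn_wt {k : ℂ} : ContinuousOn (fun y => wt (‖k‖ * y)) (Ici 0) := by
  refine ContinuousOn.inv₀ (by fun_prop) fun y hy => ?_
  have : 0 ≤ ‖k‖ * y := mul_nonneg (norm_nonneg _) hy
  exact (Real.sqrt_pos.2 (by linarith)).ne'

theorem wt_le_one {t : ℝ} (ht : 0 ≤ t) : wt t ≤ 1 := by
  rw [wt]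
  exact inv_le_one_of_one_le₀ (Real.one_le_sqrt.2 (by linarith))

theorem log_weight_nonneg {x y : ℝ} (hy : y ∈ Ioc 0 x) : 0 ≤ 1 + Real.log (x / y) := by
  have := Real.log_nonneg ((one_le_div hy.1).2 hy.2)
  linarith

theorem log_weight_le {x y : ℝ} (hy : y ∈ Ioc 0 x) :
    1 + Real.log (x / y) ≤ (1 + |Real.log x|) * (1 + |Real.log y|) := by
  rw [Real.log_div (hy.1.trans_le hy.2).ne' hy.1.ne']
  nlinarith [le_abs_self (Real.log x), neg_abs_le (Real.log y), abs_nonneg (Real.log x),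
    abs_nonneg (Real.log y)]

theorem continuousOn_log_weight {x : ℝ} (hx : 0 < x) :
    ContinuousOn (fun y => 1 + Real.log (x / y)) (Ioc 0 x) :=
  continuousOn_const.add (ContinuousOn.log (continuousOn_const.div continuousOn_id
    fun _ hy => hy.1.ne') fun _ hy => (div_pos hx hy.1).ne')

/-- The integral controlling the size of the regular solution on `(0, b]`. -/
def logMass (q : ℝ → ℝ) (b : ℝ) : ℝ := ∫ y in (0 : ℝ)..b, y * (1 + Real.log (b / y)) * |q y|

section
variable {q : ℝ → ℝ}

theorem AdmissiblePotential.integrable_logMass (hq : AdmissiblePotential q) {b : ℝ} (hb : 0 < b) :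
    IntervalIntegrable (fun y => y * (1 + Real.log (b / y)) * |q y|) volume 0 b :=
  hq.integrable_weight hb (continuousOn_log_weight hb) (fun _ hy => log_weight_nonneg hy)
    fun _ hy => log_weight_le hy

theorem integrand_logMass_nonneg {b y : ℝ} (hy : y ∈ Ioc 0 b) :
    0 ≤ y * (1 + Real.log (b / y)) * |q y| :=
  mul_nonneg (mul_nonneg hy.1.le (log_weight_nonneg hy)) (abs_nonneg _)

theorem integrand_logMass_mono {x b y : ℝ} (hy : y ∈ Ioc 0 x) (hxb : x ≤ b) :
    y * (1 + Real.log (x / y)) * |q y| ≤ y * (1 + Real.log (b / y)) * |q y| := by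
  have h0 := hy.1
  have h1 : Real.log (x / y) ≤ Real.log (b / y) :=
    Real.log_le_log (div_pos (hy.1.trans_le hy.2) hy.1) (by gcongr)
  gcongr

theorem logMass_nonneg {b : ℝ} (hb : 0 ≤ b) : 0 ≤ logMass q b := by
  rw [logMass, intervalIntegral.integral_of_le hb]
  exact setIntegral_nonneg measurableSet_Ioc fun y hy => integrand_logMass_nonneg hy

theorem logMass_mono (hq : AdmissiblePotential q) {x b : ℝ} (hx : 0 < x) (hxb : x ≤ b) :
    logMass q x ≤ logMass q b := by
  have hb := hx.trans_le hxb
  refine le_trans ?_ (primitive_mono (hq.integrable_logMass hb)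
    (fun y hy => integrand_logMass_nonneg hy) ⟨hx.le, hxb⟩ (right_mem_Icc.2 hb.le) hxb)
  exact intervalIntegral.integral_mono_on_of_le_Ioo hx.le (hq.integrable_logMass hx)
    (intervalIntegrable_of_Icc (hq.integrable_logMass hb) ⟨hx.le, hxb⟩)
    fun y hy => integrand_logMass_mono ⟨hy.1, hy.2.le⟩ hxb

/-- Grönwall's inequality for kernels bounded like the free Green kernel. -/
theorem weighted_gronwall (hq : AdmissiblePotential q) {k : ℂ} {b C c : ℝ} (hb : 0 < b)
    (hC : 0 ≤ C) (hc : 0 ≤ c) {f : ℝ → ℂ} (hf : ContinuousOn f (Icc 0 b))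
    (h : ∀ x ∈ Ioc 0 b, ‖f x‖ ≤ c * (wt (‖k‖ * x) * Real.exp (|k.im| * x))
      + ∫ y in (0 : ℝ)..x, y * (C * (wt (‖k‖ * x) * wt (‖k‖ * y)) * (1 + Real.log (x / y))
        * Real.exp (|k.im| * (x - y)) * ‖f y‖) * |q y|) :
    ∀ x ∈ Ioc 0 b, ‖f x‖
      ≤ c * Real.exp (C * logMass q b) * (wt (‖k‖ * x) * Real.exp (|k.im| * x)) := by
  -- After division by r the exponentials combine exactly, wt² ≤ 1 is dropped, and log(x/y) ≤
  -- log(b/y) makes the coefficient independent of x, so the scalar Grönwall inequality applies.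
  set r : ℝ → ℝ := fun x => wt (‖k‖ * x) * Real.exp (|k.im| * x) with hr
  have hk := norm_nonneg k
  have hwt : ∀ y, 0 ≤ y → 0 < wt (‖k‖ * y) := fun y hy => wt_pos (by positivity)
  have hr0 : ∀ y, 0 ≤ y → 0 < r y := fun y hy => mul_pos (hwt y hy) (Real.exp_pos _)
  have hrc : ContinuousOn r (Icc 0 b) :=
    (continuousOn_wt.mono Icc_subset_Ici_self).mul (by fun_prop)
  have hEc : ContinuousOn (fun y => ‖f y‖ / r y) (Icc 0 b) :=
    hf.norm.div hrc fun y hy => (hr0 y hy.1).ne'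
  obtain ⟨H, hH⟩ := isCompact_Icc.exists_bound_of_continuousOn hEc
  have hm := (hq.integrable_logMass hb).const_mul C
  have hmE := hm.mul_continuousOn (g := fun y => ‖f y‖ / r y) (by rwa [uIcc_of_le hb.le])
  have key := gronwall_integral (E := fun y => ‖f y‖ / r y) (H := H) hm
    (fun y hy => mul_nonneg hC (integrand_logMass_nonneg hy)) hc
    (fun x hx => (le_abs_self _).trans (hH x (Ioc_subset_Icc_self hx))) hmE (fun x hx => ?_)
  · intro x hx
    have h1 := key x hx
    rw [intervalIntegral.integral_const_mul, div_le_iff₀ (hr0 x hx.1.le)] at h1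
    exact h1
  · rw [div_le_iff₀ (hr0 x hx.1.le), add_mul]
    refine (h x hx).trans (add_le_add le_rfl ?_)
    rw [← intervalIntegral.integral_mul_const]
    have hxI := Ioc_subset_Icc_self hx
    have hint2 := (intervalIntegrable_of_Icc hmE hxI).mul_const (r x)
    have hle : ∀ y ∈ Ioc 0 x, y * (C * (wt (‖k‖ * x) * wt (‖k‖ * y)) * (1 + Real.log (x / y))
        * Real.exp (|k.im| * (x - y)) * ‖f y‖) * |q y|
        ≤ C * (y * (1 + Real.log (b / y)) * |q y|) * (‖f y‖ / r y) * r x := by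
      intro y hy
      have hy0 := hy.1.le
      have h1 : Real.exp (|k.im| * (x - y)) * Real.exp (|k.im| * y) = Real.exp (|k.im| * x) := by
        rw [← Real.exp_add]; congr 1; ring
      have h2 : ‖f y‖ = (‖f y‖ / r y) * r y := by rw [div_mul_cancel₀ _ (hr0 y hy0).ne']
      set E := ‖f y‖ / r y
      have hE0 : 0 ≤ E := div_nonneg (norm_nonneg _) (hr0 y hy0).le
      have h3 : wt (‖k‖ * y) ^ 2 ≤ 1 := pow_le_one₀ (hwt y hy0).le (wt_le_one (by positivity))
      have h4 := integrand_logMass_mono (q := q) hy hx.2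
      have h5 := integrand_logMass_nonneg (q := q) hy
      have hw := (hwt x hx.1.le).le
      calc _ = C * (y * (1 + Real.log (x / y)) * |q y|) * E * (wt (‖k‖ * x)
            * (Real.exp (|k.im| * (x - y)) * Real.exp (|k.im| * y))) * wt (‖k‖ * y) ^ 2 := by
            rw [h2]; simp only [hr]; ring
        _ = C * (y * (1 + Real.log (x / y)) * |q y|) * E * r x * wt (‖k‖ * y) ^ 2 := by rw [h1]
        _ ≤ C * (y * (1 + Real.log (x / y)) * |q y|) * E * r x * 1 := by
            have := (hr0 x hx.1.le).le
            gcongr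
        _ = C * (y * (1 + Real.log (x / y)) * |q y|) * E * r x := mul_one _
        _ ≤ _ := by
            have := (hr0 x hx.1.le).le
            gcongr
    -- A non-integrable integrand has integral 0 by convention, and then nonnegativity of the
    -- majorant is enough.
    by_cases hi : IntervalIntegrable (fun y => y * (C * (wt (‖k‖ * x) * wt (‖k‖ * y))
        * (1 + Real.log (x / y)) * Real.exp (|k.im| * (x - y)) * ‖f y‖) * |q y|) volume 0 x
    · exact intervalIntegral.integral_mono_on_of_le_Ioo hx.1.le hi hint2
        fun y hy => hle y ⟨hy.1, hy.2.le⟩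
    · rw [intervalIntegral.integral_undef hi, intervalIntegral.integral_of_le hx.1.le]
      refine setIntegral_nonneg measurableSet_Ioc fun y hy => ?_
      have h5 := integrand_logMass_nonneg (q := q) (b := b) ⟨hy.1, hy.2.trans hx.2⟩
      exact mul_nonneg (mul_nonneg (mul_nonneg hC h5)
        (div_nonneg (norm_nonneg _) (hr0 y hy.1.le).le)) (hr0 x hx.1.le).le

theorem norm_integral_le_weighted {F : ℝ → ℂ} {G : ℝ → ℝ} {x : ℝ} (hx : 0 < x)
    (hG : IntervalIntegrable (fun y => y * G y * |q y|) volume 0 x)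
    (hFG : ∀ y ∈ Ioc 0 x, ‖F y‖ ≤ G y) :
    ‖∫ y in (0 : ℝ)..x, (y : ℂ) * F y * (q y : ℂ)‖ ≤ ∫ y in (0 : ℝ)..x, y * G y * |q y| := by
  refine intervalIntegral.norm_integral_le_of_norm_le hx.le (Eventually.of_forall fun y hy => ?_) hG
  rw [norm_mul, norm_mul, Complex.norm_real, Complex.norm_real, Real.norm_of_nonneg hy.1.le,
    Real.norm_eq_abs]
  have := hy.1.le
  gcongr
  exact hFG y hy

/-- The function K t²/(1 + K t) is increasing. It allows the factor |k| y² wt² coming from the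
derivative to be replaced by its value at x and taken out of integrals over y ≤ x. -/
theorem mul_sq_wt_sq_mono {K : ℝ} (hK : 0 ≤ K) {x y : ℝ} (hy : 0 ≤ y) (hyx : y ≤ x) :
    K * y ^ 2 * wt (K * y) ^ 2 ≤ K * x ^ 2 * wt (K * x) ^ 2 := by
  have hx : 0 ≤ x := hy.trans hyx
  rw [wt_sq (by positivity), wt_sq (by positivity), ← div_eq_mul_inv, ← div_eq_mul_inv,
    div_le_div_iff₀ (by positivity) (by positivity)]
  have h1 : y ^ 2 ≤ x ^ 2 := pow_le_pow_left₀ hy hyx 2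
  have h2 : y ^ 2 * x ≤ x ^ 2 * y := by nlinarith [mul_nonneg hy hx]
  nlinarith [mul_le_mul_of_nonneg_left h1 hK, mul_le_mul_of_nonneg_left h2 (mul_nonneg hK hK)]

/-- Continuous weights times the logarithmic weight are integrable against `y |q y|`. -/
theorem AdmissiblePotential.integrable_log_weight_mul (hq : AdmissiblePotential q) {x : ℝ}
    (hx : 0 < x) {g : ℝ → ℝ} (hg : ContinuousOn g (Icc 0 x)) (h0 : ∀ y ∈ Icc 0 x, 0 ≤ g y) :
    IntervalIntegrable (fun y => y * (g y * (1 + Real.log (x / y))) * |q y|) volume 0 x := by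
  obtain ⟨B, hB⟩ := isCompact_Icc.exists_bound_of_continuousOn hg
  refine hq.integrable_weight hx ((hg.mono Ioc_subset_Icc_self).mul (continuousOn_log_weight hx))
    (D := B * (1 + |Real.log x|)) (fun y hy => mul_nonneg (h0 y (Ioc_subset_Icc_self hy))
      (log_weight_nonneg hy)) fun y hy => ?_
  have h1 := (le_abs_self _).trans (hB y (Ioc_subset_Icc_self hy))
  have h2 := log_weight_le hy
  have h3 := log_weight_nonneg hy
  have h4 := h0 y (Ioc_subset_Icc_self hy)
  calc _ ≤ B * ((1 + |Real.log x|) * (1 + |Real.log y|)) :=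
        mul_le_mul h1 h2 h3 (h4.trans h1)
    _ = _ := by ring

/-- A priori bound for the regular solution. -/
theorem exists_solution_bound (hq : AdmissiblePotential q) {U : ℂ → ℝ → ℂ}
    (hU : ∀ z, IsVolterraSolution q z (U z)) {b : ℝ} (hb : 0 < b) :
    ∃ C : ℝ, 0 ≤ C ∧ ∀ (k : ℂ), ∀ x ∈ Ioc 0 b,
      ‖U (k ^ 2) x‖ ≤ C * (wt (‖k‖ * x) * Real.exp (|k.im| * x)) := by
  obtain ⟨Ca, hCa, ha⟩ := alpha_bound
  obtain ⟨Ck, hCk, hk⟩ := kernel_bound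
  refine ⟨Ca * Real.exp (Ck * logMass q b), by positivity, fun k => ?_⟩
  refine weighted_gronwall hq hb hCk hCa ((hU (k ^ 2)).1.mono Icc_subset_Ici_self) fun x hx => ?_
  rw [((hU (k ^ 2)).green_equation hq hx.1).2]
  refine (norm_add_le _ _).trans (add_le_add ?_ ?_)
  · rw [← mul_assoc]; exact (ha k x hx.1).1
  · refine norm_integral_le_weighted hx.1 ?_ fun y hy => ?_
    · have h1 := hq.integrable_log_weight_mul hx.1 (g := fun y => Ck * (wt (‖k‖ * x)
        * wt (‖k‖ * y)) * Real.exp (|k.im| * (x - y)) * ‖U (k ^ 2) y‖) ?_ fun y hy => ?_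
      · refine h1.congr fun y _ => ?_
        ring
      · exact ((continuousOn_const.mul (continuousOn_const.mul
          (continuousOn_wt.mono Icc_subset_Ici_self))).mul (by fun_prop)).mul
          ((hU (k ^ 2)).1.mono Icc_subset_Ici_self).norm
      · have h1 : 0 ≤ wt (‖k‖ * x) := (wt_pos (mul_nonneg (norm_nonneg _) hx.1.le)).le
        have h2 : 0 ≤ wt (‖k‖ * y) := (wt_pos (mul_nonneg (norm_nonneg _) hy.1)).le
        positivity
    · rw [norm_mul]
      gcongr
      exact (hk k x y hy.1 hy.2).1

end

/-! ### Estimates for the momentum derivative -/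

section
variable {q : ℝ → ℝ} {U : ℂ → ℝ → ℂ}

/-- The integral appearing in the estimate of the momentum derivative. -/
def weightedMass (q : ℝ → ℝ) (k : ℂ) (x : ℝ) : ℝ :=
  ∫ y in (0 : ℝ)..x, y * (wt (‖k‖ * y) ^ 2 * (1 + Real.log (x / y))) * |q y|

theorem AdmissiblePotential.integrable_weightedMass (hq : AdmissiblePotential q) (k : ℂ) {x : ℝ}
    (hx : 0 < x) : IntervalIntegrable
      (fun y => y * (wt (‖k‖ * y) ^ 2 * (1 + Real.log (x / y))) * |q y|) volume 0 x :=
  hq.integrable_log_weight_mul hx ((continuousOn_wt.mono Icc_subset_Ici_self).pow 2)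
    fun _ _ => sq_nonneg _

theorem weightedMass_le_logMass (hq : AdmissiblePotential q) (k : ℂ) {x : ℝ} (hx : 0 < x) :
    weightedMass q k x ≤ logMass q x := by
  refine intervalIntegral.integral_mono_on_of_le_Ioo hx.le (hq.integrable_weightedMass k hx)
    (hq.integrable_logMass hx) fun y hy => ?_
  have h0 := hy.1.le
  have h1 : 0 ≤ ‖k‖ * y := mul_nonneg (norm_nonneg _) h0
  have h2 : wt (‖k‖ * y) ^ 2 ≤ 1 := pow_le_one₀ (wt_pos h1).le (wt_le_one h1)
  have h3 := log_weight_nonneg ⟨hy.1, hy.2.le⟩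
  calc _ ≤ y * (1 * (1 + Real.log (x / y))) * |q y| := by gcongr
    _ = _ := by rw [one_mul]

/-- In the term with the differentiated kernel, the weight at y from the kernel and the one from u
multiply to wt² = 1/(1 + |k|y), and the exponentials combine to e^(|Im k| x). This already has the
claimed form; the term with the unknown derivative is kept for Grönwall. -/
theorem deriv_norm_sub_le (hq : AdmissiblePotential q) (hU : ∀ z, IsVolterraSolution q z (U z))
    {C₁ Ck : ℝ} (hCk : 0 ≤ Ck) {k : ℂ} {x : ℝ} (hx : 0 < x)
    (hU1 : ∀ y ∈ Ioc 0 x, ‖U (k ^ 2) y‖ ≤ C₁ * (wt (‖k‖ * y) * Real.exp (|k.im| * y)))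
    (hK : ∀ y ∈ Ioc 0 x, ‖kernel (k ^ 2) x y‖ ≤ Ck * (wt (‖k‖ * x) * wt (‖k‖ * y))
        * (1 + Real.log (x / y)) * Real.exp (|k.im| * (x - y)) ∧
      ‖2 * k * kernelZ (k ^ 2) x y‖ ≤ Ck * (‖k‖ * x ^ 2 * wt (‖k‖ * x) ^ 3 * wt (‖k‖ * y))
        * (1 + Real.log (x / y)) * Real.exp (|k.im| * (x - y))) :
    ‖2 * k * deriv (fun z => U z x) (k ^ 2) - 2 * k * alphaZ (k ^ 2) x‖
      ≤ Ck * C₁ * (‖k‖ * x ^ 2 * wt (‖k‖ * x) ^ 3) * Real.exp (|k.im| * x) * weightedMass q k x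
        + ∫ y in (0 : ℝ)..x, y * (Ck * (wt (‖k‖ * x) * wt (‖k‖ * y)) * (1 + Real.log (x / y))
          * Real.exp (|k.im| * (x - y)) * ‖2 * k * deriv (fun z => U z y) (k ^ 2)‖) * |q y| := by
  set A := Ck * C₁ * (‖k‖ * x ^ 2 * wt (‖k‖ * x) ^ 3) * Real.exp (|k.im| * x)
  have hwx : 0 ≤ wt (‖k‖ * x) := (wt_pos (mul_nonneg (norm_nonneg _) hx.le)).le
  have hwy : ∀ y ∈ Icc 0 x, 0 ≤ wt (‖k‖ * y) := fun y hy =>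
    (wt_pos (mul_nonneg (norm_nonneg _) hy.1)).le
  have hI1 := (hq.integrable_weightedMass k hx).const_mul A
  have hI2 : IntervalIntegrable (fun y => y * (Ck * (wt (‖k‖ * x) * wt (‖k‖ * y))
      * (1 + Real.log (x / y)) * Real.exp (|k.im| * (x - y))
      * ‖2 * k * deriv (fun z => U z y) (k ^ 2)‖) * |q y|) volume 0 x := by
    have h1 := hq.integrable_log_weight_mul hx (g := fun y => Ck * (wt (‖k‖ * x)
      * wt (‖k‖ * y)) * Real.exp (|k.im| * (x - y)) * ‖2 * k * deriv (fun z => U z y) (k ^ 2)‖)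
      ?_ fun y hy => ?_
    · refine h1.congr fun y _ => ?_
      ring
    · exact ((continuousOn_const.mul (continuousOn_const.mul
        (continuousOn_wt.mono Icc_subset_Ici_self))).mul (by fun_prop)).mul
        (continuousOn_const.mul (continuousOn_deriv_family hq hU hx (k ^ 2))).norm
    · have := hwy y hy
      positivity
  have heq : 2 * k * deriv (fun z => U z x) (k ^ 2) - 2 * k * alphaZ (k ^ 2) x
      = ∫ y in (0 : ℝ)..x, (y : ℂ) * (2 * k * kernelZ (k ^ 2) x y * U (k ^ 2) y
        + kernel (k ^ 2) x y * (2 * k * deriv (fun z => U z y) (k ^ 2))) * (q y : ℂ) := by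
    rw [(deriv_green_equation hq hU hx (k ^ 2)).2, mul_add, add_sub_cancel_left,
      ← intervalIntegral.integral_const_mul]
    exact intervalIntegral.integral_congr fun y _ => by ring
  have hsplit : A * weightedMass q k x + ∫ y in (0 : ℝ)..x, y * (Ck * (wt (‖k‖ * x)
        * wt (‖k‖ * y)) * (1 + Real.log (x / y))
        * Real.exp (|k.im| * (x - y)) * ‖2 * k * deriv (fun z => U z y) (k ^ 2)‖) * |q y|
      = ∫ y in (0 : ℝ)..x, y * (A * (wt (‖k‖ * y) ^ 2 * (1 + Real.log (x / y)))
        + Ck * (wt (‖k‖ * x) * wt (‖k‖ * y)) * (1 + Real.log (x / y))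
        * Real.exp (|k.im| * (x - y)) * ‖2 * k * deriv (fun z => U z y) (k ^ 2)‖) * |q y| := by
    rw [weightedMass, ← intervalIntegral.integral_const_mul, ← intervalIntegral.integral_add hI1 hI2]
    exact intervalIntegral.integral_congr fun y _ => by ring
  rw [heq, hsplit]
  refine norm_integral_le_weighted hx ?_ fun y hy => ?_
  · refine (hI1.add hI2).congr fun y _ => ?_
    ring
  · have hexp : Real.exp (|k.im| * (x - y)) * Real.exp (|k.im| * y) = Real.exp (|k.im| * x) := by
      rw [← Real.exp_add]; congr 1; ring
    have hwy' := hwy y (Ioc_subset_Icc_self hy)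
    have hlog := log_weight_nonneg hy
    obtain ⟨h1, h2⟩ := hK y hy
    refine (norm_add_le _ _).trans (add_le_add ?_ ?_)
    · rw [norm_mul]
      refine (mul_le_mul h2 (hU1 y hy) (norm_nonneg _) (by positivity)).trans_eq ?_
      simp only [A]
      rw [← hexp]
      ring
    · rw [norm_mul]
      gcongr

/-- A priori bound for the momentum derivative of the regular solution. -/
theorem deriv_norm_le (hq : AdmissiblePotential q) (hU : ∀ z, IsVolterraSolution q z (U z))
    {b Ca C₁ Ck : ℝ} (hb : 0 < b) (hCa : 0 ≤ Ca) (hC₁ : 0 ≤ C₁) (hCk : 0 ≤ Ck) {k : ℂ}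
    (ha : ∀ x, 0 < x → ‖2 * k * alphaZ (k ^ 2) x‖
      ≤ Ca * (‖k‖ * x ^ 2 * wt (‖k‖ * x) ^ 3) * Real.exp (|k.im| * x))
    (hU1 : ∀ y ∈ Ioc 0 b, ‖U (k ^ 2) y‖ ≤ C₁ * (wt (‖k‖ * y) * Real.exp (|k.im| * y)))
    (hK : ∀ x y, 0 < y → y ≤ x → ‖kernel (k ^ 2) x y‖ ≤ Ck * (wt (‖k‖ * x) * wt (‖k‖ * y))
        * (1 + Real.log (x / y)) * Real.exp (|k.im| * (x - y)) ∧
      ‖2 * k * kernelZ (k ^ 2) x y‖ ≤ Ck * (‖k‖ * x ^ 2 * wt (‖k‖ * x) ^ 3 * wt (‖k‖ * y))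
        * (1 + Real.log (x / y)) * Real.exp (|k.im| * (x - y))) :
    ∀ x ∈ Ioc 0 b, ‖2 * k * deriv (fun z => U z x) (k ^ 2)‖
      ≤ (Ca + Ck * C₁ * logMass q b) * Real.exp (Ck * logMass q b)
        * (‖k‖ * x ^ 2 * wt (‖k‖ * x) ^ 3) * Real.exp (|k.im| * x) := by
  intro x hx
  have hM : 0 ≤ logMass q b := logMass_nonneg hb.le
  have hMx := logMass_mono hq hx.1 hx.2
  have hk := norm_nonneg k
  -- Grönwall is run on (0,x] for each x separately, with the constant frozen at t = x. This is
  -- legitimate because |k| t² wt² increases with t.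
  have hg := weighted_gronwall hq (k := k) hx.1 hCk
    (c := (Ca + Ck * C₁ * logMass q b) * (‖k‖ * x ^ 2 * wt (‖k‖ * x) ^ 2)) (by positivity)
    (f := fun t => 2 * k * deriv (fun z => U z t) (k ^ 2))
    (continuousOn_const.mul (continuousOn_deriv_family hq hU hx.1 (k ^ 2))) (fun t ht => ?_)
    x (right_mem_Ioc.2 hx.1)
  · refine hg.trans ?_
    have hw : 0 ≤ wt (‖k‖ * x) := (wt_pos (mul_nonneg hk hx.1.le)).le
    calc _ ≤ (Ca + Ck * C₁ * logMass q b) * (‖k‖ * x ^ 2 * wt (‖k‖ * x) ^ 2)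
          * Real.exp (Ck * logMass q b) * (wt (‖k‖ * x) * Real.exp (|k.im| * x)) := by gcongr
      _ = _ := by ring
  · have htb : t ≤ b := ht.2.trans hx.2
    have h1 := deriv_norm_sub_le hq hU hCk ht.1 (fun y hy => hU1 y ⟨hy.1, hy.2.trans htb⟩)
      fun y hy => hK t y hy.1 hy.2
    have h2 := ha t ht.1
    have h3 : weightedMass q k t ≤ logMass q b :=
      (weightedMass_le_logMass hq k ht.1).trans (logMass_mono hq ht.1 htb)
    have h4 := mul_sq_wt_sq_mono hk ht.1.le ht.2
    have hw : 0 ≤ wt (‖k‖ * t) := (wt_pos (mul_nonneg hk ht.1.le)).le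
    have h5 := norm_le_norm_add_norm_sub' (2 * k * deriv (fun z => U z t) (k ^ 2))
      (2 * k * alphaZ (k ^ 2) t)
    refine (h5.trans (add_le_add h2 h1)).trans ?_
    rw [← add_assoc]
    refine add_le_add ?_ le_rfl
    calc _ ≤ Ca * (‖k‖ * t ^ 2 * wt (‖k‖ * t) ^ 3) * Real.exp (|k.im| * t)
          + Ck * C₁ * (‖k‖ * t ^ 2 * wt (‖k‖ * t) ^ 3) * Real.exp (|k.im| * t) * logMass q b := by
          gcongr
      _ = (Ca + Ck * C₁ * logMass q b) * (‖k‖ * t ^ 2 * wt (‖k‖ * t) ^ 2)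
          * (wt (‖k‖ * t) * Real.exp (|k.im| * t)) := by ring
      _ ≤ _ := by gcongr

/-- The momentum derivative of the regular solution is close to that of the free one. -/
theorem exists_deriv_norm_sub_le (hq : AdmissiblePotential q)
    (hU : ∀ z, IsVolterraSolution q z (U z)) {b : ℝ} (hb : 0 < b) :
    ∃ C : ℝ, 0 ≤ C ∧ ∀ (k : ℂ), ∀ x ∈ Ioc 0 b,
      ‖2 * k * deriv (fun z => U z x) (k ^ 2) - 2 * k * alphaZ (k ^ 2) x‖
        ≤ C * (‖k‖ * x ^ 2 * wt (‖k‖ * x) ^ 3) * Real.exp (|k.im| * x) * weightedMass q k x := by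
  obtain ⟨Ca, hCa, ha⟩ := alpha_bound
  obtain ⟨Ck, hCk, hK⟩ := kernel_bound
  obtain ⟨C₁, hC₁, hU1⟩ := exists_solution_bound hq hU hb
  have hM : 0 ≤ logMass q b := logMass_nonneg hb.le
  set C₂ := (Ca + Ck * C₁ * logMass q b) * Real.exp (Ck * logMass q b) with hC₂
  have hC₂0 : 0 ≤ C₂ := by positivity
  refine ⟨Ck * C₁ + Ck * C₂, by positivity, fun k x hx => ?_⟩
  have hk := norm_nonneg k
  have hw : 0 ≤ wt (‖k‖ * x) := (wt_pos (mul_nonneg hk hx.1.le)).le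
  have hF2 := deriv_norm_le hq hU hb hCa hC₁ hCk (k := k) (fun x hx => (ha k x hx).2) (hU1 k)
    (hK k)
  refine (deriv_norm_sub_le hq hU hCk hx.1 (fun y hy => hU1 k y ⟨hy.1, hy.2.trans hx.2⟩)
      fun y hy => hK k x y hy.1 hy.2).trans ?_
  rw [add_mul, add_mul, add_mul]
  refine add_le_add le_rfl ?_
  rw [weightedMass, ← intervalIntegral.integral_const_mul, intervalIntegral.integral_of_le hx.1.le,
    intervalIntegral.integral_of_le hx.1.le]
  -- The a priori bound on the derivative contributes wt³ at y and the kernel one more weight. Two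
  -- of these four form the weighted mass; the other two go with |k| y², which is replaced by its
  -- value at x.
  refine integral_mono_of_nonneg ?_ ((hq.integrable_weightedMass k hx.1).const_mul _).1 ?_
  · refine (ae_restrict_mem measurableSet_Ioc).mono fun y hy => ?_
    have h1 := hy.1.le
    have h2 := log_weight_nonneg hy
    have h3 : 0 ≤ wt (‖k‖ * y) := (wt_pos (mul_nonneg hk h1)).le
    simp only [Pi.zero_apply]
    positivity
  · refine (ae_restrict_mem measurableSet_Ioc).mono fun y hy => ?_
    have h1 := hy.1.le
    have h2 := log_weight_nonneg hy
    have h3 : 0 ≤ wt (‖k‖ * y) := (wt_pos (mul_nonneg hk h1)).le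
    have hexp : Real.exp (|k.im| * (x - y)) * Real.exp (|k.im| * y) = Real.exp (|k.im| * x) := by
      rw [← Real.exp_add]; congr 1; ring
    have h4 := mul_sq_wt_sq_mono hk h1 hy.2
    have h5 := hF2 y ⟨hy.1, hy.2.trans hx.2⟩
    calc y * (Ck * (wt (‖k‖ * x) * wt (‖k‖ * y)) * (1 + Real.log (x / y))
          * Real.exp (|k.im| * (x - y)) * ‖2 * k * deriv (fun z => U z y) (k ^ 2)‖) * |q y|
        ≤ y * (Ck * (wt (‖k‖ * x) * wt (‖k‖ * y)) * (1 + Real.log (x / y))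
          * Real.exp (|k.im| * (x - y)) * (C₂ * (‖k‖ * y ^ 2 * wt (‖k‖ * y) ^ 3)
          * Real.exp (|k.im| * y))) * |q y| := by gcongr
      _ = Ck * C₂ * (wt (‖k‖ * x) * (‖k‖ * y ^ 2 * wt (‖k‖ * y) ^ 2)) * Real.exp (|k.im| * x)
          * (y * (wt (‖k‖ * y) ^ 2 * (1 + Real.log (x / y))) * |q y|) := by rw [← hexp]; ring
      _ ≤ Ck * C₂ * (wt (‖k‖ * x) * (‖k‖ * x ^ 2 * wt (‖k‖ * x) ^ 2)) * Real.exp (|k.im| * x)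
          * (y * (wt (‖k‖ * y) ^ 2 * (1 + Real.log (x / y))) * |q y|) := by gcongr
      _ = _ := by ring

end

/-! ### Return to φ and to the variable k -/

theorem hasDerivAt_comp_sq {f : ℂ → ℂ} {k f' : ℂ} (hf : HasDerivAt f f' (k ^ 2)) :
    HasDerivAt (fun κ : ℂ => f (κ ^ 2)) (2 * k * f') k := by
  have h := hf.comp k (hasDerivAt_pow 2 k)
  refine h.congr_deriv ?_
  simp
  ring

theorem hasDerivAt_phi0_sq (k : ℂ) (x : ℝ) :
    HasDerivAt (fun κ : ℂ => phi0 (κ ^ 2) x) (rt x * (2 * k * alphaZ (k ^ 2) x)) k := by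
  simp_rw [phi0_eq]
  exact (hasDerivAt_comp_sq (hasDerivAt_alphaZ (k ^ 2) x)).const_mul (rt x)

theorem hasDerivAt_green0_sq (k : ℂ) {x y : ℝ} (hx : 0 < x) (hy : 0 < y) :
    HasDerivAt (fun κ : ℂ => green0 (κ ^ 2) x y)
      (rt x * rt y * (2 / Real.pi) * (2 * k * kernelZ (k ^ 2) x y)) k := by
  simp_rw [green0_eq _ hx hy]
  exact (hasDerivAt_comp_sq (hasDerivAt_kernelZ (k ^ 2) x y)).const_mul
    (rt x * rt y * (2 / Real.pi))

section
variable {q : ℝ → ℝ} {φ : ℂ → ℝ → ℂ}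

theorem IsRegularSolution.hasDerivAt (hq : AdmissiblePotential q) (hφ : IsRegularSolution q φ)
    (z : ℂ) {x : ℝ} (hx : 0 < x) :
    HasDerivAt (fun z => φ z x) (rt x * deriv (fun z => reduced (φ z) x) z) z := by
  have h := (hasDerivAt_volterra_family hq (U := fun z => reduced (φ z))
    (fun z => hφ.isVolterraSolution hq z) hx z (right_mem_Icc.2 hx.le)).differentiableAt.hasDerivAt
  refine (h.const_mul (rt x)).congr_of_eventuallyEq (Filter.Eventually.of_forall fun z => ?_)
  exact eq_rt_mul_reduced (φ z) hx

theorem IsRegularSolution.hasDerivAt_sq (hq : AdmissiblePotential q) (hφ : IsRegularSolution q φ)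
    (k : ℂ) {x : ℝ} (hx : 0 < x) :
    HasDerivAt (fun κ : ℂ => φ (κ ^ 2) x)
      (rt x * (2 * k * deriv (fun z => reduced (φ z) x) (k ^ 2))) k :=
  (hasDerivAt_comp_sq (hφ.hasDerivAt hq (k ^ 2) hx)).congr_deriv (by ring)

/-- The integrand of the differentiated integral equation in terms of the reduced solution. -/
theorem IsRegularSolution.integrand_eq (hq : AdmissiblePotential q) (hφ : IsRegularSolution q φ)
    (k : ℂ) {x y : ℝ} (hy : y ∈ Ioc 0 x) :
    (deriv (fun κ : ℂ => green0 (κ ^ 2) x y) k * φ (k ^ 2) y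
      + green0 (k ^ 2) x y * deriv (fun κ : ℂ => φ (κ ^ 2) y) k) * (q y : ℂ)
    = rt x * (2 * k) * ((y : ℂ) * (kernelZ (k ^ 2) x y * reduced (φ (k ^ 2)) y
      + kernel (k ^ 2) x y * deriv (fun z => reduced (φ z) y) (k ^ 2)) * (q y : ℂ)) := by
  have hx := hy.1.trans_le hy.2
  have hπ : (Real.pi : ℂ) ≠ 0 := by exact_mod_cast Real.pi_ne_zero
  -- The normalisation √(πy/2)² · (2/π) = y accounts for the factor y in the reduced integral
  -- equation.
  have h : rt y * rt y * (2 / Real.pi) = y := by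
    rw [← pow_two, rt_sq hy.1.le]
    field_simp
  rw [(hasDerivAt_green0_sq k hx hy.1).deriv, (hφ.hasDerivAt_sq hq k hy.1).deriv,
    green0_eq _ hx hy.1, eq_rt_mul_reduced (φ (k ^ 2)) hy.1]
  rw [← h]
  simp only [rt]
  ring

theorem IsRegularSolution.deriv_integral_equation (hq : AdmissiblePotential q)
    (hφ : IsRegularSolution q φ) (k : ℂ) {x : ℝ} (hx : 0 < x) :
    IntervalIntegrable
      (fun y : ℝ =>
        (deriv (fun κ : ℂ => green0 (κ ^ 2) x y) k * φ (k ^ 2) y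
          + green0 (k ^ 2) x y * deriv (fun κ : ℂ => φ (κ ^ 2) y) k) * (q y : ℂ)) volume 0 x ∧
    deriv (fun κ : ℂ => φ (κ ^ 2) x) k
      = deriv (fun κ : ℂ => phi0 (κ ^ 2) x) k
        + ∫ y in (0 : ℝ)..x,
            (deriv (fun κ : ℂ => green0 (κ ^ 2) x y) k * φ (k ^ 2) y
              + green0 (k ^ 2) x y * deriv (fun κ : ℂ => φ (κ ^ 2) y) k) * (q y : ℂ) := by
  obtain ⟨h1, h2⟩ := deriv_green_equation hq (U := fun z => reduced (φ z))
    (fun z => hφ.isVolterraSolution hq z) hx (k ^ 2)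
  constructor
  · refine (h1.const_mul (rt x * (2 * k))).congr fun y hy => ?_
    rw [uIoc_of_le hx.le] at hy
    exact (hφ.integrand_eq hq k hy).symm
  · rw [(hφ.hasDerivAt_sq hq k hx).deriv, (hasDerivAt_phi0_sq k x).deriv, h2,
      intervalIntegral.integral_congr_ae (ae_of_all _ fun y hy => hφ.integrand_eq hq k
        (by rwa [uIoc_of_le hx.le] at hy)), intervalIntegral.integral_const_mul]
    ring

/-- The prefactor √x raises x² to x · x^(3/2), which matches wt³ = (1 + |k|x)^(−3/2) and yields the
power 3/2 in the estimate. -/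
theorem sqrt_mul_wt_cube {K x : ℝ} (hK : 0 ≤ K) (hx : 0 < x) :
    Real.sqrt (Real.pi * x / 2) * (K * x ^ 2 * wt (K * x) ^ 3)
      = Real.sqrt (Real.pi / 2) * (K * x * (x / (1 + K * x)) ^ (3 / 2 : ℝ)) := by
  have h1 : 0 < 1 + K * x := by positivity
  have h2 : ∀ t : ℝ, 0 ≤ t → t ^ (3 / 2 : ℝ) = Real.sqrt t ^ 3 := fun t ht => by
    rw [Real.sqrt_eq_rpow, ← Real.rpow_natCast, ← Real.rpow_mul ht]
    norm_num
  rw [h2 _ (by positivity), Real.sqrt_div hx.le, mul_div_right_comm, Real.sqrt_mul (by positivity),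
    wt, div_pow, inv_pow]
  have h3 : Real.sqrt x ^ 3 = x * Real.sqrt x := by rw [pow_succ, Real.sq_sqrt hx.le]
  rw [h3]
  ring

theorem weightedMass_eq (q : ℝ → ℝ) (k : ℂ) {x : ℝ} (hx : 0 ≤ x) : weightedMass q k x
    = ∫ y in (0 : ℝ)..x, y / (1 + ‖k‖ * y) * (1 + Real.log (x / y)) * |q y| := by
  refine intervalIntegral.integral_congr fun y hy => ?_
  rw [uIcc_of_le hx] at hy
  rw [wt_sq (mul_nonneg (norm_nonneg _) hy.1)]
  ring

theorem IsRegularSolution.deriv_estimate (hq : AdmissiblePotential q) (hφ : IsRegularSolution q φ)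
    {b : ℝ} (hb : 0 < b) : ∃ C : ℝ, ∀ (k : ℂ) (x : ℝ), 0 < x → x ≤ b →
      ‖deriv (fun κ : ℂ => φ (κ ^ 2) x) k - deriv (fun κ : ℂ => phi0 (κ ^ 2) x) k‖
        ≤ C * ‖k‖ * x * (x / (1 + ‖k‖ * x)) ^ (3 / 2 : ℝ) * Real.exp (|k.im| * x)
          * ∫ y in (0 : ℝ)..x, y / (1 + ‖k‖ * y) * (1 + Real.log (x / y)) * |q y| := by
  obtain ⟨C, -, h⟩ := exists_deriv_norm_sub_le hq (U := fun z => reduced (φ z))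
    (fun z => hφ.isVolterraSolution hq z) hb
  refine ⟨Real.sqrt (Real.pi / 2) * C, fun k x hx hxb => ?_⟩
  rw [(hφ.hasDerivAt_sq hq k hx).deriv, (hasDerivAt_phi0_sq k x).deriv, ← mul_sub, norm_mul, rt,
    Complex.norm_real, Real.norm_of_nonneg (Real.sqrt_nonneg _), ← weightedMass_eq q k hx.le]
  refine (mul_le_mul_of_nonneg_left (h k x ⟨hx, hxb⟩) (Real.sqrt_nonneg _)).trans_eq ?_
  calc _ = C * (Real.sqrt (Real.pi * x / 2) * (‖k‖ * x ^ 2 * wt (‖k‖ * x) ^ 3))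
        * Real.exp (|k.im| * x) * weightedMass q k x := by ring
    _ = _ := by rw [sqrt_mul_wt_cube (norm_nonneg k) hx]; ring

end

end RadialSchrodinger

end

theorem lemma2p4 (q : ℝ → ℝ) (hq : RadialSchrodinger.AdmissiblePotential q) :
    (∃ φ : ℂ → ℝ → ℂ, RadialSchrodinger.IsRegularSolution q φ) ∧
    ∀ φ : ℂ → ℝ → ℂ, RadialSchrodinger.IsRegularSolution q φ →
      -- the derivatives with respect to `k` below exist
      (∀ x : ℝ, 0 < x → Differentiable ℂ (fun z : ℂ => φ z x)) ∧
      (∀ x : ℝ, 0 < x → Differentiable ℂ (fun k : ℂ => RadialSchrodinger.phi0 (k ^ 2) x)) ∧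
      (∀ x y : ℝ, 0 < y → y ≤ x →
        Differentiable ℂ (fun k : ℂ => RadialSchrodinger.green0 (k ^ 2) x y)) ∧
      -- the integral equation, with an absolutely convergent integral
      (∀ (k : ℂ) (x : ℝ), 0 < x →
        IntervalIntegrable
          (fun y : ℝ =>
            (deriv (fun κ : ℂ => RadialSchrodinger.green0 (κ ^ 2) x y) k * φ (k ^ 2) y
              + RadialSchrodinger.green0 (k ^ 2) x y * deriv (fun κ : ℂ => φ (κ ^ 2) y) k)
              * (q y : ℂ)) volume 0 x ∧
        deriv (fun κ : ℂ => φ (κ ^ 2) x) k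
          = deriv (fun κ : ℂ => RadialSchrodinger.phi0 (κ ^ 2) x) k
            + ∫ y in (0 : ℝ)..x,
                (deriv (fun κ : ℂ => RadialSchrodinger.green0 (κ ^ 2) x y) k * φ (k ^ 2) y
                  + RadialSchrodinger.green0 (k ^ 2) x y * deriv (fun κ : ℂ => φ (κ ^ 2) y) k)
                  * (q y : ℂ)) ∧
      -- the estimate
      (∀ b : ℝ, 0 < b → ∃ C : ℝ, ∀ (k : ℂ) (x : ℝ), 0 < x → x ≤ b →
        ‖deriv (fun κ : ℂ => φ (κ ^ 2) x) k
            - deriv (fun κ : ℂ => RadialSchrodinger.phi0 (κ ^ 2) x) k‖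
          ≤ C * ‖k‖ * x * (x / (1 + ‖k‖ * x)) ^ (3 / 2 : ℝ) * Real.exp (|k.im| * x)
            * ∫ y in (0 : ℝ)..x,
                y / (1 + ‖k‖ * y) * (1 + Real.log (x / y)) * |q y|) := by
  refine ⟨RadialSchrodinger.exists_isRegularSolution hq, fun φ hφ => ⟨?_, ?_, ?_, ?_, ?_⟩⟩
  · exact fun x hx z => (hφ.hasDerivAt hq z hx).differentiableAt
  · exact fun x _ k => (RadialSchrodinger.hasDerivAt_phi0_sq k x).differentiableAt
  · exact fun x y hy hyx k =>
      (RadialSchrodinger.hasDerivAt_green0_sq k (hy.trans_le hyx) hy).differentiableAt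
  · exact fun k x hx => hφ.deriv_integral_equation hq k hx
  · exact fun b hb => hφ.deriv_estimate hq hb
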